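/- Let $\mathcal C$ be a small site with fibre products, $\mathcal R$ a sheaf of rings on $\mathcal C$, and $\varphi\colon V\to U$ a morphism which generates a covering sieve of $U$. Let $C_n=V\times_U\cdots\times_U V$ ($n+1$ factors) be the Čech nerve of $\varphi$, a simplicial object over $U$, and for an object $W$ of $\mathcal C$ let $\mathbf{Sh}_{\mathcal R|_W}$ be the abelian category of sheaves of $\mathcal R|_W$-modules on the site $\mathcal C/W$. Let $\Omega_\varphi$ be the diagram of abelian categories $[n]\mapsto \mathbf{Sh}_{\mathcal R|_{C_n}}$ indexed by the simplex category $\Delta$, where $\theta\colon[n]\to[m]$ acts by the (exact) restriction functor $\Omega_\varphi(\theta)$ along $C_m\to C_n$. Its lax limit $\mathfrak L(\Omega_\varphi)$ is the following abelian category. An object is a family of objects $x_n\in\mathbf{Sh}_{\mathcal R|_{C_n}}$ with morphisms $u^\theta\colon \Omega_\varphi(\theta)(x_n)\to x_m$ for all $\theta\colon[n]\to[m]$, such that (modulo the canonical isomorphisms) $u^{\mathrm{id}}=\mathrm{id}$ and $u^{\delta\theta}=u^\delta\circ\Omega_\varphi(\delta)(u^\theta)$; a morphism is a family of morphisms $x_n\to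 x'_n$ compatible with the $u^\theta$. For an abelian category $\mathcal A$ let $\mathrm{Ch}_+(\mathcal A)$ be the category of non-negatively graded chain complexes in $\mathcal A$, and $D_+(\mathcal A)$ its localization at the quasi-isomorphisms. Let $\Gamma_\varphi$ be the diagram $[n]\mapsto \mathrm{Ch}_+(\mathbf{Sh}_{\mathcal R|_{C_n}})$, and identify $\mathrm{Ch}_+(\mathfrak L(\Omega_\varphi))$ with the lax limit $\mathfrak L(\Gamma_\varphi)$ of $\Gamma_\varphi$, defined in the same way. Let $\mathbf{LAX}(\Gamma_\varphi)\subset\mathfrak L(\Gamma_\varphi)$ be the full subcategory of those objects whose structure maps $u^\theta$ are all quasi-isomorphisms, and let $\mathrm{Ho}(\mathbf{LAX}(\Gamma_\varphi))$ be its localization at the levelwise quasi-isomorphisms. Restriction to the $C_n$ defines a functor $r^*\colon \mathrm{Ch}_+(\mathbf{Sh}_{\mathcal R|_U})\to \mathrm{Ch}_+(\mathfrak L(\Omega_\varphi))$ which preserves quasi-isomorphisms, and hence a functor $r^*\colon D_+(\mathbf{Sh}_{\mathcal R|_U})\to D_+(\mathfrak L(\Omega_\varphi))$. The essential image of the latter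 is identified with $\mathbf{LAX}(\Gamma_\varphi)$, in the following sense. 1. A complex $E\in \mathrm{Ch}_+(\mathfrak L(\Omega_\varphi))=\mathfrak L(\Gamma_\varphi)$ is isomorphic in $D_+(\mathfrak L(\Omega_\varphi))$ to $r^*F$ for some $F\in D_+(\mathbf{Sh}_{\mathcal R|_U})$ if and only if $E$ belongs to $\mathbf{LAX}(\Gamma_\varphi)$. 2. The canonical functor $\mathrm{Ho}(\mathbf{LAX}(\Gamma_\varphi))\to D_+(\mathfrak L(\Omega_\varphi))$ is fully faithful, and its essential image is the essential image of $r^*$. -/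

import Mathlib

open CategoryTheory Limits Opposite

universe w u' v u

noncomputable section

namespace LaxDescent

/-! ### Diagrams of categories and their lax limits -/

/-- A diagram of categories indexed by `I`: a pseudofunctor from `I` to categories, i.e. functors
`map θ : obj i ⥤ obj j` for `θ : i ⟶ j`, which respect identities and compositions up to
specified coherent natural isomorphisms. -/
structure CatDiagram (I : Type u) [Category.{v} I] where
  /-- the categories -/
  obj : I → Type u'
  /-- the category structures -/
  cat (i : I) : Category.{w} (obj i)
  /-- the transition functors -/
  map {i j : I} (θ : i ⟶ j) : obj i ⥤ obj j
  /-- compatibility with identities -/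
  mapId (i : I) : map (𝟙 i) ≅ 𝟭 (obj i)
  /-- compatibility with composition -/
  mapComp {i j k : I} (θ : i ⟶ j) (δ : j ⟶ k) : map (θ ≫ δ) ≅ map θ ⋙ map δ
  mapComp_id_left {i j : I} (θ : i ⟶ j) (x : obj i) :
    (mapComp (𝟙 i) θ).hom.app x ≫ (map θ).map ((mapId i).hom.app x) =
      eqToHom (by rw [Category.id_comp]; rfl)
  mapComp_id_right {i j : I} (θ : i ⟶ j) (x : obj i) :
    (mapComp θ (𝟙 j)).hom.app x ≫ (mapId j).hom.app ((map θ).obj x) =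
      eqToHom (by rw [Category.comp_id]; rfl)
  mapComp_assoc {i j k l : I} (θ : i ⟶ j) (δ : j ⟶ k) (ε : k ⟶ l) (x : obj i) :
    (mapComp (θ ≫ δ) ε).hom.app x ≫ (map ε).map ((mapComp θ δ).hom.app x) =
      eqToHom (by rw [Category.assoc]) ≫ (mapComp θ (δ ≫ ε)).hom.app x ≫
        (mapComp δ ε).hom.app ((map θ).obj x)

attribute [instance] CatDiagram.cat

section LaxLimit

variable {I : Type u} [Category.{v} I] (M : CatDiagram.{w, u'} I)

/-- An object of the lax limit of `M`: a family of objects `x i` of `M i` with structure maps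
`u θ : M(θ)(x i) ⟶ x j` which are compatible with identities and composition. -/
structure LaxLimit where
  /-- the components -/
  x (i : I) : M.obj i
  /-- the structure maps -/
  u {i j : I} (θ : i ⟶ j) : (M.map θ).obj (x i) ⟶ x j
  u_id (i : I) : u (𝟙 i) = (M.mapId i).hom.app (x i)
  u_comp {i j k : I} (θ : i ⟶ j) (δ : j ⟶ k) :
    u (θ ≫ δ) = (M.mapComp θ δ).hom.app (x i) ≫ (M.map δ).map (u θ) ≫ u δ

namespace LaxLimit

variable {M}

/-- A morphism in the lax limit: a family of morphisms commuting with the structure maps. -/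
@[ext]
structure Hom (E E' : LaxLimit M) where
  /-- the components -/
  app (i : I) : E.x i ⟶ E'.x i
  comm {i j : I} (θ : i ⟶ j) : (M.map θ).map (app i) ≫ E'.u θ = E.u θ ≫ app j

lemma Hom.comm_assoc {E E' : LaxLimit M} (f : Hom E E') {i j : I} (θ : i ⟶ j) {y : M.obj j}
    (g : E'.x j ⟶ y) : (M.map θ).map (f.app i) ≫ E'.u θ ≫ g = E.u θ ≫ f.app j ≫ g := by
  rw [← Category.assoc, f.comm, Category.assoc]

instance : Category (LaxLimit M) where
  Hom := Hom
  id E := { app := fun i => 𝟙 (E.x i), comm := by simp }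
  comp f g :=
    { app := fun i => f.app i ≫ g.app i
      comm := fun θ => by
        rw [Functor.map_comp, Category.assoc, g.comm, f.comm_assoc] }
  id_comp f := Hom.ext (funext fun i => Category.id_comp (f.app i))
  comp_id f := Hom.ext (funext fun i => Category.comp_id (f.app i))
  assoc f g h := Hom.ext (funext fun i => Category.assoc (f.app i) (g.app i) (h.app i))

@[ext]
lemma hom_ext {E E' : LaxLimit M} {f g : E ⟶ E'} (h : ∀ i, f.app i = g.app i) : f = g :=
  Hom.ext (funext h)

@[simp] lemma id_app (E : LaxLimit M) (i : I) : Hom.app (𝟙 E) i = 𝟙 (E.x i) := rfl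

@[simp] lemma comp_app {E E' E'' : LaxLimit M} (f : E ⟶ E') (g : E' ⟶ E'') (i : I) :
    (f ≫ g).app i = f.app i ≫ g.app i := rfl

variable (M) in
/-- The projection of the lax limit to `M i`. -/
@[simps]
def ev (i : I) : LaxLimit M ⥤ M.obj i where
  obj E := E.x i
  map f := f.app i

/-- Isomorphisms in the lax limit can be built levelwise. -/
@[simps]
def isoMk {E E' : LaxLimit M} (e : ∀ i, E.x i ≅ E'.x i)
    (comm : ∀ {i j : I} (θ : i ⟶ j),
      (M.map θ).map (e i).hom ≫ E'.u θ = E.u θ ≫ (e j).hom) : E ≅ E' where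
  hom := { app := fun i => (e i).hom, comm := comm }
  inv :=
    { app := fun i => (e i).inv
      comm := fun {i j} θ => by
        rw [← cancel_mono (e j).hom, Category.assoc, Category.assoc, ← comm θ,
          ← Functor.map_comp_assoc]
        simp }
  hom_inv_id := by ext i; simp
  inv_hom_id := by ext i; simp

lemma isIso_of_app {E E' : LaxLimit M} (f : E ⟶ E') (h : ∀ i, IsIso (f.app i)) : IsIso f := by
  have : f = (isoMk (fun i => asIso (f.app i)) (fun θ => f.comm θ)).hom := rfl
  rw [this]
  infer_instance

/-! #### Additive structure -/

section Preadditive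

variable [∀ i : I, Preadditive (M.obj i)] [∀ {i j : I} (θ : i ⟶ j), (M.map θ).Additive]

instance (E E' : LaxLimit M) : Zero (E ⟶ E') where
  zero := { app := fun i => 0, comm := fun θ => by simp }

instance (E E' : LaxLimit M) : Add (E ⟶ E') where
  add f g :=
    { app := fun i => f.app i + g.app i
      comm := fun θ => by
        rw [Functor.map_add, Preadditive.add_comp, Preadditive.comp_add, f.comm, g.comm] }

instance (E E' : LaxLimit M) : Neg (E ⟶ E') where
  neg f :=
    { app := fun i => -f.app i
      comm := fun θ => by
        rw [Functor.map_neg, Preadditive.neg_comp, Preadditive.comp_neg, f.comm] }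

@[simp] lemma zero_app (E E' : LaxLimit M) (i : I) : (0 : E ⟶ E').app i = 0 := rfl

@[simp] lemma add_app {E E' : LaxLimit M} (f g : E ⟶ E') (i : I) :
    (f + g).app i = f.app i + g.app i := rfl

@[simp] lemma neg_app {E E' : LaxLimit M} (f : E ⟶ E') (i : I) : (-f).app i = -f.app i := rfl

instance (E E' : LaxLimit M) : AddCommGroup (E ⟶ E') where
  add_assoc f g h := by ext i; simp [add_assoc]
  zero_add f := by ext i; simp
  add_zero f := by ext i; simp
  neg_add_cancel f := by ext i; simp
  add_comm f g := by ext i; simp [add_comm]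
  nsmul := nsmulRec
  zsmul := zsmulRec

instance : Preadditive (LaxLimit M) where

instance (i : I) : (ev M i).Additive where

end Preadditive

/-! #### Levelwise limits and colimits -/

section Limits

variable (M) in
/-- The structure maps of lax sections, as a natural transformation. -/
@[simps]
def structureMap {i j : I} (θ : i ⟶ j) : ev M i ⋙ M.map θ ⟶ ev M j where
  app E := E.u θ
  naturality _ _ f := f.comm θ

variable {J : Type*} [Category J] (K : J ⥤ LaxLimit M)

section

variable [∀ i : I, HasLimitsOfShape J (M.obj i)]

/-- The structure map of the levelwise limit. -/
def limU {i j : I} (θ : i ⟶ j) : (M.map θ).obj (limit (K ⋙ ev M i)) ⟶ limit (K ⋙ ev M j) :=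
  limit.lift (K ⋙ ev M j) ((Cone.postcompose (Functor.whiskerLeft K (structureMap M θ))).obj
    ((M.map θ).mapCone (limit.cone (K ⋙ ev M i))))

lemma limU_π {i j : I} (θ : i ⟶ j) (a : J) :
    limU K θ ≫ limit.π (K ⋙ ev M j) a =
      (M.map θ).map (limit.π (K ⋙ ev M i) a) ≫ (structureMap M θ).app (K.obj a) := by
  simp [limU]

/-- The levelwise limit. -/
@[simps]
def lim : LaxLimit M where
  x i := limit (K ⋙ ev M i)
  u θ := limU K θ
  u_id i := by
    apply limit.hom_ext
    intro a
    rw [limU_π]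
    exact (congrArg _ ((K.obj a).u_id i)).trans
      ((M.mapId i).hom.naturality (limit.π (K ⋙ ev M i) a))
  u_comp {i j k} θ δ := by
    apply limit.hom_ext
    intro a
    rw [limU_π, Category.assoc, Category.assoc, limU_π, ← Functor.map_comp_assoc, limU_π,
      Functor.map_comp, Category.assoc]
    have h := (M.mapComp θ δ).hom.naturality_assoc (limit.π (K ⋙ ev M i) a)
      ((M.map δ).map ((structureMap M θ).app (K.obj a)) ≫ (structureMap M δ).app (K.obj a))
    exact (congrArg _ ((K.obj a).u_comp θ δ)).trans h

/-- The levelwise limit cone. -/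
def limCone : Cone K where
  pt := lim K
  π :=
    { app a :=
        { app i := limit.π (K ⋙ ev M i) a
          comm θ := (limU_π K θ a).symm }
      naturality a b f := by
        ext i
        exact (Category.id_comp _).trans (limit.w (K ⋙ ev M i) f).symm }

/-- The levelwise limit cone is a limit cone. -/
def limConeIsLimit : IsLimit (limCone K) where
  lift s :=
    { app i := limit.lift (K ⋙ ev M i) ((ev M i).mapCone s)
      comm {i j} θ := by
        have h : (M.map θ).map (limit.lift (K ⋙ ev M i) ((ev M i).mapCone s)) ≫ limU K θ =
            (structureMap M θ).app s.pt ≫ limit.lift (K ⋙ ev M j) ((ev M j).mapCone s) := by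
          apply limit.hom_ext
          intro a
          rw [Category.assoc, limU_π, ← Functor.map_comp_assoc, Category.assoc, limit.lift_π,
            limit.lift_π]
          exact (s.π.app a).comm θ
        exact h }
  fac s a := by
    ext i
    exact limit.lift_π ((ev M i).mapCone s) a
  uniq s m hm := by
    ext i
    apply limit.hom_ext
    intro a
    refine Eq.trans ?_ (limit.lift_π ((ev M i).mapCone s) a).symm
    exact congrArg (fun f => Hom.app f i) (hm a)

instance : HasLimitsOfShape J (LaxLimit M) where
  has_limit K := ⟨⟨_, limConeIsLimit K⟩⟩

instance (i : I) : PreservesLimitsOfShape J (ev M i) where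
  preservesLimit {K} := preservesLimit_of_preserves_limit_cone (limConeIsLimit K)
    (IsLimit.ofIsoLimit (limit.isLimit (K ⋙ ev M i)) (Cone.ext (Iso.refl _)
      (fun a => (Category.id_comp _).symm)))

end

section

variable [∀ i : I, HasColimitsOfShape J (M.obj i)]
  [∀ {i j : I} (θ : i ⟶ j), PreservesColimitsOfShape J (M.map θ)]

variable (M) in
lemma colim_hom_ext {i j : I} (θ : i ⟶ j) (D : J ⥤ M.obj i) {y : M.obj j}
    {f g : (M.map θ).obj (colimit D) ⟶ y}
    (h : ∀ a, (M.map θ).map (colimit.ι D a) ≫ f = (M.map θ).map (colimit.ι D a) ≫ g) : f = g :=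
  (isColimitOfPreserves (M.map θ) (colimit.isColimit D)).hom_ext h

/-- The structure map of the levelwise colimit. -/
def colimU {i j : I} (θ : i ⟶ j) :
    (M.map θ).obj (colimit (K ⋙ ev M i)) ⟶ colimit (K ⋙ ev M j) :=
  (isColimitOfPreserves (M.map θ) (colimit.isColimit (K ⋙ ev M i))).desc
    ((Cocone.precompose (Functor.whiskerLeft K (structureMap M θ))).obj
      (colimit.cocone (K ⋙ ev M j)))

lemma ι_colimU {i j : I} (θ : i ⟶ j) (a : J) :
    (M.map θ).map (colimit.ι (K ⋙ ev M i) a) ≫ colimU K θ =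
      (structureMap M θ).app (K.obj a) ≫ colimit.ι (K ⋙ ev M j) a :=
  (isColimitOfPreserves (M.map θ) (colimit.isColimit (K ⋙ ev M i))).fac _ a

lemma ι_colimU_assoc {i j : I} (θ : i ⟶ j) (a : J) {y : M.obj j}
    (f : colimit (K ⋙ ev M j) ⟶ y) :
    (M.map θ).map (colimit.ι (K ⋙ ev M i) a) ≫ colimU K θ ≫ f =
      (structureMap M θ).app (K.obj a) ≫ colimit.ι (K ⋙ ev M j) a ≫ f := by
  rw [← Category.assoc, ι_colimU, Category.assoc]

/-- The levelwise colimit. -/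
@[simps]
def colim : LaxLimit M where
  x i := colimit (K ⋙ ev M i)
  u θ := colimU K θ
  u_id i := by
    apply colim_hom_ext
    intro a
    rw [ι_colimU]
    exact (congrArg (· ≫ _) ((K.obj a).u_id i)).trans
      ((M.mapId i).hom.naturality (colimit.ι (K ⋙ ev M i) a)).symm
  u_comp {i j k} θ δ := by
    apply colim_hom_ext
    intro a
    rw [ι_colimU]
    have h := (M.mapComp θ δ).hom.naturality_assoc (colimit.ι (K ⋙ ev M i) a)
      ((M.map δ).map (colimU K θ) ≫ colimU K δ)
    refine Eq.trans ?_ h.symm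
    dsimp
    rw [← Functor.map_comp_assoc, ι_colimU, Functor.map_comp_assoc, ι_colimU]
    exact (congrArg (· ≫ _) ((K.obj a).u_comp θ δ)).trans
      ((Category.assoc _ _ _).trans (congrArg _ (Category.assoc _ _ _)))

/-- The levelwise colimit cocone. -/
def colimCocone : Cocone K where
  pt := colim K
  ι :=
    { app a :=
        { app i := colimit.ι (K ⋙ ev M i) a
          comm θ := ι_colimU K θ a }
      naturality a b f := by
        ext i
        exact (colimit.w (K ⋙ ev M i) f).trans (Category.comp_id _).symm }

/-- The levelwise colimit cocone is a colimit cocone. -/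
def colimCoconeIsColimit : IsColimit (colimCocone K) where
  desc s :=
    { app i := colimit.desc (K ⋙ ev M i) ((ev M i).mapCocone s)
      comm {i j} θ := by
        have h : (M.map θ).map (colimit.desc (K ⋙ ev M i) ((ev M i).mapCocone s)) ≫
              (structureMap M θ).app s.pt =
            colimU K θ ≫ colimit.desc (K ⋙ ev M j) ((ev M j).mapCocone s) := by
          apply colim_hom_ext
          intro a
          rw [ι_colimU_assoc, ← Functor.map_comp_assoc, colimit.ι_desc, colimit.ι_desc]
          exact (s.ι.app a).comm θ
        exact h }
  fac s a := by
    ext i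
    exact colimit.ι_desc ((ev M i).mapCocone s) a
  uniq s m hm := by
    ext i
    apply colimit.hom_ext
    intro a
    refine Eq.trans ?_ (colimit.ι_desc ((ev M i).mapCocone s) a).symm
    exact congrArg (fun f => Hom.app f i) (hm a)

instance : HasColimitsOfShape J (LaxLimit M) where
  has_colimit K := ⟨⟨_, colimCoconeIsColimit K⟩⟩

instance (i : I) : PreservesColimitsOfShape J (ev M i) where
  preservesColimit {K} := preservesColimit_of_preserves_colimit_cocone (colimCoconeIsColimit K)
    (IsColimit.ofIsoColimit (colimit.isColimit (K ⋙ ev M i)) (Cocone.ext (Iso.refl _)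
      (fun a => Category.comp_id _)))

end

end Limits

/-! #### The lax limit of a diagram of abelian categories -/

section Abelian

variable [∀ i : I, Abelian (M.obj i)] [∀ {i j : I} (θ : i ⟶ j), (M.map θ).Additive]
  [∀ {i j : I} (θ : i ⟶ j), PreservesFiniteColimits (M.map θ)]

instance : HasFiniteLimits (LaxLimit M) := ⟨fun _ => inferInstance⟩

instance : HasFiniteColimits (LaxLimit M) := ⟨fun _ => inferInstance⟩

instance (i : I) : PreservesFiniteLimits (ev M i) := ⟨fun _ => inferInstance⟩

instance (i : I) : PreservesFiniteColimits (ev M i) := ⟨fun _ => inferInstance⟩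

instance : Abelian (LaxLimit M) := by
  haveI : ∀ {E E' : LaxLimit M} (f : E ⟶ E'), IsIso (Abelian.coimageImageComparison f) := by
    intro E E' f
    apply isIso_of_app
    intro i
    change IsIso ((ev M i).map (Abelian.coimageImageComparison f))
    exact (Arrow.isIso_iff_isIso_of_isIso
      (Abelian.PreservesCoimageImageComparison.iso (ev M i) f).hom).2
        (inferInstanceAs (IsIso (Abelian.coimageImageComparison ((ev M i).map f))))
  haveI : HasFiniteProducts (LaxLimit M) := inferInstance
  exact Abelian.ofCoimageImageComparisonIsIso

end Abelian

/-! #### Complexes in a lax limit and lax limits of categories of complexes -/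

section Chain

variable [∀ i : I, Abelian (M.obj i)] [∀ {i j : I} (θ : i ⟶ j), (M.map θ).Additive]

variable (M) in
/-- The diagram of the categories of non-negatively graded chain complexes in a diagram of abelian
categories. -/
@[simps obj map]
def _root_.LaxDescent.chainDiagram : CatDiagram.{w, max u' w} I where
  obj i := ChainComplex (M.obj i) ℕ
  cat i := inferInstance
  map θ := (M.map θ).mapHomologicalComplex (ComplexShape.down ℕ)
  mapId i := NatIso.mapHomologicalComplex (M.mapId i) (ComplexShape.down ℕ)
  mapComp θ δ := NatIso.mapHomologicalComplex (M.mapComp θ δ) _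
  mapComp_id_left θ x := by
    refine HomologicalComplex.hom_ext _ _ fun n => ?_
    exact (M.mapComp_id_left θ (x.X n)).trans (HomologicalComplex.eqToHom_f
      (show ((M.map (𝟙 _ ≫ θ)).mapHomologicalComplex (ComplexShape.down ℕ)).obj x =
        ((M.map θ).mapHomologicalComplex _).obj x by rw [Category.id_comp]) n).symm
  mapComp_id_right θ x := by
    refine HomologicalComplex.hom_ext _ _ fun n => ?_
    exact (M.mapComp_id_right θ (x.X n)).trans (HomologicalComplex.eqToHom_f
      (show ((M.map (θ ≫ 𝟙 _)).mapHomologicalComplex (ComplexShape.down ℕ)).obj x =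
        ((M.map θ).mapHomologicalComplex _).obj x by rw [Category.comp_id]) n).symm
  mapComp_assoc θ δ ε x := by
    refine HomologicalComplex.hom_ext _ _ fun n => ?_
    refine (M.mapComp_assoc θ δ ε (x.X n)).trans ?_
    rw [HomologicalComplex.comp_f, HomologicalComplex.eqToHom_f]
    rfl

/-- A complex of lax sections, viewed as a lax section of complexes. -/
@[simps]
def toChainLaxObj (E : ChainComplex (LaxLimit M) ℕ) : LaxLimit (chainDiagram M) where
  x i := ((ev M i).mapHomologicalComplex (ComplexShape.down ℕ)).obj E
  u θ :=
    { f := fun n => (E.X n).u θ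
      comm' := fun a b _ => ((E.d a b).comm θ).symm }
  u_id i := HomologicalComplex.Hom.ext (funext fun n => (E.X n).u_id i)
  u_comp θ δ := HomologicalComplex.Hom.ext (funext fun n => (E.X n).u_comp θ δ)

/-- A lax section of complexes, viewed as a complex of lax sections. -/
@[simps]
def ofChainLaxObj (E : LaxLimit (chainDiagram M)) : ChainComplex (LaxLimit M) ℕ where
  X n :=
    { x i := (E.x i).X n
      u θ := (E.u θ).f n
      u_id i := congrArg (fun f => HomologicalComplex.Hom.f f n) (E.u_id i)
      u_comp θ δ := congrArg (fun f => HomologicalComplex.Hom.f f n) (E.u_comp θ δ) }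
  d a b :=
    { app i := (E.x i).d a b
      comm θ := ((E.u θ).comm a b).symm }
  shape a b h := by
    ext i
    exact (E.x i).shape a b h
  d_comp_d' a b c _ _ := by
    ext i
    exact (E.x i).d_comp_d a b c

variable (M) in
/-- The identification of complexes of lax sections with lax sections of complexes. -/
def chainLaxEquiv : ChainComplex (LaxLimit M) ℕ ≌ LaxLimit (chainDiagram M) where
  functor :=
    { obj E := toChainLaxObj E
      map f :=
        { app i := ((ev M i).mapHomologicalComplex (ComplexShape.down ℕ)).map f
          comm θ := HomologicalComplex.Hom.ext (funext fun n => (f.f n).comm θ) }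
      map_id E := rfl
      map_comp f g := rfl }
  inverse :=
    { obj E := ofChainLaxObj E
      map f :=
        { f n :=
            { app i := (f.app i).f n
              comm θ := congrArg (fun g => HomologicalComplex.Hom.f g n) (f.comm θ) }
          comm' a b _ := by
            ext i
            exact (f.app i).comm a b }
      map_id E := by ext n i; rfl
      map_comp f g := by ext n i; rfl }
  unitIso := Iso.refl _
  counitIso := Iso.refl _
  functor_unitIso_comp E := by
    ext i
    exact HomologicalComplex.Hom.ext (funext fun n => Category.comp_id _)

variable [∀ {i j : I} (θ : i ⟶ j), PreservesFiniteColimits (M.map θ)]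

/-- A morphism of complexes of lax sections is a quasi-isomorphism iff it is one levelwise. -/
lemma quasiIso_iff_ev {E E' : ChainComplex (LaxLimit M) ℕ} (f : E ⟶ E') :
    QuasiIso f ↔
      ∀ i, QuasiIso (((ev M i).mapHomologicalComplex (ComplexShape.down ℕ)).map f) := by
  constructor
  · intro h i
    infer_instance
  · intro h
    rw [quasiIso_iff]
    intro n
    rw [quasiIsoAt_iff_isIso_homologyMap]
    apply isIso_of_app
    intro i
    have h' := h i
    rw [quasiIso_iff] at h'
    have h'' := h' n
    rw [quasiIsoAt_iff, ShortComplex.quasiIso_iff] at h''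
    exact (NatIso.isIso_map_iff (ShortComplex.homologyFunctorIso (ev M i))
      ((HomologicalComplex.shortComplexFunctor _ _ n).map f)).1 h''

end Chain

end LaxLimit
end LaxLimit

/-! ### Sheaves of modules over the slices of a site -/

section Modules

variable {C : Type u} [SmallCategory C] {J : GrothendieckTopology C} (R : Sheaf J RingCat.{u})

/-- For `f = 𝟙 Y`, restriction of sheaves of modules along `f` identifies to the identity. -/
def overMapIdIso {Y : C} {f : Y ⟶ Y} (h : f = 𝟙 Y) :
    SheafOfModules.overMap.{u} R f ≅ 𝟭 (SheafOfModules.{u} (R.over Y)) :=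
  ((SheafOfModules.pushforwardId (R.over Y)).symm ≪≫
    SheafOfModules.pushforwardCongr₂ (J := J.over Y) (K := J.over Y) (S := R.over Y) (T := R.over Y)
      (F := Over.map f) (G := 𝟭 (Over Y)) (𝟙 (R.over Y))
      (Over.mapCongr f (𝟙 Y) h ≪≫ Over.mapId Y) (by
        ext W x
        change (R.obj.map (𝟙 W.unop.left ≫ 𝟙 _).op) x = x
        rw [Category.comp_id, op_id, R.obj.map_id]
        rfl)).symm

/-- For `h = f ≫ g`, restriction of sheaves of modules along `h` identifies to the restriction
along `g` followed by the restriction along `f`. -/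
def overMapCompIso {Y Y' Y'' : C} {f : Y ⟶ Y'} {g : Y' ⟶ Y''} {h : Y ⟶ Y''} (e : h = f ≫ g) :
    SheafOfModules.overMap.{u} R h ≅
      SheafOfModules.overMap.{u} R g ⋙ SheafOfModules.overMap.{u} R f :=
  haveI : (Over.map f ⋙ Over.map g).IsContinuous (J.over Y) (J.over Y'') :=
    Functor.isContinuous_comp _ _ _ (J.over Y') _
  (SheafOfModules.pushforwardComp _ _ ≪≫ SheafOfModules.pushforwardCongr₂ _
    (Over.mapCongr h (f ≫ g) e ≪≫ Over.mapComp f g) (by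
      ext W x
      change (R.obj.map (𝟙 W.unop.left ≫ 𝟙 _).op) x = x
      rw [Category.comp_id, op_id, R.obj.map_id]
      rfl)).symm

/-- Restriction of sections of a sheaf of modules on `Over Z`. -/
abbrev res {Z : C} (M : SheafOfModules.{u} (R.over Z)) {W W' : Over Z} (t : W ⟶ W') :
    M.val.presheaf.obj (op W') → M.val.presheaf.obj (op W) := fun x => M.val.presheaf.map t.op x

lemma res_res {Z : C} (M : SheafOfModules.{u} (R.over Z)) {W W' W'' : Over Z} (t : W ⟶ W')
    (t' : W' ⟶ W'') (x) : res R M t (res R M t' x) = res R M (t ≫ t') x := by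
  dsimp [res]
  rw [M.val.presheaf.map_comp]
  rfl

lemma res_id {Z : C} (M : SheafOfModules.{u} (R.over Z)) {W : Over Z} (t : W ⟶ W) (h : t = 𝟙 _)
    (x) : res R M t x = x := by
  subst h
  dsimp [res]
  rw [M.val.presheaf.map_id]
  rfl

lemma res_congr {Z : C} (M : SheafOfModules.{u} (R.over Z)) {W W' : Over Z} (t t' : W ⟶ W')
    (h : t = t') (x : M.val.presheaf.obj (op W')) : res R M t x = res R M t' x := by
  rw [h]

lemma res_overMap {Y Z : C} (f : Y ⟶ Z) (M : SheafOfModules.{u} (R.over Z)) {W W' : Over Y}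
    (t : W ⟶ W') (x : M.val.presheaf.obj (op ((Over.map f).obj W'))) :
    (res R ((SheafOfModules.overMap.{u} R f).obj M) t x :
      M.val.presheaf.obj (op ((Over.map f).obj W))) = res R M ((Over.map f).map t) x := rfl

/-- The morphism `overMapIdIso` on sections. -/
def idSec {Y : C} {f : Y ⟶ Y} (h : f = 𝟙 Y) (M : SheafOfModules.{u} (R.over Y)) (W : Over Y)
    (x : M.val.presheaf.obj (op ((Over.map f).obj W))) : M.val.presheaf.obj (op W) :=
  ((overMapIdIso R h).hom.app M).val.app (op W) x

lemma idSec_eq {Y : C} {f : Y ⟶ Y} (h : f = 𝟙 Y) (M : SheafOfModules.{u} (R.over Y)) (W : Over Y)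
    (x : M.val.presheaf.obj (op ((Over.map f).obj W))) :
    idSec R h M W x =
      res R M (W := W) (W' := (Over.map f).obj W) (Over.homMk (𝟙 W.left) (by simp [h])) x := by
  refine (congrArg (fun t => res R M t x) ?_)
  ext
  exact Category.comp_id _

/-- The morphism `overMapCompIso` on sections. -/
def compSec {Y Y' Y'' : C} {f : Y ⟶ Y'} {g : Y' ⟶ Y''} {h : Y ⟶ Y''} (e : h = f ≫ g)
    (M : SheafOfModules.{u} (R.over Y'')) (W : Over Y)
    (x : M.val.presheaf.obj (op ((Over.map h).obj W))) :
    M.val.presheaf.obj (op ((Over.map g).obj ((Over.map f).obj W))) :=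
  ((overMapCompIso R e).hom.app M).val.app (op W) x

lemma compSec_eq {Y Y' Y'' : C} {f : Y ⟶ Y'} {g : Y' ⟶ Y''} {h : Y ⟶ Y''} (e : h = f ≫ g)
    (M : SheafOfModules.{u} (R.over Y'')) (W : Over Y)
    (x : M.val.presheaf.obj (op ((Over.map h).obj W))) :
    compSec R e M W x =
      res R M (W := (Over.map g).obj ((Over.map f).obj W)) (W' := (Over.map h).obj W)
        (Over.homMk (𝟙 W.left) (by simp [e])) x := by
  refine (congrArg (fun t => res R M t x) ?_)
  ext
  exact Category.comp_id _

/-- The canonical morphism for equal restriction maps on sections. -/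
def eqSec {Y Z : C} {f f' : Y ⟶ Z} (h : f = f')
    (M : SheafOfModules.{u} (R.over Z)) (W : Over Y)
    (x : M.val.presheaf.obj (op ((Over.map f).obj W))) :
    M.val.presheaf.obj (op ((Over.map f').obj W)) :=
  (eqToHom (show (SheafOfModules.overMap.{u} R f).obj M =
    (SheafOfModules.overMap.{u} R f').obj M by rw [h])).val.app (op W) x

lemma eqSec_eq {Y Z : C} {f f' : Y ⟶ Z} (h : f = f')
    (M : SheafOfModules.{u} (R.over Z)) (W : Over Y)
    (x : M.val.presheaf.obj (op ((Over.map f).obj W))) :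
    eqSec R h M W x =
      res R M (W := (Over.map f').obj W) (W' := (Over.map f).obj W)
        (Over.homMk (𝟙 W.left) (by simp [h])) x := by
  subst h
  rw [res_id]
  · rfl
  · ext
    rfl

lemma idSec_eq' {Y Z : C} {i : Y ⟶ Y} {f : Y ⟶ Z} (hi : i = 𝟙 Y)
    (M : SheafOfModules.{u} (R.over Z)) (W : Over Y)
    (y : M.val.presheaf.obj (op ((Over.map f).obj ((Over.map i).obj W)))) :
    (idSec R hi ((SheafOfModules.overMap.{u} R f).obj M) W y :
        M.val.presheaf.obj (op ((Over.map f).obj W))) =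
      res R M (W := (Over.map f).obj W) (W' := (Over.map f).obj ((Over.map i).obj W))
        (Over.homMk (𝟙 W.left) (by simp [hi])) y := by
  refine (idSec_eq R hi ((SheafOfModules.overMap.{u} R f).obj M) W y).trans ?_
  refine (res_overMap R f M _ y).trans (res_congr R M _ _ ?_ y)
  ext
  rfl

lemma compSec_eq' {X₀ X₁ X₂ X₃ : C} {a : X₀ ⟶ X₁} {b : X₁ ⟶ X₂} {c : X₂ ⟶ X₃}
    {ab : X₀ ⟶ X₂} (e : ab = a ≫ b)
    (M : SheafOfModules.{u} (R.over X₃)) (W : Over X₀)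
    (y : M.val.presheaf.obj (op ((Over.map c).obj ((Over.map ab).obj W)))) :
    (compSec R e ((SheafOfModules.overMap.{u} R c).obj M) W y :
        M.val.presheaf.obj (op ((Over.map c).obj ((Over.map b).obj ((Over.map a).obj W))))) =
      res R M (W := (Over.map c).obj ((Over.map b).obj ((Over.map a).obj W)))
        (W' := (Over.map c).obj ((Over.map ab).obj W))
        (Over.homMk (𝟙 W.left) (by simp [e])) y := by
  refine (compSec_eq R e ((SheafOfModules.overMap.{u} R c).obj M) W y).trans ?_
  refine (res_overMap R c M _ y).trans (res_congr R M _ _ ?_ y)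
  ext
  rfl

lemma overMapCompIso_id_left {Y Z : C} {i : Z ⟶ Z} {f h : Y ⟶ Z} (hi : i = 𝟙 Z) (e : h = f ≫ i)
    (hf : h = f) (M : SheafOfModules.{u} (R.over Z)) :
    (overMapCompIso R e).hom.app M ≫
        (SheafOfModules.overMap.{u} R f).map ((overMapIdIso R hi).hom.app M) =
      eqToHom (show (SheafOfModules.overMap.{u} R h).obj M =
        (SheafOfModules.overMap.{u} R f).obj M by rw [hf]) := by
  have key (W : Over Y) (x : M.val.presheaf.obj (op ((Over.map h).obj W))) :
      idSec R hi M ((Over.map f).obj W) (compSec R e M W x) = eqSec R hf M W x := by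
    rw [idSec_eq, compSec_eq, eqSec_eq, res_res]
    congr 1
    ext
    exact Category.comp_id _
  ext ⟨W⟩ x
  exact key W x

lemma overMapCompIso_id_right {Y Z : C} {i : Y ⟶ Y} {f h : Y ⟶ Z} (hi : i = 𝟙 Y) (e : h = i ≫ f)
    (hf : h = f) (M : SheafOfModules.{u} (R.over Z)) :
    (overMapCompIso R e).hom.app M ≫
        (overMapIdIso R hi).hom.app ((SheafOfModules.overMap.{u} R f).obj M) =
      eqToHom (show (SheafOfModules.overMap.{u} R h).obj M =
        (SheafOfModules.overMap.{u} R f).obj M by rw [hf]) := by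
  have key (W : Over Y) (x : M.val.presheaf.obj (op ((Over.map h).obj W))) :
      idSec R hi ((SheafOfModules.overMap.{u} R f).obj M) W (compSec R e M W x) =
        eqSec R hf M W x := by
    refine (idSec_eq' R hi M W _).trans ?_
    rw [compSec_eq, eqSec_eq, res_res]
    congr 1
    ext
    exact Category.comp_id _
  ext ⟨W⟩ x
  exact key W x

lemma overMapCompIso_assoc {X₀ X₁ X₂ X₃ : C} {a : X₀ ⟶ X₁} {b : X₁ ⟶ X₂} {c : X₂ ⟶ X₃}
    {bc : X₁ ⟶ X₃} {ab : X₀ ⟶ X₂} {abc abc' : X₀ ⟶ X₃} (h₁ : bc = b ≫ c) (h₂ : ab = a ≫ b)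
    (h₃ : abc = a ≫ bc) (h₄ : abc' = ab ≫ c) (h₅ : abc = abc')
    (M : SheafOfModules.{u} (R.over X₃)) :
    (overMapCompIso R h₃).hom.app M ≫
        (SheafOfModules.overMap.{u} R a).map ((overMapCompIso R h₁).hom.app M) =
      eqToHom (show (SheafOfModules.overMap.{u} R abc).obj M =
        (SheafOfModules.overMap.{u} R abc').obj M by rw [h₅]) ≫
        (overMapCompIso R h₄).hom.app M ≫
          (overMapCompIso R h₂).hom.app ((SheafOfModules.overMap.{u} R c).obj M) := by
  have key (W : Over X₀) (x : M.val.presheaf.obj (op ((Over.map abc).obj W))) :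
      compSec R h₁ M ((Over.map a).obj W) (compSec R h₃ M W x) =
        compSec R h₂ ((SheafOfModules.overMap.{u} R c).obj M) W
          (compSec R h₄ M W (eqSec R h₅ M W x)) := by
    refine Eq.trans ?_ (compSec_eq' R h₂ M W _).symm
    rw [compSec_eq, compSec_eq, compSec_eq, eqSec_eq, res_res, res_res, res_res]
    congr 1
    ext
    simp
  ext ⟨W⟩ x
  exact key W x

variable (X : SimplicialObject C)

/-- The cosimplicial diagram of categories of sheaves of modules over a simplicial object `X`: it
sends `[n]` to the category of sheaves of modules over `R` restricted to `X_n`, and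
`θ : [n] ⟶ [m]` to the restriction functor along `X_m ⟶ X_n`. -/
@[simps obj map]
def modDiagram : CatDiagram.{u, u + 1} SimplexCategory where
  obj n := SheafOfModules.{u} (R.over (X.obj (op n)))
  cat _ := inferInstance
  map θ := SheafOfModules.overMap.{u} R (X.map θ.op)
  mapId n := overMapIdIso R (by simp)
  mapComp θ δ := overMapCompIso R (by simp)
  mapComp_id_left θ M := overMapCompIso_id_left R _ _ (by simp) M
  mapComp_id_right θ M := overMapCompIso_id_right R _ _ (by simp) M
  mapComp_assoc θ δ ε M := overMapCompIso_assoc R _ _ _ _ (by simp) M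

end Modules

section Restriction

variable {C : Type u} [SmallCategory C] {J : GrothendieckTopology C} (R : Sheaf J RingCat.{u})

instance {Y Z : C} (f : Y ⟶ Z) : (SheafOfModules.overMap.{u} R f).Additive where
  map_add := rfl

instance {Y Z : C} (f : Y ⟶ Z) : PreservesFiniteLimits (SheafOfModules.overMap.{u} R f) := by
  let ψ : (R.over Y).obj ⟶ (Over.map f).op ⋙ (R.over Z).obj :=
    (Sheaf.pushforwardOverMapIso R f).inv.hom
  haveI : (PresheafOfModules.pushforward.{u} ψ).IsRightAdjoint := inferInstance
  haveI : (SheafOfModules.overMap.{u} R f).IsRightAdjoint :=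
    (SheafOfModules.PullbackConstruction.adjunction.{u}
      (Sheaf.pushforwardOverMapIso R f).inv).isRightAdjoint
  infer_instance

/-- The inverse of `overMapCompIso` on sections. -/
def compInvSec {Y Y' Y'' : C} {f : Y ⟶ Y'} {g : Y' ⟶ Y''} {h : Y ⟶ Y''} (e : h = f ≫ g)
    (M : SheafOfModules.{u} (R.over Y'')) (W : Over Y)
    (x : M.val.presheaf.obj (op ((Over.map g).obj ((Over.map f).obj W)))) :
    M.val.presheaf.obj (op ((Over.map h).obj W)) :=
  ((overMapCompIso R e).inv.app M).val.app (op W) x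

lemma compInvSec_eq {Y Y' Y'' : C} {f : Y ⟶ Y'} {g : Y' ⟶ Y''} {h : Y ⟶ Y''} (e : h = f ≫ g)
    (M : SheafOfModules.{u} (R.over Y'')) (W : Over Y)
    (x : M.val.presheaf.obj (op ((Over.map g).obj ((Over.map f).obj W)))) :
    compInvSec R e M W x =
      res R M (W := (Over.map h).obj W) (W' := (Over.map g).obj ((Over.map f).obj W))
        (Over.homMk (𝟙 W.left) (by simp [e])) x := by
  have h₁ : compSec R e M W (compInvSec R e M W x) = x :=
    congrArg (fun t : (SheafOfModules.overMap.{u} R g ⋙ SheafOfModules.overMap.{u} R f).obj M ⟶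
      (SheafOfModules.overMap.{u} R g ⋙ SheafOfModules.overMap.{u} R f).obj M =>
        t.val.app (op W) x) ((overMapCompIso R e).inv_hom_id_app M)
  rw [compSec_eq] at h₁
  conv_rhs => rw [← h₁]
  rw [res_res, res_id]
  ext
  exact Category.comp_id _

/-- Restricting along an identity. -/
lemma overMapCompIso_inv_id {Y Z : C} {i : Y ⟶ Y} {p : Y ⟶ Z} (hi : i = 𝟙 Y) (e : p = i ≫ p)
    (M : SheafOfModules.{u} (R.over Z)) :
    (overMapCompIso R e).inv.app M =
      (overMapIdIso R hi).hom.app ((SheafOfModules.overMap.{u} R p).obj M) := by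
  have key (W : Over Y) (x : M.val.presheaf.obj (op ((Over.map p).obj ((Over.map i).obj W)))) :
      compInvSec R e M W x = idSec R hi ((SheafOfModules.overMap.{u} R p).obj M) W x := by
    refine Eq.trans ?_ (idSec_eq' R hi M W _).symm
    rw [compInvSec_eq]
  ext ⟨W⟩ x
  exact key W x

/-- Compatibility of the inverses of `overMapCompIso` with compositions. -/
lemma overMapCompIso_inv_comp {X₀ X₁ X₂ Z : C} {a : X₀ ⟶ X₁} {b : X₁ ⟶ X₂} {ab : X₀ ⟶ X₂}
    {p₀ : X₀ ⟶ Z} {p₁ : X₁ ⟶ Z} {p₂ : X₂ ⟶ Z} (h : ab = a ≫ b) (e₀₂ : p₀ = ab ≫ p₂)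
    (e₀₁ : p₀ = a ≫ p₁) (e₁₂ : p₁ = b ≫ p₂) (M : SheafOfModules.{u} (R.over Z)) :
    (overMapCompIso R e₀₂).inv.app M =
      (overMapCompIso R h).hom.app ((SheafOfModules.overMap.{u} R p₂).obj M) ≫
        (SheafOfModules.overMap.{u} R a).map ((overMapCompIso R e₁₂).inv.app M) ≫
          (overMapCompIso R e₀₁).inv.app M := by
  have key (W : Over X₀) (x : M.val.presheaf.obj (op ((Over.map p₂).obj ((Over.map ab).obj W)))) :
      compInvSec R e₀₂ M W x = compInvSec R e₀₁ M W (compInvSec R e₁₂ M ((Over.map a).obj W)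
        (compSec R h ((SheafOfModules.overMap.{u} R p₂).obj M) W x)) := by
    refine Eq.trans ?_ (congrArg (fun y => compInvSec R e₀₁ M W
      (compInvSec R e₁₂ M ((Over.map a).obj W) y)) (compSec_eq' R h M W x).symm)
    rw [compInvSec_eq, compInvSec_eq, compInvSec_eq, res_res, res_res]
    congr 1
    ext
    simp
  ext ⟨W⟩ x
  exact key W x

variable (X : SimplicialObject C)

instance (n : SimplexCategory) : Abelian ((modDiagram R X).obj n) :=
  inferInstanceAs (Abelian (SheafOfModules.{u} (R.over (X.obj (op n)))))

instance {n m : SimplexCategory} (θ : n ⟶ m) : ((modDiagram R X).map θ).Additive :=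
  inferInstanceAs (SheafOfModules.overMap.{u} R (X.map θ.op)).Additive

instance [HasPullbacks C] {n m : SimplexCategory} (θ : n ⟶ m) :
    PreservesFiniteColimits ((modDiagram R X).map θ) :=
  inferInstanceAs (PreservesFiniteColimits (SheafOfModules.overMap.{u} R (X.map θ.op)))

/-- The functor from sheaves of modules over `U` to the lax limit over a simplicial object `X`
augmented over `U`, induced by restriction: it sends `F` to the family of restrictions `F|X_n`,
with the canonical isomorphisms as structure maps. -/
@[simps obj_x obj_u map_app]
def restr {U : C} (p : X ⟶ (SimplicialObject.const C).obj U) :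
    SheafOfModules.{u} (R.over U) ⥤ LaxLimit (modDiagram R X) where
  obj F :=
    { x n := (SheafOfModules.overMap.{u} R (Y := U) (p.app (op n))).obj F
      u {n m} θ := (overMapCompIso R (h := p.app (op m)) (f := X.map θ.op) (g := p.app (op n))
        (by simpa using (p.naturality θ.op).symm)).inv.app F
      u_id n := overMapCompIso_inv_id R (by simp) _ F
      u_comp θ δ := overMapCompIso_inv_comp R (by simp) _ _ _ F }
  map f :=
    { app n := (SheafOfModules.overMap.{u} R (Y := U) (p.app (op n))).map f
      comm θ := (overMapCompIso R _).inv.naturality f }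
  map_id F := by
    ext n
    exact (SheafOfModules.overMap.{u} R _).map_id F
  map_comp f g := by
    ext n
    exact (SheafOfModules.overMap.{u} R _).map_comp f g

instance {U : C} (p : X ⟶ (SimplicialObject.const C).obj U) : (restr R X p).Additive where
  map_add := rfl


lemma hasWidePullback_of_hasPullbacks [HasPullbacks C] (f : Arrow C) (n : ℕ) :
    HasWidePullback.{0} f.right (fun _ : Fin (n + 1) => f.left) fun _ => f.hom := by
  haveI : HasBinaryProducts (Over f.right) := Over.ConstructProducts.over_binaryProduct_of_pullback
  haveI : HasTerminal (Over f.right) := Over.over_hasTerminal f.right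
  haveI : HasFiniteProducts (Over f.right) := hasFiniteProducts_of_has_binary_and_terminal
  let F : Discrete (Fin (n + 1)) ⥤ Over f.right :=
    Discrete.functor (fun _ => Over.mk f.hom)
  exact HasLimit.mk (F := WidePullbackShape.wideCospan f.right (fun _ : Fin (n + 1) => f.left)
      fun _ => f.hom)
    { cone := _
      isLimit := IsLimit.ofRightAdjoint (Over.ConstructProducts.conesEquiv f.right F).toAdjunction
        (limit.isLimit F) }

end Restriction

/-! ### Derived categories -/

section Derived

/-- The derived category `D_+` of non-negatively graded chain complexes in an abelian category:
the localization of the category of complexes at the quasi-isomorphisms. -/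
abbrev DPlus (A : Type u) [Category.{v} A] [Abelian A] :=
  (HomologicalComplex.quasiIso A (ComplexShape.down ℕ)).Localization

/-- The localization functor. -/
abbrev DPlus.Q (A : Type u) [Category.{v} A] [Abelian A] : ChainComplex A ℕ ⥤ DPlus A :=
  (HomologicalComplex.quasiIso A (ComplexShape.down ℕ)).Q

variable {I : Type u} [Category.{v} I] (M : CatDiagram.{w, u'} I)
  [∀ i : I, Abelian (M.obj i)] [∀ {i j : I} (θ : i ⟶ j), (M.map θ).Additive]

/-- The property of lax sections of complexes that all the structure maps are
quasi-isomorphisms. -/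
def LAX : ObjectProperty (LaxLimit (chainDiagram M)) := fun E =>
  ∀ ⦃i j : I⦄ (θ : i ⟶ j), HomologicalComplex.quasiIso (M.obj j) (ComplexShape.down ℕ) (E.u θ)

/-- The levelwise quasi-isomorphisms of lax sections of complexes. -/
def levelwiseQuasiIso : MorphismProperty (LaxLimit (chainDiagram M)) := fun _ _ f =>
  ∀ i : I, HomologicalComplex.quasiIso (M.obj i) (ComplexShape.down ℕ) (f.app i)

/-- The homotopy category of `LAX`: its localization at the levelwise quasi-isomorphisms. -/
abbrev HoLAX := ((levelwiseQuasiIso M).inverseImage (LAX M).ι).Localization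

variable [∀ {i j : I} (θ : i ⟶ j), PreservesFiniteColimits (M.map θ)]

lemma quasiIso_iff_levelwiseQuasiIso {E E' : ChainComplex (LaxLimit M) ℕ} (f : E ⟶ E') :
    QuasiIso f ↔ levelwiseQuasiIso M ((LaxLimit.chainLaxEquiv M).functor.map f) :=
  LaxLimit.quasiIso_iff_ev f

/-- The functor from the homotopy category of `LAX` to the derived category of the lax limit,
induced by the identification of lax sections of complexes with complexes of lax sections. -/
def laxToDPlus : HoLAX M ⥤ DPlus (LaxLimit M) :=
  Localization.Construction.lift ((LAX M).ι ⋙ (LaxLimit.chainLaxEquiv M).inverse ⋙ DPlus.Q _)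
    (fun _ _ f hf => Localization.inverts (DPlus.Q (LaxLimit M))
      (HomologicalComplex.quasiIso (LaxLimit M) (ComplexShape.down ℕ)) _
      ((quasiIso_iff_levelwiseQuasiIso M
        ((LaxLimit.chainLaxEquiv M).inverse.map ((LAX M).ι.map f))).2 hf))

end Derived

section Cech

variable {C : Type u} [SmallCategory C] [HasPullbacks C] {J : GrothendieckTopology C}
  (R : Sheaf J RingCat.{u})

/-- The Čech nerve of `φ : V ⟶ U`: in degree `n`, it is the fibre product of `n + 1` copies of `V`
over `U`. -/
def cech {U V : C} (φ : V ⟶ U) : SimplicialObject C :=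
  haveI := hasWidePullback_of_hasPullbacks (Arrow.mk φ)
  (Arrow.mk φ).cechNerve

/-- The augmentation of the Čech nerve. -/
def cechAug {U V : C} (φ : V ⟶ U) : cech φ ⟶ (SimplicialObject.const C).obj U :=
  haveI := hasWidePullback_of_hasPullbacks (Arrow.mk φ)
  (Arrow.mk φ).augmentedCechNerve.hom

/-- The diagram of the categories of sheaves of modules over the Čech nerve of `φ`. -/
abbrev Ω {U V : C} (φ : V ⟶ U) : CatDiagram.{u, u + 1} SimplexCategory := modDiagram R (cech φ)

/-- The functor on complexes induced by the restriction to the Čech nerve. -/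
abbrev restrChain {U V : C} (φ : V ⟶ U) :
    ChainComplex (SheafOfModules.{u} (R.over U)) ℕ ⥤ ChainComplex (LaxLimit (Ω R φ)) ℕ :=
  (restr R (cech φ) (cechAug φ)).mapHomologicalComplex (ComplexShape.down ℕ)

lemma restrChain_map_quasiIso {U V : C} (φ : V ⟶ U)
    {K L : ChainComplex (SheafOfModules.{u} (R.over U)) ℕ} (f : K ⟶ L) (hf : QuasiIso f) :
    QuasiIso ((restrChain R φ).map f) := by
  rw [LaxLimit.quasiIso_iff_ev]
  intro n
  exact inferInstanceAs (QuasiIso (((SheafOfModules.overMap.{u} R (Y := U)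
    ((cechAug φ).app (op n))).mapHomologicalComplex (ComplexShape.down ℕ)).map f))

/-- The functor on derived categories induced by the restriction to the Čech nerve. -/
def restrDerived {U V : C} (φ : V ⟶ U) :
    DPlus (SheafOfModules.{u} (R.over U)) ⥤ DPlus (LaxLimit (Ω R φ)) :=
  Localization.Construction.lift (restrChain R φ ⋙ DPlus.Q _)
    (fun _ _ f hf => Localization.inverts (DPlus.Q (LaxLimit (Ω R φ)))
      (HomologicalComplex.quasiIso (LaxLimit (Ω R φ)) (ComplexShape.down ℕ)) _
      (restrChain_map_quasiIso R φ f hf))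

end Cech
end LaxDescent

end

open LaxDescent

/-! Write r for restriction from U to the Čech nerve X of φ and l for its left adjoint. Everything
rests on one assertion, `quasiIso_lanUnit_cech`: if all structure maps of a complex E of lax
sections are quasi-isomorphisms, then the derived unit E → r(Ll E) is an isomorphism.

The derived functor Ll. The free lax section on a family (y_i) has the terms ∐ M(θ)(y_i), the sum
over all θ : i → j. On free lax sections l is extension by zero, which is exact because direct sums
of injections are injective and sheafification is exact. The comonad of free lax sections has an
epimorphic counit, so every complex E has a functorial resolution BE → E by free terms. Dimension
shifting, started by the vanishing in negative degrees, shows that l preserves quasi-isomorphisms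
between complexes of relatively projective objects (`quasiIso_map_of_relProj`). Hence l ∘ B computes
Ll, and Ll is left adjoint to r on the localizations (`derivedAdj`).

The unit. Forgetting the first vertex gives a projection q : dec X → X from the décalage. Since
X_{n+1} = X_0 ×_U X_n, each q_n is a base change of the covering X_0 → U, so q^* is exact and
reflects quasi-isomorphisms (`quasiIso_of_onChain_projPull`). The same fibre squares give a base
change isomorphism between l and the left adjoint l' of restriction r' from X_0 to dec X, compatible
with units (`unit_lanBaseChange`). It therefore suffices to treat the unit of l' ⊣ r' on q^*BE. The
augmentation dec X → X_0 has an extra degeneracy, which makes r' fully faithful on derived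
categories. If the structure maps of E are quasi-isomorphisms, the two families q_n^*E_n → E_{n+1}
and E_0|X_{n+1} → E_{n+1}, given by the last vertices and by the first vertex, connect q^*E to
r'E_0. So q^*E lies in the essential image of the fully faithful r', and the derived unit is an
isomorphism there.

Conclusion. The zigzag E ← BE → r l BE puts such an E into the essential image of r. Conversely, rF
has invertible structure maps, and having quasi-isomorphisms as structure maps is invariant under
isomorphism in the derived category (`quasiIso_strChain_of_iso`). The functor r l B takes values in
`LAX`, and the same zigzag, formed both inside `LAX` and in all complexes, yields full faithfulness
(`full_and_faithful_locMap`). -/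

noncomputable section

namespace LaxDescent

/-! ### Resolutions of chain complexes by a covering family of epimorphisms -/

section Resolution

variable {𝓐 : Type*} [Category* 𝓐] [Abelian 𝓐] (G : 𝓐 → 𝓐) (p : ∀ Q, G Q ⟶ Q)
  (E : ChainComplex 𝓐 ℕ)

/-- The data in degree `n` of a resolution of `E` which is constructed degree by degree. -/
structure ResolutionStage (n : ℕ) where
  /-- the term of the resolution -/
  Y : 𝓐
  /-- the cycles of the resolution -/
  Z : 𝓐
  /-- the inclusion of cycles -/
  i : Z ⟶ Y
  /-- the augmentation -/
  e : Y ⟶ E.X n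

variable {E} in
/-- The object covered by the next term of the resolution. -/
abbrev ResolutionStage.Q {n : ℕ} (s : ResolutionStage E n) : 𝓐 :=
  pullback (E.d (n + 1) n) (s.i ≫ s.e)

variable {E} in
/-- The map from the next term of the resolution to cycles. -/
abbrev ResolutionStage.f {n : ℕ} (s : ResolutionStage E n) : G s.Q ⟶ s.Z :=
  p _ ≫ pullback.snd _ _

/-- The degreewise construction of a resolution. -/
def resolutionStage : ∀ n, ResolutionStage E n
  | 0 => { Y := G (E.X 0), Z := G (E.X 0), i := 𝟙 _, e := p _ }
  | n + 1 =>
    { Y := G (resolutionStage n).Q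
      Z := kernel ((resolutionStage n).f G p)
      i := kernel.ι _
      e := p _ ≫ pullback.fst _ _ }

/-- The map from a term of the resolution to the cycles in the previous degree. -/
def resolutionD (n : ℕ) : (resolutionStage G p E (n + 1)).Y ⟶ (resolutionStage G p E n).Z :=
  (resolutionStage G p E n).f G p

instance (n : ℕ) : Mono (resolutionStage G p E n).i := by
  cases n <;> · dsimp [resolutionStage]; infer_instance

lemma resolutionStage_i_d (n : ℕ) :
    (resolutionStage G p E (n + 1)).i ≫ resolutionD G p E n = 0 :=
  kernel.condition _

lemma resolutionStage_e_d (n : ℕ) : (resolutionStage G p E (n + 1)).e ≫ E.d (n + 1) n =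
    resolutionD G p E n ≫ (resolutionStage G p E n).i ≫ (resolutionStage G p E n).e := by
  change (p _ ≫ pullback.fst _ _) ≫ _ = (p _ ≫ pullback.snd _ _) ≫ _
  simp only [Category.assoc, pullback.condition]

/-- The resolution of `E`. -/
abbrev resolution : ChainComplex 𝓐 ℕ :=
  ChainComplex.of (fun n => (resolutionStage G p E n).Y)
    (fun n => resolutionD G p E n ≫ (resolutionStage G p E n).i)
    (fun n => by
      rw [Category.assoc, reassoc_of% resolutionStage_i_d G p E n, zero_comp, comp_zero])

lemma resolution_d (n : ℕ) : (resolution G p E).d (n + 1) n =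
    resolutionD G p E n ≫ (resolutionStage G p E n).i :=
  ChainComplex.of_d (fun n => (resolutionStage G p E n).Y)
    (fun n => resolutionD G p E n ≫ (resolutionStage G p E n).i) n

/-- The augmentation of the resolution. -/
abbrev resolutionπ : resolution G p E ⟶ E :=
  ChainComplex.ofHom (fun n => (resolutionStage G p E n).e) (fun n => by
    rw [resolution_d, resolutionStage_e_d, Category.assoc])

/-- Holds by construction in degree zero and in successor degrees. It is what makes the terms of the
resolution relatively projective when `G` is the free comonad. -/
lemma resolution_X (n : ℕ) : ∃ Q, (resolution G p E).X n = G Q := by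
  cases n
  · exact ⟨_, rfl⟩
  · exact ⟨_, rfl⟩

/-- The hypothesis `h` says that `(c, y)` is a generalized element of the pullback `Q`, and `p Q` is
an epimorphism, so the element lifts to `G Q` after refining its domain. Both halves of the
quasi-isomorphism statement are instances of this. -/
lemma resolution_exists_lift (hp : ∀ Q, Epi (p Q)) (n : ℕ) {A : 𝓐}
    (c : A ⟶ E.X (n + 1)) (y : A ⟶ (resolutionStage G p E n).Z)
    (h : c ≫ E.d (n + 1) n = y ≫ (resolutionStage G p E n).i ≫ (resolutionStage G p E n).e) :
    ∃ (A' : 𝓐) (π : A' ⟶ A) (_ : Epi π) (x : A' ⟶ (resolutionStage G p E (n + 1)).Y),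
      x ≫ (resolutionStage G p E (n + 1)).e = π ≫ c ∧ x ≫ resolutionD G p E n = π ≫ y := by
  have := hp (resolutionStage G p E n).Q
  obtain ⟨A', π, hπ, x, hx⟩ := surjective_up_to_refinements_of_epi
    (p (resolutionStage G p E n).Q) (pullback.lift c y h)
  refine ⟨A', π, hπ, x, ?_, ?_⟩
  · change x ≫ p _ ≫ pullback.fst _ _ = _
    rw [← reassoc_of% hx, pullback.lift_fst]
  · change x ≫ p _ ≫ pullback.snd _ _ = _
    rw [← reassoc_of% hx, pullback.lift_snd]

/-- The differential is `resolutionD` followed by the monomorphism `i`, so its kernel is the kernel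
of `resolutionD`, which is `Z`. In degree zero `Z` is the whole term. -/
lemma resolution_factors_cycles (n : ℕ) {A : 𝓐} (x : A ⟶ (resolution G p E).X n)
    (hx : x ≫ (resolution G p E).d n (n - 1) = 0) :
    ∃ y : A ⟶ (resolutionStage G p E n).Z, y ≫ (resolutionStage G p E n).i = x := by
  cases n with
  | zero => exact ⟨x, Category.comp_id _⟩
  | succ n =>
    replace hx : x ≫ (resolution G p E).d (n + 1) n = 0 := hx
    rw [resolution_d, ← Category.assoc] at hx
    have hx' := zero_of_comp_mono _ hx
    exact ⟨kernel.lift (resolutionD G p E n) x hx', kernel.lift_ι _ _ _⟩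

lemma quasiIso_resolutionπ (hp : ∀ Q, Epi (p Q)) : QuasiIso (resolutionπ G p E) := by
  rw [quasiIso_iff]
  intro n
  rw [quasiIsoAt_iff_isIso_homologyMap]
  -- In degree zero truncated subtraction gives `0 - 1 = 0`, which is also the default value of
  -- `next`; the differential from `0` to `0` vanishes, so both cases are handled at once.
  have hn : (ComplexShape.down ℕ).next n = n - 1 := by
    cases n <;> simp
  have : Mono (HomologicalComplex.homologyMap (resolutionπ G p E) n) := by
    rw [HomologicalComplex.mono_homologyMap_iff_up_to_refinements _ (n + 1) n (n - 1)
      (by simp) hn]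
    intro A x hx c hc
    obtain ⟨y, rfl⟩ := resolution_factors_cycles G p E n x hx
    -- A cycle `y` whose image is the boundary of `c` gives the element `(c, y)` of the pullback;
    -- its lift `t` has boundary `y`.
    obtain ⟨A', π, hπ, t, -, ht⟩ := resolution_exists_lift G p E hp n c y
      (by rw [← hc, Category.assoc])
    refine ⟨A', π, hπ, t, ?_⟩
    rw [resolution_d, reassoc_of% ht]
  have : Epi (HomologicalComplex.homologyMap (resolutionπ G p E) n) := by
    rw [HomologicalComplex.epi_homologyMap_iff_up_to_refinements _ (n + 1) n (n - 1)
      (by simp) hn]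
    intro A c hc
    cases n with
    | zero =>
      -- In degree zero everything is a cycle, and the augmentation is the epimorphism `p (E.X 0)`
      -- itself.
      have := hp (E.X 0)
      obtain ⟨A', π, hπ, x, hx⟩ := surjective_up_to_refinements_of_epi (p (E.X 0)) c
      exact ⟨A', π, hπ, x, (congrArg (x ≫ ·) ((resolution G p E).shape 0 0 (by simp))).trans
        comp_zero, 0, by rw [hx, zero_comp, add_zero]; rfl⟩
    | succ n =>
      -- For a cycle `c` the pair `(c, 0)` lies in the pullback; its lift is a cycle mapping to `c`,
      -- so no correcting boundary is needed.
      obtain ⟨A', π, hπ, x, hx, hx'⟩ := resolution_exists_lift G p E hp n c 0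
        (by rw [zero_comp]; exact hc)
      refine ⟨A', π, hπ, x, ?_, 0, by rw [hx, zero_comp, add_zero]⟩
      change x ≫ (resolution G p E).d (n + 1) n = 0
      rw [resolution_d, reassoc_of% hx', zero_comp, comp_zero]
  exact isIso_of_mono_of_epi _

end Resolution

/-! ### Functorial resolutions, obtained by resolving the universal complex in a functor category -/

section FunctorialResolution

variable {L : Type*} [Category* L] [Abelian L] (G : L ⥤ L) (ε : G ⟶ 𝟭 L)

/-- The universal complex of functors on complexes. -/
@[simps]
def universalComplex (L : Type*) [Category* L] [Abelian L] :
    ChainComplex (ChainComplex L ℕ ⥤ L) ℕ where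
  X n := HomologicalComplex.eval L _ n
  d i j := { app := fun E => E.d i j, naturality := fun _ _ f => f.comm i j }
  shape i j h := by
    ext E
    exact E.shape i j h
  d_comp_d' i j k _ _ := by
    ext E
    exact E.d_comp_d i j k

/-- The resolution of the universal complex of functors. -/
abbrev universalResolution : ChainComplex (ChainComplex L ℕ ⥤ L) ℕ :=
  resolution (fun Q : ChainComplex L ℕ ⥤ L => Q ⋙ G)
    (fun Q => Functor.whiskerLeft Q ε ≫ Q.rightUnitor.hom) (universalComplex L)

/-- The functorial resolution of chain complexes. -/
def functorialResolution : ChainComplex L ℕ ⥤ ChainComplex L ℕ :=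
  (universalResolution G ε).asFunctor

/-- The augmentation of the functorial resolution. -/
def functorialResolutionπ : functorialResolution G ε ⟶ 𝟭 (ChainComplex L ℕ) :=
  HomologicalComplex.complexOfFunctorsToFunctorToComplex.map
    (resolutionπ (fun Q : ChainComplex L ℕ ⥤ L => Q ⋙ G)
    (fun Q => Functor.whiskerLeft Q ε ≫ Q.rightUnitor.hom) (universalComplex L))

lemma functorialResolution_obj_X (E : ChainComplex L ℕ) (n : ℕ) :
    ∃ Q, ((functorialResolution G ε).obj E).X n = G.obj Q := by
  obtain ⟨Q, hQ⟩ := resolution_X (fun Q : ChainComplex L ℕ ⥤ L => Q ⋙ G)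
    (fun Q => Functor.whiskerLeft Q ε ≫ Q.rightUnitor.hom) (universalComplex L) n
  exact ⟨Q.obj E, congrArg (fun F : ChainComplex L ℕ ⥤ L => F.obj E) hQ⟩

/-- The resolution is constructed once, in the abelian category of functors on complexes. Evaluation
at `E` is exact, so the quasi-isomorphism there specializes to one for each complex. -/
lemma quasiIso_functorialResolutionπ (hε : ∀ X, Epi (ε.app X)) (E : ChainComplex L ℕ) :
    QuasiIso ((functorialResolutionπ G ε).app E) := by
  have h := quasiIso_resolutionπ (fun Q : ChainComplex L ℕ ⥤ L => Q ⋙ G)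
    (fun Q => Functor.whiskerLeft Q ε ≫ Q.rightUnitor.hom) (universalComplex L) (fun Q => by
      have : ∀ K, Epi ((Functor.whiskerLeft Q ε ≫ Q.rightUnitor.hom).app K) := fun K => by
        dsimp
        rw [Category.comp_id]
        exact hε _
      exact NatTrans.epi_of_epi_app _)
  exact inferInstanceAs (QuasiIso
    ((((evaluation (ChainComplex L ℕ) L).obj E).mapHomologicalComplex (ComplexShape.down ℕ)).map
      (resolutionπ (fun Q : ChainComplex L ℕ ⥤ L => Q ⋙ G)
        (fun Q => Functor.whiskerLeft Q ε ≫ Q.rightUnitor.hom) (universalComplex L))))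

end FunctorialResolution

end LaxDescent

end

noncomputable section

namespace LaxDescent

/-! ### Quasi-isomorphisms between complexes of relatively projective objects -/

section FunctorShortComplex

variable {L A : Type*} [Category* L] [Category* A] [Abelian L] [Abelian A]
  {A₁ A₂ A₃ : L ⥤ A} [A₁.Additive] [A₂.Additive] [A₃.Additive]
  (i : A₁ ⟶ A₂) (p : A₂ ⟶ A₃) (w : ∀ X, i.app X ≫ p.app X = 0)

/-- The short complex of complexes obtained by applying natural transformations degreewise. -/
@[simps]
def chainShortComplex (Y : ChainComplex L ℕ) : ShortComplex (ChainComplex A ℕ) where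
  X₁ := (A₁.mapHomologicalComplex _).obj Y
  X₂ := (A₂.mapHomologicalComplex _).obj Y
  X₃ := (A₃.mapHomologicalComplex _).obj Y
  f := (NatTrans.mapHomologicalComplex i _).app Y
  g := (NatTrans.mapHomologicalComplex p _).app Y
  zero := by
    ext n
    exact w (Y.X n)

/-- The functoriality of `chainShortComplex`. -/
@[simps]
def chainShortComplexMap {Y Y' : ChainComplex L ℕ} (f : Y ⟶ Y') :
    chainShortComplex i p w Y ⟶ chainShortComplex i p w Y' where
  τ₁ := (A₁.mapHomologicalComplex _).map f
  τ₂ := (A₂.mapHomologicalComplex _).map f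
  τ₃ := (A₃.mapHomologicalComplex _).map f
  comm₁₂ := (NatTrans.mapHomologicalComplex i _).naturality f
  comm₂₃ := (NatTrans.mapHomologicalComplex p _).naturality f

lemma chainShortComplex_shortExact (Y : ChainComplex L ℕ)
    (h : ∀ n, (ShortComplex.mk _ _ (w (Y.X n))).ShortExact) :
    (chainShortComplex i p w Y).ShortExact :=
  HomologicalComplex.shortExact_of_degreewise_shortExact _ h

end FunctorShortComplex

/-- Five lemma on the six-term piece of the long exact sequence with homology in degrees `n + 1` and
`n`: the map on `H_n` of the first terms sits in position `3`, between the maps of the second and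
third terms. -/
lemma quasiIso_τ₁ {A : Type*} [Category* A] [Abelian A] {S S' : ShortComplex (ChainComplex A ℕ)}
    (φ : S ⟶ S') (hS : S.ShortExact) (hS' : S'.ShortExact) (h₂ : QuasiIso φ.τ₂)
    (h₃ : QuasiIso φ.τ₃) : QuasiIso φ.τ₁ := by
  rw [quasiIso_iff]
  intro n
  rw [quasiIsoAt_iff_isIso_homologyMap]
  have hn : (ComplexShape.down ℕ).Rel (n + 1) n := rfl
  have h2 : IsIso (HomologicalComplex.homologyMap φ.τ₂ (n + 1)) := inferInstance
  have h3 : IsIso (HomologicalComplex.homologyMap φ.τ₃ (n + 1)) := inferInstance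
  have h2' : IsIso (HomologicalComplex.homologyMap φ.τ₂ n) := inferInstance
  have h3' : IsIso (HomologicalComplex.homologyMap φ.τ₃ n) := inferInstance
  exact Abelian.isIso_of_epi_of_isIso_of_isIso_of_mono'
    (k := 1) (by omega)
    (HomologicalComplex.HomologySequence.composableArrows₅_exact hS (n + 1) n hn)
    (HomologicalComplex.HomologySequence.composableArrows₅_exact hS' (n + 1) n hn)
    (HomologicalComplex.HomologySequence.mapComposableArrows₅ φ hS hS' (n + 1) n hn)
    1 2 3 4 5 rfl rfl rfl rfl rfl (IsIso.epi_of_iso (HomologicalComplex.homologyMap φ.τ₂ (n + 1)))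
    h3 h2' (IsIso.mono_of_iso (HomologicalComplex.homologyMap φ.τ₃ n))

/-! ### Relatively projective objects and dimension shifting along the kernel of the counit -/

section RelativelyProjective

variable {L : Type*} [Category* L] {G : L ⥤ L} (ε : G ⟶ 𝟭 L)

/-- The objects `X` such that `G X ⟶ X` is a split epimorphism. -/
def RelProj : ObjectProperty L := fun X => ∃ s : X ⟶ G.obj X, s ≫ ε.app X = 𝟙 X

variable {ε}

lemma RelProj.of_retract {X Y : L} (hY : RelProj ε Y) (i : X ⟶ Y) (r : Y ⟶ X) (h : i ≫ r = 𝟙 X) :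
    RelProj ε X := by
  obtain ⟨s, hs⟩ := hY
  refine ⟨i ≫ s ≫ G.map r, ?_⟩
  rw [Category.assoc, Category.assoc, ε.naturality, reassoc_of% hs]
  exact h

variable [Abelian L] (ε)

/-- The kernel of `G ⟶ 𝟭`. -/
@[simps]
def kerFunctor : L ⥤ L where
  obj X := kernel (ε.app X)
  map f := kernel.map _ _ (G.map f) f (ε.naturality f).symm

/-- The inclusion of the kernel of `G ⟶ 𝟭`. -/
@[simps]
def kerFunctorι : kerFunctor ε ⟶ G where
  app X := kernel.ι (ε.app X)
  naturality _ _ _ := kernel.lift_ι _ _ _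

instance (X : L) : Mono ((kerFunctorι ε).app X) := inferInstanceAs (Mono (kernel.ι (ε.app X)))

instance [G.Additive] : (kerFunctor ε).Additive where
  map_add {X Y f g} := by
    rw [← cancel_mono ((kerFunctorι ε).app Y), Preadditive.add_comp, NatTrans.naturality,
      NatTrans.naturality, NatTrans.naturality, Functor.map_add, Preadditive.comp_add]

lemma kerFunctor_w (X : L) : (kerFunctorι ε).app X ≫ ε.app X = 0 := kernel.condition _

lemma kerFunctor_shortExact (hε : ∀ X, Epi (ε.app X)) (X : L) :
    (ShortComplex.mk _ _ (kerFunctor_w ε X)).ShortExact where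
  exact := ShortComplex.exact_of_f_is_kernel _ (kernelIsKernel _)
  mono_f := inferInstanceAs (Mono ((kerFunctorι ε).app X))
  epi_g := hε X

variable {ε} in
lemma RelProj.nonempty_splitting {X : L} (hX : RelProj ε X) :
    Nonempty (ShortComplex.mk _ _ (kerFunctor_w ε X)).Splitting := by
  obtain ⟨s, hs⟩ := hX
  exact ⟨ShortComplex.Splitting.ofExactOfSection _
    (ShortComplex.exact_of_f_is_kernel _ (kernelIsKernel _)) s hs
    (inferInstanceAs (Mono ((kerFunctorι ε).app X)))⟩

variable {ε} in
-- When the counit splits, its kernel is a retract of `G X`. This keeps dimension shifting inside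
-- the relatively projective objects.
lemma RelProj.kerFunctor (hG : ∀ X, RelProj ε (G.obj X)) {X : L} (hX : RelProj ε X) :
    RelProj ε ((kerFunctor ε).obj X) := by
  obtain ⟨s⟩ := hX.nonempty_splitting
  exact (hG X).of_retract _ s.r s.f_r

variable {A : Type*} [Category* A] [Abelian A] (l : L ⥤ A) [l.Additive]

lemma kerFunctor_comp_w (X : L) : (Functor.whiskerRight (kerFunctorι ε) l).app X ≫
    (Functor.whiskerRight ε l ≫ l.leftUnitor.hom).app X = 0 := by
  have h := congrArg l.map (kerFunctor_w ε X)
  rw [l.map_comp, l.map_zero] at h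
  simpa using h

/-- For a relatively projective `X` the sequence `ker → G X → X` splits, and a split sequence stays
exact under any additive functor, even when `l` is not exact. -/
lemma RelProj.shortExact_comp {X : L} (hX : RelProj ε X) :
    (ShortComplex.mk _ _ (kerFunctor_comp_w ε l X)).ShortExact := by
  obtain ⟨s⟩ := hX.nonempty_splitting
  let e : (ShortComplex.mk _ _ (kerFunctor_w ε X)).map l ≅
      ShortComplex.mk _ _ (kerFunctor_comp_w ε l X) :=
    ShortComplex.isoMk (Iso.refl _) (Iso.refl _) (Iso.refl _)
      ((Category.id_comp _).trans (Category.comp_id _).symm)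
      (Category.id_comp _)
  exact ShortComplex.shortExact_of_iso e (s.map l).shortExact

variable [G.Additive] [G.PreservesHomology]

/-- `G` and the identity preserve quasi-isomorphisms, and the kernel is the first term of a short
exact sequence with these as the other two. No relative projectivity is needed. -/
lemma quasiIso_kerFunctor_map (hε : ∀ X, Epi (ε.app X)) {Y Y' : ChainComplex L ℕ} (f : Y ⟶ Y')
    [hf : QuasiIso f] : QuasiIso (((kerFunctor ε).mapHomologicalComplex _).map f) :=
  quasiIso_τ₁ (chainShortComplexMap (kerFunctorι ε) ε (kerFunctor_w ε) f)
    (chainShortComplex_shortExact _ _ _ _ fun _ => kerFunctor_shortExact ε hε _)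
    (chainShortComplex_shortExact _ _ _ _ fun _ => kerFunctor_shortExact ε hε _)
    (inferInstanceAs (QuasiIso ((G.mapHomologicalComplex _).map f))) hf

/-- A functor which is exact on relatively projective objects preserves quasi-isomorphisms between
complexes of relatively projective objects. -/
lemma quasiIso_map_of_relProj [(G ⋙ l).PreservesHomology] (hε : ∀ X, Epi (ε.app X)) (hG : ∀ X, RelProj ε (G.obj X))
    {Y Y' : ChainComplex L ℕ} (f : Y ⟶ Y') [QuasiIso f] (hY : ∀ n, RelProj ε (Y.X n))
    (hY' : ∀ n, RelProj ε (Y'.X n)) : QuasiIso ((l.mapHomologicalComplex _).map f) := by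
  have key₂ {Y Y' : ChainComplex L ℕ} (f : Y ⟶ Y') [QuasiIso f] :
      QuasiIso (((G ⋙ l).mapHomologicalComplex (ComplexShape.down ℕ)).map f) := inferInstance
  have hexact {Y : ChainComplex L ℕ} (hY : ∀ n, RelProj ε (Y.X n)) :=
    chainShortComplex_shortExact _ _ (kerFunctor_comp_w ε l) Y fun n =>
      (hY n).shortExact_comp ε l
  have key : ∀ (n : ℕ) {Y Y' : ChainComplex L ℕ} (f : Y ⟶ Y') [QuasiIso f]
      (_ : ∀ n, RelProj ε (Y.X n)) (_ : ∀ n, RelProj ε (Y'.X n)),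
      IsIso (HomologicalComplex.homologyMap ((l.mapHomologicalComplex _).map f) n) := by
    -- Four lemma for `0 → lK → lG → l → 0`, where `K` is the kernel functor: `lG` is exact, so
    -- surjectivity on `H_n` of `l f` needs information only on `H_{n-1}` of `l(K f)`, which the
    -- induction supplies because it ranges over all `f`.
    have hepi (n : ℕ) (hn : ∀ m, (ComplexShape.down ℕ).Rel n m →
        ∀ {Y Y' : ChainComplex L ℕ} (f : Y ⟶ Y') [QuasiIso f]
          (_ : ∀ n, RelProj ε (Y.X n)) (_ : ∀ n, RelProj ε (Y'.X n)),
          IsIso (HomologicalComplex.homologyMap ((l.mapHomologicalComplex _).map f) m))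
        {Y Y' : ChainComplex L ℕ} (f : Y ⟶ Y') [QuasiIso f]
        (hY : ∀ n, RelProj ε (Y.X n)) (hY' : ∀ n, RelProj ε (Y'.X n)) :
        Epi (HomologicalComplex.homologyMap ((l.mapHomologicalComplex _).map f) n) := by
      have := quasiIso_kerFunctor_map ε hε f
      have := key₂ f
      refine HomologicalComplex.HomologySequence.epi_homologyMap_τ₃
        (chainShortComplexMap _ _ (kerFunctor_comp_w ε l) f) (hexact hY) (hexact hY') n ?_ ?_ ?_
      · exact inferInstanceAs (Epi (HomologicalComplex.homologyMap
          (((G ⋙ l).mapHomologicalComplex (ComplexShape.down ℕ)).map f) n))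
      · intro m hm
        have := hn m hm (((kerFunctor ε).mapHomologicalComplex _).map f)
          (fun n => (hY n).kerFunctor hG) (fun n => (hY' n).kerFunctor hG)
        exact IsIso.epi_of_iso (HomologicalComplex.homologyMap ((l.mapHomologicalComplex _).map
          (((kerFunctor ε).mapHomologicalComplex _).map f)) m)
      · intro m _
        exact inferInstanceAs (Mono (HomologicalComplex.homologyMap
          (((G ⋙ l).mapHomologicalComplex (ComplexShape.down ℕ)).map f) m))
    have hiso (n : ℕ) (hn : ∀ m, (ComplexShape.down ℕ).Rel n m →
        ∀ {Y Y' : ChainComplex L ℕ} (f : Y ⟶ Y') [QuasiIso f]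
          (_ : ∀ n, RelProj ε (Y.X n)) (_ : ∀ n, RelProj ε (Y'.X n)),
          IsIso (HomologicalComplex.homologyMap ((l.mapHomologicalComplex _).map f) m))
        {Y Y' : ChainComplex L ℕ} (f : Y ⟶ Y') [QuasiIso f]
        (hY : ∀ n, RelProj ε (Y.X n)) (hY' : ∀ n, RelProj ε (Y'.X n)) :
        IsIso (HomologicalComplex.homologyMap ((l.mapHomologicalComplex _).map f) n) := by
      have := quasiIso_kerFunctor_map ε hε f
      have := key₂ f
      have := hepi n hn f hY hY'
      have : Mono (HomologicalComplex.homologyMap ((l.mapHomologicalComplex _).map f) n) := by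
        -- Injectivity needs surjectivity on `H_n` of `l(K f)` in the same degree. This is why
        -- `hepi` is proved first, for every `f`.
        refine HomologicalComplex.HomologySequence.mono_homologyMap_τ₃
          (chainShortComplexMap _ _ (kerFunctor_comp_w ε l) f) (hexact hY) (hexact hY') n ?_ ?_ ?_
        · exact hepi n hn (((kerFunctor ε).mapHomologicalComplex _).map f)
            (fun n => (hY n).kerFunctor hG) (fun n => (hY' n).kerFunctor hG)
        · exact inferInstanceAs (Mono (HomologicalComplex.homologyMap
            (((G ⋙ l).mapHomologicalComplex (ComplexShape.down ℕ)).map f) n))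
        · intro m hm
          have := hn m hm (((kerFunctor ε).mapHomologicalComplex _).map f)
            (fun n => (hY n).kerFunctor hG) (fun n => (hY' n).kerFunctor hG)
          exact IsIso.mono_of_iso (HomologicalComplex.homologyMap ((l.mapHomologicalComplex _).map
            (((kerFunctor ε).mapHomologicalComplex _).map f)) m)
      exact isIso_of_mono_of_epi _
    intro n
    induction n with
    -- No degree lies below `0`, so the induction starts with nothing to check.
    | zero => exact hiso 0 (fun m hm => absurd hm (by simp))
    | succ n ih =>
      refine hiso (n + 1) (fun m hm => ?_)
      obtain rfl : m = n := by simpa using hm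
      exact ih
  rw [quasiIso_iff]
  intro n
  rw [quasiIsoAt_iff_isIso_homologyMap]
  exact key n f hY hY'

end RelativelyProjective

end LaxDescent

end

noncomputable section

namespace LaxDescent

/-! ### Free lax sections -/

section FreeLax

variable {I : Type u} [Category.{v} I] {M : CatDiagram.{w, u'} I}

variable (M) in
/-- The functor which forgets the structure maps of lax sections. -/
@[simps]
def evPi : LaxLimit M ⥤ ∀ i, M.obj i where
  obj E i := E.x i
  map f i := f.app i

lemma CatDiagram.mapComp_inv_id_right {i j : I} (θ : i ⟶ j) (x : M.obj i) :
    (M.mapComp θ (𝟙 j)).inv.app x =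
      (M.mapId j).hom.app ((M.map θ).obj x) ≫ eqToHom (by rw [Category.comp_id]; rfl) := by
  have h := M.mapComp_id_right θ x
  rw [← cancel_epi ((M.mapComp θ (𝟙 j)).hom.app x), Iso.hom_inv_id_app, ← Category.assoc, h,
    eqToHom_trans, eqToHom_refl]

/-- The associativity coherence, inverted. Structure maps of free lax sections send the summand of
`θ` to that of `θ ≫ δ` through the inverse of `mapComp`, so their cocycle identity uses coherence in
this form. -/
lemma CatDiagram.mapComp_inv_assoc {i j k l : I} (θ : i ⟶ j) (δ : j ⟶ k) (ε : k ⟶ l)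
    (x : M.obj i) :
    (M.map ε).map ((M.mapComp θ δ).inv.app x) ≫ (M.mapComp (θ ≫ δ) ε).inv.app x =
      (M.mapComp δ ε).inv.app ((M.map θ).obj x) ≫ (M.mapComp θ (δ ≫ ε)).inv.app x ≫
        eqToHom (by rw [Category.assoc]) := by
  have h := M.mapComp_assoc θ δ ε x
  have h' : (M.map ε).map ((M.mapComp θ δ).hom.app x) =
      (M.mapComp (θ ≫ δ) ε).inv.app x ≫ eqToHom (by rw [Category.assoc]) ≫
        (M.mapComp θ (δ ≫ ε)).hom.app x ≫ (M.mapComp δ ε).hom.app ((M.map θ).obj x) := by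
    rw [← cancel_epi ((M.mapComp (θ ≫ δ) ε).hom.app x), h, Iso.hom_inv_id_app_assoc]
  rw [← cancel_epi ((M.map ε).map ((M.mapComp θ δ).hom.app x)), ← Functor.map_comp_assoc,
    Iso.hom_inv_id_app, h']
  have e₁ := (M.mapComp δ ε).hom_inv_id_app_assoc ((M.map θ).obj x)
    ((M.mapComp θ (δ ≫ ε)).inv.app x ≫ eqToHom (by rw [Category.assoc]) :
      _ ⟶ (M.map ((θ ≫ δ) ≫ ε)).obj x)
  refine Eq.symm ?_
  refine (Category.assoc _ _ _).trans ?_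
  refine (congrArg (_ ≫ ·) (Category.assoc _ _ _)).trans ?_
  refine (congrArg (fun t => (M.mapComp (θ ≫ δ) ε).inv.app x ≫ eqToHom _ ≫ t)
    ((Category.assoc _ _ _).trans (congrArg (_ ≫ ·) e₁))).trans ?_
  rw [Iso.hom_inv_id_app_assoc, eqToHom_trans, eqToHom_refl, Category.comp_id]
  exact (((M.map ε).map_id _ =≫ _).trans (Category.id_comp _)).symm

lemma LaxLimit.mono_of_app {E E' : LaxLimit M} (f : E ⟶ E') (h : ∀ i, Mono (f.app i)) :
    Mono f where
  right_cancellation a b hab := by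
    ext i
    exact (h i).right_cancellation _ _ (congrArg (fun g => LaxLimit.Hom.app g i) hab)

lemma LaxLimit.epi_of_app {E E' : LaxLimit M} (f : E ⟶ E') (h : ∀ i, Epi (f.app i)) :
    Epi f where
  left_cancellation a b hab := by
    ext i
    exact (h i).left_cancellation _ _ (congrArg (fun g => LaxLimit.Hom.app g i) hab)

variable [∀ i, HasCoproducts.{max u v} (M.obj i)]

/-- The terms of a free lax section. -/
abbrev freeX (y : ∀ i, M.obj i) (j : I) : M.obj j :=
  ∐ fun k : Σ i, (i ⟶ j) => (M.map k.2).obj (y k.1)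

/-- The inclusions in the terms of a free lax section. -/
abbrev freeι (y : ∀ i, M.obj i) {i j : I} (θ : i ⟶ j) : (M.map θ).obj (y i) ⟶ freeX y j :=
  Sigma.ι (fun k : Σ i, (i ⟶ j) => (M.map k.2).obj (y k.1)) ⟨i, θ⟩

lemma eqToHom_freeι (y : ∀ i, M.obj i) {i j : I} {θ θ' : i ⟶ j} (h : θ = θ') :
    eqToHom (by rw [h]) ≫ freeι y θ' = freeι y θ := by
  subst h
  simp

variable [∀ {i j : I} (θ : i ⟶ j) (T : Type (max u v)),
  PreservesColimitsOfShape (Discrete T) (M.map θ)]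

lemma map_freeX_hom_ext (y : ∀ i, M.obj i) {j k : I} (δ : j ⟶ k) {z : M.obj k}
    {f g : (M.map δ).obj (freeX y j) ⟶ z}
    (h : ∀ {i} (θ : i ⟶ j), (M.map δ).map (freeι y θ) ≫ f = (M.map δ).map (freeι y θ) ≫ g) :
    f = g :=
  (isColimitOfPreserves (M.map δ) (colimit.isColimit (Discrete.functor
    fun k : Σ i, (i ⟶ j) => (M.map k.2).obj (y k.1)))).hom_ext fun ⟨⟨_, θ⟩⟩ => h θ

/-- The structure maps of a free lax section. -/
def freeU (y : ∀ i, M.obj i) {j k : I} (δ : j ⟶ k) : (M.map δ).obj (freeX y j) ⟶ freeX y k :=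
  (isColimitOfPreserves (M.map δ) (colimit.isColimit (Discrete.functor
    fun k : Σ i, (i ⟶ j) => (M.map k.2).obj (y k.1)))).desc
      ⟨_, Discrete.natTrans fun k =>
        (M.mapComp k.as.2 δ).inv.app (y k.as.1) ≫ freeι y (k.as.2 ≫ δ)⟩

lemma ι_freeU (y : ∀ i, M.obj i) {i j k : I} (θ : i ⟶ j) (δ : j ⟶ k) :
    (M.map δ).map (freeι y θ) ≫ freeU y δ =
      (M.mapComp θ δ).inv.app (y i) ≫ freeι y (θ ≫ δ) :=
  (isColimitOfPreserves (M.map δ) (colimit.isColimit (Discrete.functor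
    fun k : Σ i, (i ⟶ j) => (M.map k.2).obj (y k.1)))).fac _ ⟨⟨i, θ⟩⟩

/-- The free lax section generated by a family of objects. -/
@[simps]
def freeObj (y : ∀ i, M.obj i) : LaxLimit M where
  x j := freeX y j
  u δ := freeU y δ
  u_id j := by
    refine map_freeX_hom_ext y _ fun {i} θ => ?_
    rw [ι_freeU, CatDiagram.mapComp_inv_id_right, Category.assoc,
      eqToHom_freeι y (Category.comp_id θ).symm]
    exact ((M.mapId j).hom.naturality (freeι y θ)).symm
  u_comp {j k l} δ ε := by
    refine map_freeX_hom_ext y _ fun {i} θ => ?_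
    rw [ι_freeU]
    refine Eq.symm (((M.mapComp δ ε).hom.naturality_assoc (freeι y θ) _).trans ?_)
    refine (congrArg (_ ≫ ·) ((Category.assoc _ _ _).symm.trans
      (congrArg (· ≫ _) (((M.map ε).map_comp _ _).symm.trans
        (congrArg (M.map ε).map (ι_freeU y θ δ)))))).trans ?_
    rw [Functor.map_comp, Category.assoc, ι_freeU,
      ← Category.assoc ((M.map ε).map ((M.mapComp θ δ).inv.app (y i))),
      CatDiagram.mapComp_inv_assoc, Category.assoc, Category.assoc,
      eqToHom_freeι y (Category.assoc θ δ ε).symm]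
    exact (M.mapComp δ ε).hom_inv_id_app_assoc ((M.map θ).obj (y i)) _

omit [∀ {i j : I} (θ : i ⟶ j) (T : Type (max u v)),
  PreservesColimitsOfShape (Discrete T) (M.map θ)] in
lemma freeX_hom_ext (y : ∀ i, M.obj i) {j : I} {z : M.obj j} {f g : freeX y j ⟶ z}
    (h : ∀ {i} (θ : i ⟶ j), freeι y θ ≫ f = freeι y θ ≫ g) : f = g :=
  Sigma.hom_ext _ _ fun k => h k.2

/-- The components of the morphisms from a free lax section. -/
def freeDescApp (y : ∀ i, M.obj i) (E : LaxLimit M) (g : ∀ i, y i ⟶ E.x i) (j : I) :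
    freeX y j ⟶ E.x j :=
  Sigma.desc fun k => (M.map k.2).map (g k.1) ≫ E.u k.2

omit [∀ {i j : I} (θ : i ⟶ j) (T : Type (max u v)),
  PreservesColimitsOfShape (Discrete T) (M.map θ)] in
lemma ι_freeDescApp (y : ∀ i, M.obj i) (E : LaxLimit M) (g : ∀ i, y i ⟶ E.x i) {i j : I}
    (θ : i ⟶ j) : freeι y θ ≫ freeDescApp y E g j = (M.map θ).map (g i) ≫ E.u θ :=
  Sigma.ι_desc (fun k : Σ i, (i ⟶ j) => (M.map k.2).map (g k.1) ≫ E.u k.2) ⟨i, θ⟩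

lemma map_freeDescApp_u (y : ∀ i, M.obj i) (E : LaxLimit M) (g : ∀ i, y i ⟶ E.x i) {j k : I}
    (δ : j ⟶ k) : (M.map δ).map (freeDescApp y E g j) ≫ E.u δ =
      freeU y δ ≫ freeDescApp y E g k := by
  refine map_freeX_hom_ext y _ fun {i} θ => ?_
  rw [← Functor.map_comp_assoc, ι_freeDescApp, ← Category.assoc _ (freeU y δ), ι_freeU,
    Category.assoc,
    ι_freeDescApp, E.u_comp, ← Category.assoc ((M.map (θ ≫ δ)).map (g i)),
    (M.mapComp θ δ).hom.naturality, Functor.map_comp]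
  refine Eq.symm ((congrArg (_ ≫ ·) (Category.assoc _ _ _)).trans
    (((M.mapComp θ δ).inv_hom_id_app_assoc _ _).trans ?_))
  exact (Category.assoc _ _ _).symm

/-- Morphisms from a free lax section. -/
@[simps]
def freeDesc (y : ∀ i, M.obj i) (E : LaxLimit M) (g : ∀ i, y i ⟶ E.x i) : freeObj y ⟶ E where
  app j := freeDescApp y E g j
  comm δ := map_freeDescApp_u y E g δ

/-- The generators of a free lax section. -/
def freeUnit (y : ∀ i, M.obj i) (i : I) : y i ⟶ freeX y i :=
  (M.mapId i).inv.app (y i) ≫ freeι y (𝟙 i)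

/-- Every summand is the image of a generator, the summand of an identity, under a structure map.
Hence a morphism out of a free lax section is determined by its values on generators. -/
lemma freeι_eq (y : ∀ i, M.obj i) {i j : I} (θ : i ⟶ j) :
    (M.map θ).map (freeUnit y i) ≫ freeU y θ = freeι y θ := by
  rw [freeUnit, Functor.map_comp, Category.assoc, ι_freeU]
  have h := M.mapComp_id_left θ (y i)
  have h' : (M.map θ).map ((M.mapId i).inv.app (y i)) ≫ (M.mapComp (𝟙 i) θ).inv.app (y i) =
      eqToHom (by rw [Category.id_comp]; rfl) := by
    have e : (M.mapComp (𝟙 i) θ).hom.app (y i) ≫ (M.map θ).map ((M.mapId i).hom.app (y i)) ≫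
      (M.map θ).map ((M.mapId i).inv.app (y i)) ≫ (M.mapComp (𝟙 i) θ).inv.app (y i) = 𝟙 _ := by
      rw [← Functor.map_comp_assoc, Iso.hom_inv_id_app]
      exact (congrArg (_ ≫ ·) (((M.map θ).map_id _ =≫ _).trans (Category.id_comp _))).trans
        (Iso.hom_inv_id_app _ _)
    rw [← Category.assoc, h] at e
    have e' := congrArg (eqToHom (show (M.map θ).obj (y i) = (M.map (𝟙 i ≫ θ)).obj (y i) by
      rw [Category.id_comp]) ≫ ·) e
    refine Eq.trans ?_ (e'.trans (Category.comp_id _))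
    refine ((Category.assoc _ _ _).symm.trans ((congrArg (· ≫ _) (eqToHom_trans _ _)).trans
      (Category.id_comp _))).symm
  refine (Category.assoc _ _ _).symm.trans ((congrArg (· ≫ _) h').trans ?_)
  exact eqToHom_freeι y (Category.id_comp θ).symm

/-- The universal property of free lax sections. -/
def freeHomEquiv (y : ∀ i, M.obj i) (E : LaxLimit M) :
    (freeObj y ⟶ E) ≃ (∀ i, y i ⟶ E.x i) where
  toFun f i := freeUnit y i ≫ f.app i
  invFun := freeDesc y E
  left_inv f := by
    ext j
    refine freeX_hom_ext y fun {i} θ =>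
      (ι_freeDescApp y E (fun i => freeUnit y i ≫ f.app i) θ).trans ?_
    rw [← freeι_eq y θ]
    refine ((M.map θ).map_comp (freeUnit y i) (f.app i) =≫ _).trans ?_
    exact (Category.assoc _ _ _).trans
      ((congrArg (_ ≫ ·) (f.comm θ)).trans (Category.assoc _ _ _).symm)
  right_inv g := by
    funext i
    change ((M.mapId i).inv.app (y i) ≫ freeι y (𝟙 i)) ≫ freeDescApp y E g i = g i
    rw [Category.assoc, ι_freeDescApp, E.u_id, (M.mapId i).hom.naturality]
    exact (M.mapId i).inv_hom_id_app_assoc _ _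

/-- The components of the functoriality of free lax sections. -/
def freeMapApp {y z : ∀ i, M.obj i} (f : ∀ i, y i ⟶ z i) (j : I) : freeX y j ⟶ freeX z j :=
  Limits.Sigma.map fun k : Σ i, (i ⟶ j) => (M.map k.2).map (f k.1)

omit [∀ {i j : I} (θ : i ⟶ j) (T : Type (max u v)),
  PreservesColimitsOfShape (Discrete T) (M.map θ)] in
lemma ι_freeMapApp {y z : ∀ i, M.obj i} (f : ∀ i, y i ⟶ z i) {i j : I} (θ : i ⟶ j) :
    freeι y θ ≫ freeMapApp f j = (M.map θ).map (f i) ≫ freeι z θ :=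
  Sigma.ι_map (fun k : Σ i, (i ⟶ j) => (M.map k.2).map (f k.1)) ⟨i, θ⟩

lemma map_freeMapApp_freeU {y z : ∀ i, M.obj i} (f : ∀ i, y i ⟶ z i) {j k : I} (δ : j ⟶ k) :
    (M.map δ).map (freeMapApp f j) ≫ freeU z δ = freeU y δ ≫ freeMapApp f k := by
  refine map_freeX_hom_ext y _ fun {i} θ => ?_
  rw [← Functor.map_comp_assoc, ι_freeMapApp, Functor.map_comp, Category.assoc]
  refine (congrArg (_ ≫ ·) (ι_freeU z θ δ)).trans ?_
  rw [← Category.assoc ((M.map δ).map (freeι y θ)), ι_freeU, Category.assoc, ι_freeMapApp]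
  exact ((M.mapComp θ δ).inv.naturality_assoc (f i) _)

/-- The functoriality of free lax sections. -/
@[simps]
def freeMap {y z : ∀ i, M.obj i} (f : ∀ i, y i ⟶ z i) : freeObj y ⟶ freeObj z where
  app j := freeMapApp f j
  comm δ := map_freeMapApp_freeU f δ

variable (M) in
/-- The functor of free lax sections. -/
@[simps]
def free : (∀ i, M.obj i) ⥤ LaxLimit M where
  obj y := freeObj y
  map {y z} f := freeMap f
  map_id y := by
    ext j
    refine freeX_hom_ext y fun {i} θ => ?_
    refine (ι_freeMapApp _ θ).trans ?_
    exact (congrArg (· ≫ _) ((M.map θ).map_id _)).trans ((Category.id_comp _).trans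
      (Category.comp_id _).symm)
  map_comp {y z t} f g := by
    ext j
    refine freeX_hom_ext _ fun {i} θ => ?_
    refine (ι_freeMapApp _ θ).trans ?_
    change (M.map θ).map (f i ≫ g i) ≫ _ = freeι y θ ≫ freeMapApp f j ≫ freeMapApp g j
    rw [← Category.assoc (freeι y θ), ι_freeMapApp, Category.assoc, ι_freeMapApp,
      Functor.map_comp, Category.assoc]

variable (M) in
/-- Free lax sections are left adjoint to the forgetful functor. -/
def freeAdj : free M ⊣ evPi M :=
  Adjunction.mkOfHomEquiv
    { homEquiv y E := freeHomEquiv (M := M) y E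
      homEquiv_naturality_left_symm {y z E} f g := by
        ext j
        refine freeX_hom_ext _ fun {i} θ => ?_
        refine (ι_freeDescApp y E _ θ).trans ?_
        change (M.map θ).map (f i ≫ g i) ≫ _ = freeι y θ ≫ freeMapApp f j ≫ freeDescApp z E g j
        rw [← Category.assoc (freeι y θ), ι_freeMapApp, Category.assoc, Functor.map_comp]
        exact (Category.assoc _ _ _).trans (congrArg (_ ≫ ·) (ι_freeDescApp z E g θ).symm)
      homEquiv_naturality_right {y E E'} f g := by
        funext i
        exact (Category.assoc (freeUnit y i) (f.app i) (g.app i)).symm }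


lemma freeAdj_counit_app_app (E : LaxLimit M) (j : I) :
    ((freeAdj M).counit.app E).app j = freeDescApp E.x E (fun i => 𝟙 (E.x i)) j := rfl

/-- In each level the counit is split by the inclusion of the generators. These splittings need not
commute with the structure maps, so the counit itself need not split, but being epi can be tested
levelwise. -/
instance (E : LaxLimit M) : Epi ((freeAdj M).counit.app E) := by
  refine LaxLimit.epi_of_app _ fun j => ?_
  have h : freeUnit E.x j ≫ freeDescApp E.x E (fun i => 𝟙 (E.x i)) j = 𝟙 (E.x j) :=
    congrFun ((freeHomEquiv E.x E).right_inv fun i => 𝟙 (E.x i)) j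
  have : IsSplitEpi (freeDescApp E.x E (fun i => 𝟙 (E.x i)) j) := ⟨⟨_, h⟩⟩
  exact inferInstanceAs (Epi (freeDescApp E.x E (fun i => 𝟙 (E.x i)) j))

variable (M) in
/-- The comonad of free lax sections. -/
abbrev freeG : LaxLimit M ⥤ LaxLimit M := evPi M ⋙ free M

variable (M) in
/-- The counit of the comonad of free lax sections. -/
abbrev freeε : freeG M ⟶ 𝟭 (LaxLimit M) := (freeAdj M).counit

/-- The section is `free` applied to the unit, by a triangle identity. -/
lemma relProj_free (y : ∀ i, M.obj i) : RelProj (freeε M) ((free M).obj y) :=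
  ⟨(free M).map ((freeAdj M).unit.app y), (freeAdj M).left_triangle_components y⟩

end FreeLax

/-! ### Exactness of the comonad of free lax sections -/

section FreeLaxExact

variable {I : Type u} [Category.{v} I] (M : CatDiagram.{w, u'} I)
  [∀ i : I, Abelian (M.obj i)] [∀ {i j : I} (θ : i ⟶ j), (M.map θ).Additive]
  [∀ {i j : I} (θ : i ⟶ j), PreservesFiniteColimits (M.map θ)]

instance {J : Type*} [Category J] [∀ i : I, HasColimitsOfShape J (M.obj i)]
    [∀ {i j : I} (θ : i ⟶ j), PreservesColimitsOfShape J (M.map θ)] :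
    PreservesColimitsOfShape J (evPi M) where
  preservesColimit {K} :=
    { preserves {c} hc := ⟨
        { desc s i := (isColimitOfPreserves (LaxLimit.ev M i) hc).desc
            ⟨s.pt i, { app a := s.ι.app a i, naturality a b f := congrFun (s.ι.naturality f) i }⟩
          fac s a := by
            funext i
            exact (isColimitOfPreserves (LaxLimit.ev M i) hc).fac _ a
          uniq s m hm := by
            funext i
            exact (isColimitOfPreserves (LaxLimit.ev M i) hc).uniq
              ⟨s.pt i, { app a := s.ι.app a i, naturality a b f := congrFun (s.ι.naturality f) i }⟩
              (m i) fun a => congrFun (hm a) i }⟩ }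

variable [∀ i, HasCoproducts.{max u v} (M.obj i)]
  [∀ {i j : I} (θ : i ⟶ j) (T : Type (max u v)), PreservesColimitsOfShape (Discrete T) (M.map θ)]

instance : (freeG M).Additive where
  map_add {E E' f g} := by
    ext j
    refine freeX_hom_ext E.x fun {i} θ => ?_
    refine (ι_freeMapApp (fun i => (f + g).app i) θ).trans ?_
    change (M.map θ).map (f.app i + g.app i) ≫ _ =
      freeι E.x θ ≫ (freeMapApp (fun i => f.app i) j + freeMapApp (fun i => g.app i) j)
    rw [Functor.map_add, Preadditive.add_comp, Preadditive.comp_add, ι_freeMapApp, ι_freeMapApp]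

variable [∀ i, AB4OfSize.{max u v} (M.obj i)]
  [∀ {i j : I} (θ : i ⟶ j), PreservesFiniteLimits (M.map θ)]

/-- The functors `M.map θ` are left exact and coproducts are exact by AB4; monomorphisms of lax
sections can be tested levelwise. -/
lemma mono_freeMap {y z : ∀ i, M.obj i} (f : ∀ i, y i ⟶ z i) (hf : ∀ i, Mono (f i)) :
    Mono ((free M).map (f : y ⟶ z)) := by
  refine LaxLimit.mono_of_app _ fun j => ?_
  have : Mono (Discrete.natTrans (F := Discrete.functor fun k : Σ i, (i ⟶ j) =>
      (M.map k.2).obj (y k.1)) (G := Discrete.functor fun k : Σ i, (i ⟶ j) =>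
      (M.map k.2).obj (z k.1)) fun k => (M.map k.as.2).map (f k.as.1)) :=
    haveI (k : Discrete (Σ i, (i ⟶ j))) : Mono ((Discrete.natTrans (F := Discrete.functor
      fun k : Σ i, (i ⟶ j) => (M.map k.2).obj (y k.1)) (G := Discrete.functor
      fun k : Σ i, (i ⟶ j) => (M.map k.2).obj (z k.1)) fun k =>
        (M.map k.as.2).map (f k.as.1)).app k) :=
      inferInstanceAs (Mono ((M.map k.as.2).map (f k.as.1)))
    NatTrans.mono_of_mono_app _
  exact inferInstanceAs (Mono (colim.map (Discrete.natTrans (F := Discrete.functor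
    fun k : Σ i, (i ⟶ j) => (M.map k.2).obj (y k.1)) (G := Discrete.functor
    fun k : Σ i, (i ⟶ j) => (M.map k.2).obj (z k.1)) fun k => (M.map k.as.2).map (f k.as.1))))

instance : (freeG M).PreservesMonomorphisms where
  preserves f _ := mono_freeMap M (fun i => f.app i) fun i =>
    inferInstanceAs (Mono ((LaxLimit.ev M i).map f))

/-- Colimits of lax sections are levelwise and `free` is a left adjoint, so cokernels are preserved;
with the preservation of monomorphisms this gives exactness. -/
instance : (freeG M).PreservesHomology := by
  have : PreservesColimitsOfShape WalkingParallelPair (evPi M) := inferInstance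
  have : PreservesColimitsOfSize.{0, 0} (free M) := (freeAdj M).leftAdjoint_preservesColimits
  exact Functor.preservesHomology_of_preservesMonos_and_cokernels _

end FreeLaxExact

end LaxDescent

end

noncomputable section

namespace LaxDescent

/-! ### Sections of sheaves of modules over slices -/

section Sections

variable {C : Type u} [SmallCategory C] {J : GrothendieckTopology C} (R : Sheaf J RingCat.{u})

/-- The sections over `s : W ⟶ Y` of a sheaf of modules on `C/Y`. -/
def Sec {Y : C} (M : SheafOfModules.{u} (R.over Y)) {W : C} (s : W ⟶ Y) : Type u :=
  M.val.obj (op (Over.mk s))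

variable {Y : C} (M N : SheafOfModules.{u} (R.over Y))

instance {W : C} (s : W ⟶ Y) : AddCommGroup (Sec R M s) :=
  inferInstanceAs (AddCommGroup (M.val.obj (op (Over.mk s))))

instance {W : C} (s : W ⟶ Y) : Module (R.obj.obj (op W)) (Sec R M s) :=
  (M.val.obj (op (Over.mk s))).isModule

/-- Restriction of sections. -/
def Sec.res {W W' : C} (t : W' ⟶ W) {s : W ⟶ Y} {s' : W' ⟶ Y} (e : t ≫ s = s') :
    Sec R M s →+ Sec R M s' :=
  (M.val.presheaf.map (Over.homMk t e : Over.mk s' ⟶ Over.mk s).op).hom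

variable {M N}

lemma Sec.res_smul {W W' : C} (t : W' ⟶ W) {s : W ⟶ Y} {s' : W' ⟶ Y} (e : t ≫ s = s')
    (a : R.obj.obj (op W)) (x : Sec R M s) :
    Sec.res R M t e (a • x) = (R.obj.map t.op a : R.obj.obj (op W')) • Sec.res R M t e x :=
  M.val.map_smul (Over.homMk t e : Over.mk s' ⟶ Over.mk s).op a x

lemma Sec.res_res {W W' W'' : C} (t : W' ⟶ W) (t' : W'' ⟶ W') {s : W ⟶ Y} {s' : W' ⟶ Y}
    {s'' : W'' ⟶ Y} (e : t ≫ s = s') (e' : t' ≫ s' = s'') (x : Sec R M s) :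
    Sec.res R M t' e' (Sec.res R M t e x) =
      Sec.res R M (t' ≫ t) (by rw [Category.assoc, e, e']) x := by
  have h := M.val.presheaf.map_comp (Over.homMk t e : Over.mk s' ⟶ Over.mk s).op
    (Over.homMk t' e' : Over.mk s'' ⟶ Over.mk s').op
  exact (congrArg (fun f => f.hom x) h).symm

lemma Sec.res_congr {W W' : C} {t t' : W' ⟶ W} (h : t = t') {s : W ⟶ Y} {s' : W' ⟶ Y}
    (e : t ≫ s = s') (x : Sec R M s) : Sec.res R M t e x = Sec.res R M t' (by rw [← h, e]) x := by
  subst h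
  rfl

lemma Sec.res_id {W : C} {t : W ⟶ W} (h : t = 𝟙 W) {s : W ⟶ Y} (e : t ≫ s = s)
    (x : Sec R M s) : Sec.res R M t e x = x := by
  subst h
  have h' : (Over.homMk (𝟙 W) e : Over.mk s ⟶ Over.mk s) = 𝟙 _ := by
    ext
    rfl
  exact congrArg (fun f => f.hom x) ((congrArg (fun t => M.val.presheaf.map t.op) h').trans
    (M.val.presheaf.map_id _))

/-- The action of morphisms on sections. -/
def Sec.map (f : M ⟶ N) {W : C} (s : W ⟶ Y) : Sec R M s →ₗ[R.obj.obj (op W)] Sec R N s :=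
  (f.val.app (op (Over.mk s))).hom

lemma Sec.map_res (f : M ⟶ N) {W W' : C} (t : W' ⟶ W) {s : W ⟶ Y} {s' : W' ⟶ Y}
    (e : t ≫ s = s') (x : Sec R M s) :
    Sec.map R f s' (Sec.res R M t e x) = Sec.res R N t e (Sec.map R f s x) :=
  PresheafOfModules.naturality_apply f.val (Over.homMk t e : Over.mk s' ⟶ Over.mk s).op x

lemma Sec.hom_ext {f g : M ⟶ N}
    (h : ∀ {W : C} (s : W ⟶ Y) (x : Sec R M s), Sec.map R f s x = Sec.map R g s x) : f = g := by
  ext ⟨W⟩ x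
  exact h W.hom x

lemma Sec.map_comp {P : SheafOfModules.{u} (R.over Y)} (f : M ⟶ N) (g : N ⟶ P) {W : C}
    (s : W ⟶ Y) (x : Sec R M s) : Sec.map R (f ≫ g) s x = Sec.map R g s (Sec.map R f s x) := rfl

lemma Sec.map_id {W : C} (s : W ⟶ Y) (x : Sec R M s) : Sec.map R (𝟙 M) s x = x := rfl

/-- Morphisms to a sheaf of modules, defined on sections. -/
@[simps]
def preHomMk {P : PresheafOfModules.{u} (R.over Y).obj}
    (φ : ∀ W : Over Y, P.obj (op W) →+ Sec R N W.hom)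
    (hφ : ∀ (W : Over Y) (a : R.obj.obj (op W.left)) (x : P.obj (op W)),
      φ W ((show (R.over Y).obj.obj (op W) from a) • x) = a • φ W x)
    (hres : ∀ {W W' : Over Y} (t : W' ⟶ W) (x : P.obj (op W)),
      φ W' (P.map t.op x) = Sec.res R N t.left (Over.w t) (φ W x)) : P ⟶ N.val where
  app W := ModuleCat.ofHom
    { toFun := φ W.unop
      map_add' := (φ W.unop).map_add
      map_smul' := hφ W.unop }
  naturality t := by
    ext x
    exact hres t.unop x

/-- Morphisms of sheaves of modules, defined on sections. -/
def Sec.homMk (φ : ∀ {W : C} (s : W ⟶ Y), Sec R M s →+ Sec R N s)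
    (hφ : ∀ {W : C} (s : W ⟶ Y) (a : R.obj.obj (op W)) (x : Sec R M s),
      φ s (a • x) = a • φ s x)
    (hres : ∀ {W W' : C} (t : W' ⟶ W) {s : W ⟶ Y} {s' : W' ⟶ Y} (e : t ≫ s = s')
      (x : Sec R M s), φ s' (Sec.res R M t e x) = Sec.res R N t e (φ s x)) : M ⟶ N where
  val := preHomMk R (P := M.val) (fun W => φ W.hom) (fun W => hφ W.hom)
    (fun t => hres t.left (Over.w t))

/-- The sections of a restriction. -/
def Sec.ofOverMap {Y Z : C} (p : Y ⟶ Z) (F : SheafOfModules.{u} (R.over Z)) {W : C} (s : W ⟶ Y) :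
    Sec R ((SheafOfModules.overMap.{u} R p).obj F) s →+ Sec R F (s ≫ p) :=
  AddMonoidHom.id (Sec R F (s ≫ p))

/-- The sections of a restriction. -/
def Sec.toOverMap {Y Z : C} (p : Y ⟶ Z) (F : SheafOfModules.{u} (R.over Z)) {W : C} (s : W ⟶ Y) :
    Sec R F (s ≫ p) →+ Sec R ((SheafOfModules.overMap.{u} R p).obj F) s :=
  AddMonoidHom.id (Sec R F (s ≫ p))

section

variable {Y Z : C} (p : Y ⟶ Z) {F G : SheafOfModules.{u} (R.over Z)} {W W' : C}

@[simp]
lemma Sec.of_toOverMap (s : W ⟶ Y) (x : Sec R F (s ≫ p)) :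
    Sec.ofOverMap R p F s (Sec.toOverMap R p F s x) = x := rfl

@[simp]
lemma Sec.to_ofOverMap (s : W ⟶ Y) (x : Sec R ((SheafOfModules.overMap.{u} R p).obj F) s) :
    Sec.toOverMap R p F s (Sec.ofOverMap R p F s x) = x := rfl

lemma Sec.ofOverMap_smul (s : W ⟶ Y) (a : R.obj.obj (op W))
    (x : Sec R ((SheafOfModules.overMap.{u} R p).obj F) s) :
    Sec.ofOverMap R p F s (a • x) = a • Sec.ofOverMap R p F s x := by
  rfl

lemma Sec.toOverMap_smul (s : W ⟶ Y) (a : R.obj.obj (op W)) (x : Sec R F (s ≫ p)) :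
    Sec.toOverMap R p F s (a • x) = a • Sec.toOverMap R p F s x :=
  (Sec.ofOverMap_smul R p s a (Sec.toOverMap R p F s x)).symm

lemma Sec.ofOverMap_res (t : W' ⟶ W) {s : W ⟶ Y} {s' : W' ⟶ Y} (e : t ≫ s = s')
    (x : Sec R ((SheafOfModules.overMap.{u} R p).obj F) s) :
    Sec.ofOverMap R p F s' (Sec.res R _ t e x) =
      Sec.res R F t (by rw [← Category.assoc, e]) (Sec.ofOverMap R p F s x) := rfl

lemma Sec.toOverMap_res (t : W' ⟶ W) {s : W ⟶ Y} {s' : W' ⟶ Y} (e : t ≫ s = s')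
    (x : Sec R F (s ≫ p)) :
    Sec.toOverMap R p F s' (Sec.res R _ t (by rw [← Category.assoc, e]) x) =
      Sec.res R _ t e (Sec.toOverMap R p F s x) := rfl

lemma Sec.ofOverMap_map (f : F ⟶ G) (s : W ⟶ Y)
    (x : Sec R ((SheafOfModules.overMap.{u} R p).obj F) s) :
    Sec.ofOverMap R p G s (Sec.map R ((SheafOfModules.overMap.{u} R p).map f) s x) =
      Sec.map R f (s ≫ p) (Sec.ofOverMap R p F s x) := rfl

end

end Sections

/-! ### Extension by zero of families of sheaves of modules -/

section Extension

open scoped Classical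

variable {C : Type u} [SmallCategory C] {J : GrothendieckTopology C} (R : Sheaf J RingCat.{u})
  {ι : Type} {Y : ι → C} {Z : C} (p : ∀ i, Y i ⟶ Z)

/-- The factorizations of `s` through one of the morphisms `p i`. -/
abbrev Factor {W : C} (s : W ⟶ Z) : Type u := Σ i : ι, {t : W ⟶ Y i // t ≫ p i = s}

variable {p} in
/-- Precomposition of factorizations. -/
abbrev Factor.precomp {W W' : C} {s : W ⟶ Z} (t : W' ⟶ W) {s' : W' ⟶ Z} (e : t ≫ s = s')
    (k : Factor p s) : Factor p s' :=
  ⟨k.1, t ≫ k.2.1, by rw [Category.assoc, k.2.2, e]⟩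

variable (x y z : ∀ i, SheafOfModules.{u} (R.over (Y i)))

/-- The sections of the presheaf extension by zero. -/
abbrev extSec {W : C} (s : W ⟶ Z) : Type u := DirectSum (Factor p s) fun k => Sec R (x k.1) k.2.1

/-- A section of a member of the family, as a section of the extension. -/
abbrev extOf {W : C} {s : W ⟶ Z} (k : Factor p s) : Sec R (x k.1) k.2.1 →+ extSec R p x s :=
  DirectSum.of (fun k : Factor p s => Sec R (x k.1) k.2.1) k

/-- The restriction maps of the presheaf extension by zero. -/
def extRes {W W' : C} {s : W ⟶ Z} (t : W' ⟶ W) {s' : W' ⟶ Z} (e : t ≫ s = s') :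
    extSec R p x s →+ extSec R p x s' :=
  DirectSum.toAddMonoid fun k =>
    (extOf R p x (k.precomp t e)).comp (Sec.res R (x k.1) t rfl)

variable {p x} in
lemma extRes_of {W W' : C} {s : W ⟶ Z} (t : W' ⟶ W) {s' : W' ⟶ Z} (e : t ≫ s = s')
    (k : Factor p s) (a : Sec R (x k.1) k.2.1) : extRes R p x t e (extOf R p x k a) =
      extOf R p x (k.precomp t e) (Sec.res R (x k.1) t rfl a) :=
  DirectSum.toAddMonoid_of _ _ _

lemma extOf_smul {W : C} {s : W ⟶ Z} (k : Factor p s) (a : R.obj.obj (op W))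
    (b : Sec R (x k.1) k.2.1) : extOf R p x k (a • b) = a • extOf R p x k b :=
  (DirectSum.lof (R.obj.obj (op W)) _ (fun k : Factor p s => Sec R (x k.1) k.2.1) k).map_smul a b

variable {p x} in
lemma extSec_induction {W : C} {s : W ⟶ Z} {P : extSec R p x s → Prop} (a : extSec R p x s)
    (h₀ : P 0) (h₁ : ∀ k b, P (extOf R p x k b)) (h₂ : ∀ a b, P a → P b → P (a + b)) : P a :=
  DirectSum.induction_on a h₀ h₁ h₂

lemma extRes_smul {W W' : C} {s : W ⟶ Z} (t : W' ⟶ W) {s' : W' ⟶ Z} (e : t ≫ s = s')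
    (a : R.obj.obj (op W)) (b : extSec R p x s) : extRes R p x t e (a • b) =
      (R.obj.map t.op a : R.obj.obj (op W')) • extRes R p x t e b := by
  induction b using extSec_induction with
  | h₀ => simp
  | h₁ k b => rw [← extOf_smul, extRes_of, extRes_of, Sec.res_smul, extOf_smul]
  | h₂ b c hb hc => rw [smul_add, map_add, hb, hc, map_add, smul_add]

/-- Two factorizations that are only propositionally equal index different summands of the direct
sum. This identifies them without a cast, the transport being hidden in the restriction. -/
lemma extOf_congr {W : C} {s : W ⟶ Z} {i : ι} {t t' : W ⟶ Y i} (h : t ≫ p i = s) (e : t = t')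
    {W' : C} {r : W' ⟶ Y i} (q q' : W ⟶ W') (hq : q = q') (eq : q ≫ r = t)
    (b : Sec R (x i) r) :
    extOf R p x (⟨i, t, h⟩ : Factor p s) (Sec.res R (x i) q eq b) =
      extOf R p x (⟨i, t', by rw [← e, h]⟩ : Factor p s)
        (Sec.res R (x i) q' (by rw [← hq, eq]; exact e) b) := by
  subst e hq
  rfl

lemma extRes_id {W : C} {s : W ⟶ Z} (e : 𝟙 W ≫ s = s) (b : extSec R p x s) :
    extRes R p x (𝟙 W) e b = b := by
  induction b using extSec_induction with
  | h₀ => simp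
  | h₁ k b =>
    obtain ⟨i, t, h⟩ := k
    rw [extRes_of]
    refine (extOf_congr R p x _ (Category.id_comp t) _ _ rfl _ b).trans ?_
    rw [Sec.res_id R rfl]
  | h₂ b c hb hc => rw [map_add, hb, hc]

lemma extRes_extRes {W W' W'' : C} {s : W ⟶ Z} (t : W' ⟶ W) {s' : W' ⟶ Z} (e : t ≫ s = s')
    (t' : W'' ⟶ W') {s'' : W'' ⟶ Z} (e' : t' ≫ s' = s'') (b : extSec R p x s) :
    extRes R p x t' e' (extRes R p x t e b) =
      extRes R p x (t' ≫ t) (by rw [Category.assoc, e, e']) b := by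
  induction b using extSec_induction with
  | h₀ => simp
  | h₁ k b =>
    rw [extRes_of, extRes_of, extRes_of, Sec.res_res]
    exact (extOf_congr R p x _ (Category.assoc t' t k.2.1) _ _ rfl _ b).symm
  | h₂ b c hb hc => rw [map_add, map_add, hb, hc, map_add]

/-- The underlying presheaf of abelian groups of the presheaf extension by zero. -/
def extAb : (Over Z)ᵒᵖ ⥤ Ab.{u} where
  obj W := AddCommGrpCat.of (extSec R p x W.unop.hom)
  map t := AddCommGrpCat.ofHom (extRes R p x t.unop.left (Over.w t.unop))
  map_id W := by
    refine AddCommGrpCat.hom_ext (AddMonoidHom.ext fun b => ?_)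
    exact extRes_id R p x _ b
  map_comp t t' := by
    refine AddCommGrpCat.hom_ext (AddMonoidHom.ext fun b => ?_)
    exact (extRes_extRes R p x _ _ _ _ b).symm

instance (W : (Over Z)ᵒᵖ) : Module ((R.over Z).obj.obj W) ((extAb R p x).obj W) :=
  inferInstanceAs (Module (R.obj.obj (op W.unop.left)) (extSec R p x W.unop.hom))

/-- The presheaf extension by zero. -/
def extPre : PresheafOfModules.{u} (R.over Z).obj :=
  PresheafOfModules.ofPresheaf (extAb R p x) fun _ _ t a b =>
    extRes_smul R p x t.unop.left (Over.w t.unop) a b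

variable {x y} in
/-- The functoriality of the extension by zero on sections. -/
def extSecMap (f : ∀ i, x i ⟶ y i) {W : C} (s : W ⟶ Z) :
    extSec R p x s →ₗ[R.obj.obj (op W)] extSec R p y s :=
  DirectSum.lmap fun k => Sec.map R (f k.1) k.2.1

variable {p x y} in
lemma extSecMap_of (f : ∀ i, x i ⟶ y i) {W : C} {s : W ⟶ Z} (k : Factor p s)
    (b : Sec R (x k.1) k.2.1) : extSecMap R p f s (extOf R p x k b) =
      extOf R p y k (Sec.map R (f k.1) k.2.1 b) :=
  DirectSum.lmap_lof _ _ _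

/-- A monomorphism of sheaves is injective on sections, and a direct sum of injections is injective.
This is the source of the exactness of extension by zero. -/
lemma extSecMap_injective (f : ∀ i, x i ⟶ y i) (hf : ∀ i, Mono (f i)) {W : C} (s : W ⟶ Z) :
    Function.Injective (extSecMap R p f s) := by
  refine (DirectSum.map_injective (fun k : Factor p s =>
    (Sec.map R (f k.1) k.2.1).toAddMonoidHom)).2 fun k => ?_
  have : Mono ((SheafOfModules.forget _).map (f k.1)) := inferInstance
  exact PresheafOfModules.injective_of_mono ((SheafOfModules.forget _).map (f k.1))
    (op (Over.mk k.2.1))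

/-- The functor of presheaf extension by zero. -/
def extPreFunctor :
    (∀ i, SheafOfModules.{u} (R.over (Y i))) ⥤ PresheafOfModules.{u} (R.over Z).obj where
  obj x := extPre R p x
  map {x y} f :=
    { app W := ModuleCat.ofHom (extSecMap R p (fun i => f i) W.unop.hom)
      naturality {W W'} t := by
        ext b
        change extSecMap R p (fun i => f i) W'.unop.hom
          (extRes R p x t.unop.left (Over.w t.unop) b) =
          extRes R p y t.unop.left (Over.w t.unop) (extSecMap R p (fun i => f i) W.unop.hom b)
        induction b using extSec_induction with
        | h₀ => simp
        | h₁ k b => rw [extRes_of, extSecMap_of, extSecMap_of, extRes_of, Sec.map_res]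
        | h₂ b c hb hc => rw [map_add, map_add, hb, hc, map_add, map_add] }
  map_id x := by
    ext W b
    change extSecMap R p (fun i => 𝟙 (x i)) W.unop.hom b = b
    induction b using extSec_induction with
    | h₀ => simp
    | h₁ k b => rw [extSecMap_of, Sec.map_id]
    | h₂ b c hb hc => rw [map_add, hb, hc]
  map_comp {x y z} f g := by
    ext W b
    change extSecMap R p (fun i => f i ≫ g i) W.unop.hom b =
      extSecMap R p (fun i => g i) W.unop.hom (extSecMap R p (fun i => f i) W.unop.hom b)
    induction b using extSec_induction with
    | h₀ => simp
    | h₁ k b => rw [extSecMap_of, extSecMap_of, extSecMap_of, Sec.map_comp]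
    | h₂ b c hb hc => rw [map_add, map_add, hb, hc, map_add]

/-- Morphisms from the presheaf extension by zero, on sections. -/
def extDesc (F : SheafOfModules.{u} (R.over Z))
    (g : ∀ i, x i ⟶ (SheafOfModules.overMap.{u} R (p i)).obj F) {W : C} (s : W ⟶ Z) :
    extSec R p x s →+ Sec R F s :=
  DirectSum.toAddMonoid fun k => (Sec.res R F (𝟙 W) ((Category.id_comp _).trans k.2.2)).comp
    ((Sec.ofOverMap R (p k.1) F k.2.1).comp (Sec.map R (g k.1) k.2.1).toAddMonoidHom)

lemma extDesc_of (F : SheafOfModules.{u} (R.over Z))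
    (g : ∀ i, x i ⟶ (SheafOfModules.overMap.{u} R (p i)).obj F) {W : C} (s : W ⟶ Z)
    (k : Factor p s) (b : Sec R (x k.1) k.2.1) : extDesc R p x F g s (extOf R p x k b) =
      Sec.res R F (𝟙 W) ((Category.id_comp _).trans k.2.2)
        (Sec.ofOverMap R (p k.1) F k.2.1 (Sec.map R (g k.1) k.2.1 b)) :=
  DirectSum.toAddMonoid_of _ _ _

lemma extDesc_smul (F : SheafOfModules.{u} (R.over Z))
    (g : ∀ i, x i ⟶ (SheafOfModules.overMap.{u} R (p i)).obj F) {W : C} (s : W ⟶ Z)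
    (a : R.obj.obj (op W)) (b : extSec R p x s) :
    extDesc R p x F g s (a • b) = a • extDesc R p x F g s b := by
  induction b using extSec_induction with
  | h₀ => simp
  | h₁ k b =>
    rw [← extOf_smul, extDesc_of, extDesc_of, map_smul, Sec.ofOverMap_smul, Sec.res_smul]
    congr 1
    exact congrArg (fun f => f.hom a) (R.obj.map_id (op W))
  | h₂ b c hb hc => rw [smul_add, map_add, hb, hc, map_add, smul_add]

lemma extDesc_res (F : SheafOfModules.{u} (R.over Z))
    (g : ∀ i, x i ⟶ (SheafOfModules.overMap.{u} R (p i)).obj F) {W W' : C} {s : W ⟶ Z}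
    (t : W' ⟶ W) {s' : W' ⟶ Z} (e : t ≫ s = s') (b : extSec R p x s) :
    extDesc R p x F g s' (extRes R p x t e b) = Sec.res R F t e (extDesc R p x F g s b) := by
  induction b using extSec_induction with
  | h₀ => simp
  | h₁ k b =>
    rw [extRes_of, extDesc_of, extDesc_of, Sec.res_res, Sec.map_res, Sec.ofOverMap_res,
      Sec.res_res]
    exact Sec.res_congr R (by simp) _ _
  | h₂ b c hb hc => rw [map_add, map_add, hb, hc, map_add, map_add]

variable {p x} in
/-- The action on sections of a morphism from the presheaf extension by zero. -/
def extEval {F : SheafOfModules.{u} (R.over Z)} (f : extPre R p x ⟶ F.val) {W : C} (s : W ⟶ Z) :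
    extSec R p x s →ₗ[R.obj.obj (op W)] Sec R F s :=
  (f.app (op (Over.mk s))).hom

variable {p x} in
lemma extEval_res {F : SheafOfModules.{u} (R.over Z)} (f : extPre R p x ⟶ F.val) {W W' : C}
    {s : W ⟶ Z} (t : W' ⟶ W) {s' : W' ⟶ Z} (e : t ≫ s = s') (b : extSec R p x s) :
    extEval R f s' (extRes R p x t e b) = Sec.res R F t e (extEval R f s b) :=
  PresheafOfModules.naturality_apply f (Over.homMk t e : Over.mk s' ⟶ Over.mk s).op b

variable {p x} in
lemma extPre_hom_ext {F : SheafOfModules.{u} (R.over Z)} {f g : extPre R p x ⟶ F.val}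
    (h : ∀ {W : C} (s : W ⟶ Z) (k : Factor p s) (b : Sec R (x k.1) k.2.1),
      extEval R f s (extOf R p x k b) = extEval R g s (extOf R p x k b)) : f = g := by
  have h' {W : C} (s : W ⟶ Z) (b : extSec R p x s) : extEval R f s b = extEval R g s b := by
    induction b using extSec_induction with
    | h₀ => simp
    | h₁ k b => exact h s k b
    | h₂ b c hb hc => rw [map_add, map_add, hb, hc]
  refine PresheafOfModules.hom_ext fun ⟨W⟩ => ModuleCat.hom_ext (LinearMap.ext fun b => ?_)
  exact h' W.hom b

/-- The morphism from the presheaf extension by zero induced by a family of morphisms. -/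
def extPreDesc (F : SheafOfModules.{u} (R.over Z))
    (g : ∀ i, x i ⟶ (SheafOfModules.overMap.{u} R (p i)).obj F) : extPre R p x ⟶ F.val :=
  preHomMk R (P := extPre R p x) (fun W => extDesc R p x F g W.hom)
    (fun W a b => extDesc_smul R p x F g W.hom a b)
    (fun t b => extDesc_res R p x F g t.left (Over.w t) b)

lemma extEval_extPreDesc (F : SheafOfModules.{u} (R.over Z))
    (g : ∀ i, x i ⟶ (SheafOfModules.overMap.{u} R (p i)).obj F) {W : C} (s : W ⟶ Z)
    (b : extSec R p x s) : extEval R (extPreDesc R p x F g) s b = extDesc R p x F g s b := rfl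

variable {p x} in
/-- The family of morphisms corresponding to a morphism from the presheaf extension by zero. -/
def extPreComponent {F : SheafOfModules.{u} (R.over Z)} (f : extPre R p x ⟶ F.val) (i : ι) :
    x i ⟶ (SheafOfModules.overMap.{u} R (p i)).obj F :=
  Sec.homMk R
    (fun {W} s => (Sec.toOverMap R (p i) F s).comp ((extEval R f (s ≫ p i)).toAddMonoidHom.comp
        (extOf R p x (⟨i, s, rfl⟩ : Factor p (s ≫ p i)))))
    (fun {W} s a b => by
      change Sec.toOverMap R (p i) F s (extEval R f (s ≫ p i)
        (extOf R p x (⟨i, s, rfl⟩ : Factor p (s ≫ p i)) (a • b))) = _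
      rw [extOf_smul, map_smul]
      exact Sec.toOverMap_smul R (p i) s a _)
    (fun {W W'} t {s s'} e b => by
      subst e
      refine Eq.trans (congrArg (extEval R f ((t ≫ s) ≫ p i)) (extRes_of R t
        (Category.assoc _ _ _).symm (⟨i, s, rfl⟩ : Factor p (s ≫ p i)) b).symm) ?_
      exact extEval_res R f t (Category.assoc _ _ _).symm _)

variable {p x} in
lemma map_extPreComponent {F : SheafOfModules.{u} (R.over Z)} (f : extPre R p x ⟶ F.val) (i : ι)
    {W : C} (s : W ⟶ Y i) (b : Sec R (x i) s) : Sec.map R (extPreComponent R f i) s b =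
      Sec.toOverMap R (p i) F s
        (extEval R f (s ≫ p i) (extOf R p x (⟨i, s, rfl⟩ : Factor p (s ≫ p i)) b)) := rfl

/-- The universal property of the presheaf extension by zero. -/
def extPreHomEquiv (F : SheafOfModules.{u} (R.over Z)) :
    (extPre R p x ⟶ F.val) ≃ ∀ i, x i ⟶ (SheafOfModules.overMap.{u} R (p i)).obj F where
  toFun f i := extPreComponent R f i
  invFun g := extPreDesc R p x F g
  left_inv f := by
    -- The identity `t ≫ p i = s` is only propositional, so `extDesc` moves a section over `t ≫ p i`
    -- to `s` by restriction along `𝟙 W`. Naturality of `f` passes this restriction back to the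
    -- extension, where it acts trivially.
    refine extPre_hom_ext R fun {W} s ⟨i, t, h⟩ b => ?_
    rw [extEval_extPreDesc, extDesc_of, map_extPreComponent, Sec.of_toOverMap, ← extEval_res,
      extRes_of]
    · refine congrArg (extEval R f s) ?_
      refine (extOf_congr R p x _ (Category.id_comp t) _ _ rfl _ b).trans ?_
      rw [Sec.res_id R rfl]
  right_inv g := by
    funext i
    refine Sec.hom_ext R fun {W} s b => ?_
    rw [map_extPreComponent, extEval_extPreDesc, extDesc_of, Sec.res_id R rfl, Sec.to_ofOverMap]

end Extension

end LaxDescent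

end

noncomputable section

namespace LaxDescent

/-! ### Extension by zero and exactness of coproducts of sheaves of modules -/

section ExtensionFunctor

variable {C : Type u} [SmallCategory C] {J : GrothendieckTopology C} (R : Sheaf J RingCat.{u})
  {ι : Type} {Y : ι → C} {Z : C} (p : ∀ i, Y i ⟶ Z)

/-- Restriction along a family of morphisms. -/
@[simps]
def piOverMap :
    SheafOfModules.{u} (R.over Z) ⥤ ∀ i, SheafOfModules.{u} (R.over (Y i)) where
  obj F i := (SheafOfModules.overMap.{u} R (p i)).obj F
  map f i := (SheafOfModules.overMap.{u} R (p i)).map f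

/-- The functor of extension by zero. -/
def ext : (∀ i, SheafOfModules.{u} (R.over (Y i))) ⥤ SheafOfModules.{u} (R.over Z) :=
  extPreFunctor R p ⋙ PresheafOfModules.sheafification (𝟙 (R.over Z).obj)

/-- Sheafification is left adjoint to the forgetful functor. -/
def sheafificationForgetAdj :
    PresheafOfModules.sheafification.{u} (𝟙 (R.over Z).obj) ⊣ SheafOfModules.forget (R.over Z) :=
  (PresheafOfModules.sheafificationAdjunction (𝟙 (R.over Z).obj)).ofNatIsoRight (Iso.refl _)

/-- The universal property of extension by zero. -/
def extHomEquiv (x : ∀ i, SheafOfModules.{u} (R.over (Y i))) (F : SheafOfModules.{u} (R.over Z)) :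
    ((ext R p).obj x ⟶ F) ≃ (x ⟶ (piOverMap R p).obj F) :=
  Equiv.trans (β := extPre R p x ⟶ F.val)
    ((sheafificationForgetAdj R).homEquiv (extPre R p x) F) (extPreHomEquiv R p x F)

lemma extPreHomEquiv_symm_comp {x y : ∀ i, SheafOfModules.{u} (R.over (Y i))}
    {F : SheafOfModules.{u} (R.over Z)} (f : x ⟶ y) (g : y ⟶ (piOverMap R p).obj F) :
    (extPreHomEquiv R p x F).symm (f ≫ g) =
      (extPreFunctor R p).map f ≫ (extPreHomEquiv R p y F).symm g := by
  refine extPre_hom_ext R fun {W} s k b => ?_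
  refine (extDesc_of R p x F _ s k b).trans ?_
  refine Eq.trans ?_ (congrArg (extDesc R p y F g s) (extSecMap_of R f k b).symm)
  exact (extDesc_of R p y F g s k _).symm

/-- Extension by zero is left adjoint to restriction. -/
def extAdj : ext R p ⊣ piOverMap R p :=
  Adjunction.mkOfHomEquiv
    { homEquiv := extHomEquiv R p
      homEquiv_naturality_left_symm {x y F} f g :=
        (congrArg ((sheafificationForgetAdj R).homEquiv (extPre R p x) F).symm
          (extPreHomEquiv_symm_comp R p f g)).trans
          ((sheafificationForgetAdj R).homEquiv_naturality_left_symm _ _)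
      homEquiv_naturality_right {x F G} f g :=
        (congrArg (extPreHomEquiv R p x G)
          ((sheafificationForgetAdj R).homEquiv_naturality_right (X := extPre R p x) f g)).trans
          (by
            funext i
            exact Sec.hom_ext R fun {W} s b => rfl) }

instance : (piOverMap R p).IsRightAdjoint := (extAdj R p).isRightAdjoint

/-- The presheaf extension is injective on sections, and sheafification preserves monomorphisms.
Together with right exactness, automatic for a left adjoint, this makes extension by zero exact. -/
lemma mono_ext_map {x y : ∀ i, SheafOfModules.{u} (R.over (Y i))} (f : ∀ i, x i ⟶ y i)
    (hf : ∀ i, Mono (f i)) : Mono ((ext R p).map (f : x ⟶ y)) := by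
  have : Mono ((extPreFunctor R p).map (f : x ⟶ y)) :=
    PresheafOfModules.mono_of_injective fun W => extSecMap_injective R p x y f hf W.unop.hom
  exact inferInstanceAs (Mono ((PresheafOfModules.sheafification (𝟙 (R.over Z).obj)).map
    ((extPreFunctor R p).map (f : x ⟶ y))))

end ExtensionFunctor

/-! ### Exactness of coproducts of sheaves of modules -/

section Coproducts

variable {C : Type u} [SmallCategory C] {J : GrothendieckTopology C} (R : Sheaf J RingCat.{u})

instance (Z : C) : HasCoproducts.{0} (SheafOfModules.{u} (R.over Z)) :=
  hasCoproducts_shrink.{0, u}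

/-- Coproducts of sheaves of modules as extensions by zero. -/
def colimIsoExt (Z : C) (T : Type) :
    (colim : (Discrete T ⥤ SheafOfModules.{u} (R.over Z)) ⥤ _) ≅
      (piEquivalenceFunctorDiscrete T (SheafOfModules.{u} (R.over Z))).inverse ⋙
        ext R (Y := fun _ : T => Z) fun _ => 𝟙 Z :=
  Adjunction.leftAdjointUniq colimConstAdj
    (((piEquivalenceFunctorDiscrete T (SheafOfModules.{u} (R.over Z))).symm.toAdjunction.comp
      (extAdj R (Y := fun _ : T => Z) fun _ => 𝟙 Z)).ofNatIsoRight
        (NatIso.ofComponents (fun F => Discrete.natIso fun _ => (overMapIdIso R rfl).app F)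
          (fun {F G} f => by
            refine NatTrans.ext (funext fun _ => ?_)
            exact ((overMapIdIso R rfl).hom.naturality f))))

instance (Z : C) : AB4OfSize.{0} (SheafOfModules.{u} (R.over Z)) where
  ofShape T := by
    have : (colim : (Discrete T ⥤ SheafOfModules.{u} (R.over Z)) ⥤
        SheafOfModules.{u} (R.over Z)).PreservesMonomorphisms :=
      ⟨fun {F G} f _ => by
        -- A coproduct over `T` is the extension by zero along the constant family of identities of
        -- `Z`, so AB4 is a case of `mono_ext_map`.
        have : Mono ((ext R (Y := fun _ : T => Z) fun _ => 𝟙 Z).map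
            ((piEquivalenceFunctorDiscrete T (SheafOfModules.{u} (R.over Z))).inverse.map f)) :=
          mono_ext_map R _ (fun i => f.app ⟨i⟩) fun i => inferInstance
        exact ((MorphismProperty.monomorphisms _).arrow_mk_iso_iff
          (((Functor.mapArrowFunctor _ _).mapIso (colimIsoExt R Z T)).app (Arrow.mk f))).2 this⟩
    exact hasExactColimitsOfShape_of_preservesMono (C := SheafOfModules.{u} (R.over Z)) _

variable [HasPullbacks C] (X : SimplicialObject C)

instance (n : SimplexCategory) : HasCoproducts.{0} ((modDiagram R X).obj n) :=
  inferInstanceAs (HasCoproducts.{0} (SheafOfModules.{u} (R.over (X.obj (op n)))))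

instance (n : SimplexCategory) : AB4OfSize.{0} ((modDiagram R X).obj n) :=
  inferInstanceAs (AB4OfSize.{0} (SheafOfModules.{u} (R.over (X.obj (op n)))))

instance {n m : SimplexCategory} (θ : n ⟶ m) (T : Type) :
    PreservesColimitsOfShape (Discrete T) ((modDiagram R X).map θ) :=
  inferInstanceAs (PreservesColimitsOfShape (Discrete T)
    (SheafOfModules.overMap.{u} R (X.map θ.op)))

instance {n m : SimplexCategory} (θ : n ⟶ m) :
    PreservesFiniteLimits ((modDiagram R X).map θ) :=
  inferInstanceAs (PreservesFiniteLimits (SheafOfModules.overMap.{u} R (X.map θ.op)))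

end Coproducts

end LaxDescent

end

noncomputable section

namespace LaxDescent

/-! ### The left adjoint of the restriction to a simplicial object -/

section LeftAdjoint

variable {C : Type u} [SmallCategory C] [HasPullbacks C] {J : GrothendieckTopology C}
  (R : Sheaf J RingCat.{u}) (X : SimplicialObject C) {U : C}
  (p : X ⟶ (SimplicialObject.const C).obj U)

/-- The family of morphisms underlying an augmentation. -/
abbrev augFamily (n : SimplexCategory) : X.obj (op n) ⟶ U := p.app (op n)

/-- The comparison between restriction and restriction along a family. -/
def restrCompEvPi : restr R X p ⋙ evPi (modDiagram R X) ≅ piOverMap R (augFamily X p) :=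
  Iso.refl _

/-- Adjoint triangle theorem: forgetting structure maps after restricting gives restriction along a
family, whose left adjoint is extension by zero; and the counit of the free-forgetful adjunction is
a regular epimorphism. The left adjoint so obtained is a coequalizer of extensions by zero. -/
instance : (restr R X p).IsRightAdjoint := by
  have : (restr R X p ⋙ evPi (modDiagram R X)).IsRightAdjoint :=
    inferInstanceAs (piOverMap R (augFamily X p)).IsRightAdjoint
  exact isRightAdjoint_triangle_lift (restr R X p) (freeAdj (modDiagram R X)) fun E =>
    (regularEpiOfEpi ((freeAdj (modDiagram R X)).counit.app E))

/-- The left adjoint of the restriction functor. -/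
def lan : LaxLimit (modDiagram R X) ⥤ SheafOfModules.{u} (R.over U) :=
  (restr R X p).leftAdjoint

/-- The adjunction between `lan` and the restriction functor. -/
def lanAdj : lan R X p ⊣ restr R X p := Adjunction.ofIsRightAdjoint _

instance : (lan R X p).Additive := (lanAdj R X p).left_adjoint_additive

/-- `lan` on free objects is extension by zero. -/
def freeLanIso : free (modDiagram R X) ⋙ lan R X p ≅ ext R (augFamily X p) :=
  Adjunction.leftAdjointUniq ((freeAdj (modDiagram R X)).comp (lanAdj R X p))
    ((extAdj R (augFamily X p)).ofNatIsoRight (restrCompEvPi R X p).symm)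

instance : (freeG (modDiagram R X) ⋙ lan R X p).PreservesMonomorphisms where
  preserves {E E'} f _ := by
    have : Mono ((ext R (augFamily X p)).map ((evPi (modDiagram R X)).map f)) :=
      mono_ext_map R _ (fun n => f.app n) fun n =>
        inferInstanceAs (Mono ((LaxLimit.ev (modDiagram R X) n).map f))
    exact ((MorphismProperty.monomorphisms _).arrow_mk_iso_iff
      (((Functor.mapArrowFunctor _ _).mapIso (freeLanIso R X p)).app
        (Arrow.mk ((evPi (modDiagram R X)).map f)))).2 this

/-- On free objects `lan` is extension by zero, which preserves monomorphisms; cokernels are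
preserved because `free` and `lan` are left adjoints. `lan` alone need not be exact. -/
instance : (freeG (modDiagram R X) ⋙ lan R X p).PreservesHomology := by
  have : PreservesColimitsOfShape WalkingParallelPair (evPi (modDiagram R X)) := inferInstance
  have : PreservesColimitsOfSize.{0, 0} (free (modDiagram R X)) :=
    (freeAdj _).leftAdjoint_preservesColimits
  have : PreservesColimitsOfSize.{0, 0} (lan R X p) :=
    (lanAdj R X p).leftAdjoint_preservesColimits
  exact Functor.preservesHomology_of_preservesMonos_and_cokernels _

/-- `lan` preserves quasi-isomorphisms between complexes of relatively projective objects. -/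
lemma quasiIso_lan_map {Y Y' : ChainComplex (LaxLimit (modDiagram R X)) ℕ} (f : Y ⟶ Y')
    [QuasiIso f] (hY : ∀ n, RelProj (freeε (modDiagram R X)) (Y.X n))
    (hY' : ∀ n, RelProj (freeε (modDiagram R X)) (Y'.X n)) :
    QuasiIso (((lan R X p).mapHomologicalComplex _).map f) :=
  quasiIso_map_of_relProj (freeε (modDiagram R X)) (lan R X p) (fun _ => inferInstance)
    (fun _ => relProj_free _) f hY hY'

end LeftAdjoint

end LaxDescent

end

noncomputable section

namespace LaxDescent

/-! ### Derived adjunctions between localizations -/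

section Localization

variable {𝓒 𝓓 𝓔 : Type*} [Category* 𝓒] [Category* 𝓓] [Category* 𝓔]
  {W : MorphismProperty 𝓒} {W' : MorphismProperty 𝓓}

/-- The functor between localizations induced by a functor. -/
abbrev locMap (G : 𝓒 ⥤ 𝓓) (hG : ∀ ⦃X Y : 𝓒⦄ (f : X ⟶ Y), W f → W' (G.map f)) :
    W.Localization ⥤ W'.Localization :=
  Localization.Construction.lift (G ⋙ W'.Q) (fun _ _ f hf => W'.Q_inverts _ (hG f hf))

lemma lift_map_Q_map (G : 𝓒 ⥤ 𝓓) (hG : W.IsInvertedBy G) {X Y : 𝓒} (f : X ⟶ Y) :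
    (Localization.Construction.lift G hG).map (W.Q.map f) = G.map f :=
  (Functor.congr_hom (Localization.Construction.fac G hG) f).trans
    ((Category.id_comp _).trans (Category.comp_id _))

lemma locMap_map (G : 𝓒 ⥤ 𝓓) (hG : ∀ ⦃X Y : 𝓒⦄ (f : X ⟶ Y), W f → W' (G.map f)) {X Y : 𝓒}
    (f : X ⟶ Y) : (locMap G hG).map (W.Q.map f) = W'.Q.map (G.map f) :=
  lift_map_Q_map (G ⋙ W'.Q) _ f

/-- A natural transformation between functors from a localization. -/
def locNatTrans {F G : W.Localization ⥤ 𝓔} (app : ∀ X : 𝓒, F.obj (W.Q.obj X) ⟶ G.obj (W.Q.obj X))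
    (nat : ∀ {X Y : 𝓒} (f : X ⟶ Y), F.map (W.Q.map f) ≫ app Y = app X ≫ G.map (W.Q.map f)) :
    F ⟶ G :=
  Localization.Construction.natTransExtension { app := app, naturality := fun _ _ f => nat f }

lemma locNatTrans_app {F G : W.Localization ⥤ 𝓔}
    (app : ∀ X : 𝓒, F.obj (W.Q.obj X) ⟶ G.obj (W.Q.obj X))
    (nat : ∀ {X Y : 𝓒} (f : X ⟶ Y), F.map (W.Q.map f) ≫ app Y = app X ≫ G.map (W.Q.map f))
    (X : 𝓒) : (locNatTrans app nat).app (W.Q.obj X) = app X :=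
  Localization.Construction.NatTransExtension.app_eq _ X

/-- Naturality tested on morphisms of `𝓒` extends to all morphisms of the localization, including
formal inverses. `full_locMap_of_contraction` relies on this for an arbitrary morphism `f`. -/
lemma locNatTrans_naturality {F G : W.Localization ⥤ 𝓔}
    (app : ∀ X : 𝓒, F.obj (W.Q.obj X) ⟶ G.obj (W.Q.obj X))
    (nat : ∀ {X Y : 𝓒} (f : X ⟶ Y), F.map (W.Q.map f) ≫ app Y = app X ≫ G.map (W.Q.map f))
    {X Y : 𝓒} (f : W.Q.obj X ⟶ W.Q.obj Y) : F.map f ≫ app Y = app X ≫ G.map f := by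
  rw [← locNatTrans_app app nat, ← locNatTrans_app app nat]
  exact (locNatTrans app nat).naturality f

lemma loc_forall {P : W.Localization → Prop} (h : ∀ X : 𝓒, P (W.Q.obj X)) (X) : P X := by
  obtain ⟨⟨X⟩⟩ := X
  exact h X

section

variable {G G' : 𝓒 ⥤ 𝓓} (hG : ∀ ⦃X Y : 𝓒⦄ (f : X ⟶ Y), W f → W' (G.map f))
  (hG' : ∀ ⦃X Y : 𝓒⦄ (f : X ⟶ Y), W f → W' (G'.map f)) (τ : G ⟶ G')

lemma locMap_map_comp_Q_map {X Y : 𝓒} (f : X ⟶ Y) :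
    (locMap G hG).map (W.Q.map f) ≫ W'.Q.map (τ.app Y) =
      W'.Q.map (τ.app X) ≫ (locMap G' hG').map (W.Q.map f) := by
  rw [locMap_map, locMap_map]
  exact (W'.Q.map_comp _ _).symm.trans ((congrArg W'.Q.map (τ.naturality f)).trans
    (W'.Q.map_comp _ _))

/-- The natural transformation between functors on localizations induced by a natural
transformation. -/
def locMapNatTrans : locMap G hG ⟶ locMap G' hG' :=
  locNatTrans (fun X => W'.Q.map (τ.app X)) (locMap_map_comp_Q_map hG hG' τ)

lemma locMapNatTrans_app (X : 𝓒) :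
    (locMapNatTrans hG hG' τ).app (W.Q.obj X) = W'.Q.map (τ.app X) :=
  locNatTrans_app (F := locMap G hG) (G := locMap G' hG') (fun X => W'.Q.map (τ.app X))
    (locMap_map_comp_Q_map hG hG' τ) X

end

end Localization

/-! ### The derived adjunction of an adjunction with functorial left resolutions -/

section DerivedAdjunction

variable {𝓒 𝓓 : Type*} [Category* 𝓒] [Category* 𝓓]
  {W : MorphismProperty 𝓒} {W' : MorphismProperty 𝓓}
  {l : 𝓒 ⥤ 𝓓} {r : 𝓓 ⥤ 𝓒} (adj : l ⊣ r)
  (hr : ∀ ⦃X Y : 𝓓⦄ (f : X ⟶ Y), W' f → W (r.map f))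
  {B : 𝓒 ⥤ 𝓒} (π : B ⟶ 𝟭 𝓒) (hπ : ∀ X, W (π.app X))
  (hB : ∀ ⦃X Y : 𝓒⦄ (f : X ⟶ Y), W f → W' (l.map (B.map f)))
  (hl : ∀ X, W' (l.map (π.app (B.obj X))))

/-- The left derived functor. -/
abbrev derivedLeft : W.Localization ⥤ W'.Localization := locMap (B ⋙ l) hB

/-- The unit of the derived adjunction on objects. -/
def derivedUnitApp (X : 𝓒) : W.Q.obj X ⟶ W.Q.obj (r.obj (l.obj (B.obj X))) :=
  Localization.Construction.wInv (π.app X) (hπ X) ≫ W.Q.map (adj.unit.app (B.obj X))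

lemma Q_map_π_derivedUnitApp (X : 𝓒) :
    W.Q.map (π.app X) ≫ derivedUnitApp adj π hπ X = W.Q.map (adj.unit.app (B.obj X)) :=
  (Localization.Construction.wIso (π.app X) (hπ X)).hom_inv_id_assoc _

include hπ hB hl in
-- Naturality of `π` gives `B(π) ≫ π = π_B ≫ π`, so `B(π)` and `π_B` agree after localization and
-- hence under the derived functor `l B`. Naturality of `π` once more, together with the
-- invertibility of `l(π)` on objects `B(B X)`, removes the extra `B`.
lemma Q_map_resolution_eq (X : 𝓒) :
    W'.Q.map (l.map (B.map (π.app X))) = W'.Q.map (l.map (π.app (B.obj X))) := by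
  have h₁ : (derivedLeft hB).map (W.Q.map (B.map (π.app X))) =
      (derivedLeft hB).map (W.Q.map (π.app (B.obj X))) := by
    congr 1
    have := W.Q_inverts _ (hπ X)
    rw [← cancel_mono (W.Q.map (π.app X)), ← W.Q.map_comp, ← W.Q.map_comp]
    exact congrArg W.Q.map (π.naturality (π.app X))
  rw [locMap_map, locMap_map] at h₁
  have := W'.Q_inverts _ (hl (B.obj X))
  rw [← cancel_epi (W'.Q.map (l.map (π.app (B.obj (B.obj X)))))]
  have e (f : B.obj (B.obj X) ⟶ B.obj X) :
      W'.Q.map (l.map (π.app (B.obj (B.obj X)))) ≫ W'.Q.map (l.map f) =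
        W'.Q.map (l.map (B.map f)) ≫ W'.Q.map (l.map (π.app (B.obj X))) := by
    rw [← W'.Q.map_comp, ← W'.Q.map_comp, ← l.map_comp, ← l.map_comp, π.naturality]
    rfl
  rw [e, e]
  exact congrArg (· ≫ _) h₁

lemma derivedLeft_map {X Y : 𝓒} (f : X ⟶ Y) :
    (derivedLeft hB).map (W.Q.map f) = W'.Q.map (l.map (B.map f)) :=
  locMap_map (B ⋙ l) hB f

lemma derivedUnitApp_naturality {X Y : 𝓒} (f : X ⟶ Y) :
    W.Q.map f ≫ derivedUnitApp adj π hπ Y =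
      derivedUnitApp adj π hπ X ≫ W.Q.map (r.map (l.map (B.map f))) := by
  have := W.Q_inverts _ (hπ X)
  refine (cancel_epi (W.Q.map (π.app X))).1 ?_
  have e₁ : W.Q.map (π.app X) ≫ W.Q.map f = W.Q.map (B.map f) ≫ W.Q.map (π.app Y) := by
    rw [← W.Q.map_comp, ← W.Q.map_comp, π.naturality]
    rfl
  refine (Category.assoc _ _ _).symm.trans ((congrArg (· ≫ _) e₁).trans ?_)
  rw [Category.assoc, Q_map_π_derivedUnitApp]
  refine Eq.trans ?_ (Category.assoc _ _ _)
  refine Eq.trans ?_ (congrArg (· ≫ _) (Q_map_π_derivedUnitApp adj π hπ X).symm)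
  rw [← W.Q.map_comp, ← W.Q.map_comp]
  exact congrArg W.Q.map (adj.unit.naturality _)

lemma derivedUnitApp_Q_naturality {X Y : 𝓒} (f : X ⟶ Y) :
    W.Q.map f ≫ derivedUnitApp adj π hπ Y =
      derivedUnitApp adj π hπ X ≫ (derivedLeft hB ⋙ locMap r hr).map (W.Q.map f) :=
  (derivedUnitApp_naturality adj π hπ f).trans (congrArg (_ ≫ ·)
    ((congrArg (locMap r hr).map (derivedLeft_map hB f)).trans (locMap_map r hr _)).symm)

/-- The unit of the derived adjunction. -/
def derivedUnit : 𝟭 W.Localization ⟶ derivedLeft hB ⋙ locMap r hr :=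
  locNatTrans (G := derivedLeft hB ⋙ locMap r hr) (derivedUnitApp adj π hπ)
    (derivedUnitApp_Q_naturality adj hr π hπ hB)

lemma derivedUnit_app (X : 𝓒) :
    (derivedUnit adj hr π hπ hB).app (W.Q.obj X) = derivedUnitApp adj π hπ X :=
  locNatTrans_app (F := 𝟭 W.Localization) (G := derivedLeft hB ⋙ locMap r hr)
    (derivedUnitApp adj π hπ)
    (derivedUnitApp_Q_naturality adj hr π hπ hB) X

/-- The counit of the derived adjunction on objects. -/
def derivedCounitApp (F : 𝓓) : l.obj (B.obj (r.obj F)) ⟶ F :=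
  l.map (π.app (r.obj F)) ≫ adj.counit.app F

lemma derivedCounitApp_naturality {F G : 𝓓} (f : F ⟶ G) :
    l.map (B.map (r.map f)) ≫ derivedCounitApp adj π G = derivedCounitApp adj π F ≫ f := by
  have h := adj.counit.naturality f
  dsimp [derivedCounitApp] at h ⊢
  rw [← Category.assoc, ← l.map_comp, π.naturality]
  dsimp
  rw [l.map_comp, Category.assoc, Category.assoc, h]

lemma derivedCounitApp_Q_naturality {F G : 𝓓} (f : F ⟶ G) :
    (locMap r hr ⋙ derivedLeft hB).map (W'.Q.map f) ≫ W'.Q.map (derivedCounitApp adj π G) =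
      W'.Q.map (derivedCounitApp adj π F) ≫ W'.Q.map f := by
  have e₂ : (locMap r hr ⋙ derivedLeft hB).map (W'.Q.map f) =
      W'.Q.map (l.map (B.map (r.map f))) :=
    (congrArg (derivedLeft hB).map (locMap_map r hr f)).trans (derivedLeft_map hB _)
  refine (congrArg (· ≫ _) e₂).trans ?_
  exact (W'.Q.map_comp _ _).symm.trans ((congrArg W'.Q.map
    (derivedCounitApp_naturality adj π f)).trans (W'.Q.map_comp _ _))

/-- The counit of the derived adjunction. -/
def derivedCounit : locMap r hr ⋙ derivedLeft hB ⟶ 𝟭 W'.Localization :=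
  locNatTrans (F := locMap r hr ⋙ derivedLeft hB) (fun F => W'.Q.map (derivedCounitApp adj π F))
    (derivedCounitApp_Q_naturality adj hr π hB)

lemma derivedCounit_app (F : 𝓓) :
    (derivedCounit adj hr π hB).app (W'.Q.obj F) = W'.Q.map (derivedCounitApp adj π F) :=
  locNatTrans_app (F := locMap r hr ⋙ derivedLeft hB) (G := 𝟭 W'.Localization)
    (fun F => W'.Q.map (derivedCounitApp adj π F)) (derivedCounitApp_Q_naturality adj hr π hB) F

lemma map_unit_derivedCounitApp (X : 𝓒) :
    l.map (B.map (adj.unit.app (B.obj X))) ≫ derivedCounitApp adj π (l.obj (B.obj X)) =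
      l.map (π.app (B.obj X)) := by
  have h := π.naturality (adj.unit.app (B.obj X))
  dsimp [derivedCounitApp] at h ⊢
  rw [← Category.assoc, ← l.map_comp, h, l.map_comp, Category.assoc,
    adj.left_triangle_components, Category.comp_id]

lemma unit_map_derivedCounitApp (F : 𝓓) :
    adj.unit.app (B.obj (r.obj F)) ≫ r.map (derivedCounitApp adj π F) = π.app (r.obj F) := by
  have h := adj.unit.naturality (π.app (r.obj F))
  dsimp [derivedCounitApp] at h ⊢
  rw [r.map_comp, ← Category.assoc, ← h, Category.assoc, adj.right_triangle_components]
  exact Category.comp_id _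

include hl in
/-- The derived adjunction. -/
def derivedAdj : derivedLeft hB ⊣ locMap r hr where
  unit := derivedUnit adj hr π hπ hB
  counit := derivedCounit adj hr π hB
  left_triangle_components := loc_forall fun X => by
    rw [derivedUnit_app]
    refine (congrArg (_ ≫ ·) (derivedCounit_app adj hr π hB (l.obj (B.obj X)))).trans ?_
    have := W.Q_inverts _ (hπ X)
    have : IsIso ((derivedLeft hB).map (W.Q.map (π.app X))) := inferInstance
    -- Composing with the derived image of `π` replaces the derived unit by the honest unit at `B
    -- X`. What remains is the identity of `l(π_B)` and `l(B π)` in the localization.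
    refine (cancel_epi ((derivedLeft hB).map (W.Q.map (π.app X)))).1 ?_
    refine (Category.assoc _ _ _).symm.trans ?_
    refine (congrArg (· ≫ _) (((derivedLeft hB).map_comp _ _).symm.trans
      ((congrArg (derivedLeft hB).map (Q_map_π_derivedUnitApp adj π hπ X)).trans
        (derivedLeft_map hB _)))).trans ?_
    refine (W'.Q.map_comp _ _).symm.trans (Eq.trans ?_ (Category.comp_id _).symm)
    rw [derivedLeft_map]
    refine Eq.trans ?_ (Q_map_resolution_eq π hπ hB hl X).symm
    exact congrArg W'.Q.map (map_unit_derivedCounitApp adj π X)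
  right_triangle_components := loc_forall fun F => by
    refine (congrArg (· ≫ _) (derivedUnit_app adj hr π hπ hB (r.obj F))).trans ?_
    refine (congrArg (_ ≫ ·) ((congrArg (locMap r hr).map
      (derivedCounit_app adj hr π hB F)).trans (locMap_map r hr _))).trans ?_
    have := W.Q_inverts _ (hπ (r.obj F))
    refine (cancel_epi (W.Q.map (π.app (r.obj F)))).1 ?_
    refine (Category.assoc _ _ _).symm.trans ?_
    refine (congrArg (· ≫ _) (Q_map_π_derivedUnitApp adj π hπ (r.obj F))).trans ?_
    refine (W.Q.map_comp _ _).symm.trans (Eq.trans ?_ (Category.comp_id _).symm)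
    exact congrArg W.Q.map (unit_map_derivedCounitApp adj π F)

lemma derivedAdj_unit_app (X : 𝓒) :
    (derivedAdj adj hr π hπ hB hl).unit.app (W.Q.obj X) = derivedUnitApp adj π hπ X :=
  derivedUnit_app adj hr π hπ hB X

end DerivedAdjunction

/-! ### Full faithfulness on localizations from a contraction -/

section Contraction

variable {𝓒 𝓓 : Type*} [Category* 𝓒] [Category* 𝓓]
  {W : MorphismProperty 𝓒} {W' : MorphismProperty 𝓓} {r : 𝓓 ⥤ 𝓒}
  (hr : ∀ ⦃X Y : 𝓓⦄ (f : X ⟶ Y), W' f → W (r.map f))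
  {S : 𝓒 ⥤ 𝓓} (hS : ∀ ⦃X Y : 𝓒⦄ (f : X ⟶ Y), W f → W' (S.map f))
  {T : 𝓒 ⥤ 𝓒} (hT : ∀ ⦃X Y : 𝓒⦄ (f : X ⟶ Y), W f → W (T.map f))
  (α : 𝟭 𝓒 ⟶ T) (β : S ⋙ r ⟶ T) (i : r ⋙ S ≅ 𝟭 𝓓)

include hS i in
lemma faithful_locMap_of_retraction : (locMap r hr).Faithful := by
  have e : locMap r hr ⋙ locMap S hS ≅ 𝟭 _ :=
    { hom := locNatTrans (F := locMap r hr ⋙ locMap S hS) (fun F => W'.Q.map (i.hom.app F))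
        (fun {F G} f => (congrArg (· ≫ _) ((congrArg (locMap S hS).map (locMap_map r hr f)).trans
          (locMap_map S hS _))).trans ((W'.Q.map_comp _ _).symm.trans
            ((congrArg W'.Q.map (i.hom.naturality f)).trans (W'.Q.map_comp _ _))))
      inv := locNatTrans (G := locMap r hr ⋙ locMap S hS) (fun F => W'.Q.map (i.inv.app F))
        (fun {F G} f => Eq.trans ((W'.Q.map_comp _ _).symm.trans
            ((congrArg W'.Q.map (i.inv.naturality f)).trans (W'.Q.map_comp _ _)))
            (congrArg (_ ≫ ·) ((congrArg (locMap S hS).map (locMap_map r hr f)).trans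
          (locMap_map S hS _))).symm)
      hom_inv_id := NatTrans.ext (funext (loc_forall fun F =>
        (congrArg₂ (· ≫ ·) (locNatTrans_app _ _ F) (locNatTrans_app _ _ F)).trans
          ((W'.Q.map_comp _ _).symm.trans ((congrArg W'.Q.map (i.hom_inv_id_app F)).trans
            (W'.Q.map_id _)))))
      inv_hom_id := NatTrans.ext (funext (loc_forall fun F =>
        (congrArg₂ (· ≫ ·) (locNatTrans_app _ _ F) (locNatTrans_app _ _ F)).trans
          ((W'.Q.map_comp _ _).symm.trans ((congrArg W'.Q.map (i.inv_hom_id_app F)).trans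
            (W'.Q.map_id _))))) }
  have : (locMap r hr ⋙ locMap S hS).Faithful := Functor.Faithful.of_iso e.symm
  exact Functor.Faithful.of_comp _ (locMap S hS)

include hS hT in
-- An abstract extra degeneracy: `T` receives maps from the identity and from `r` after the
-- retraction `S`, and on the image of `r` these agree up to `i`. Moving a morphism into `T` along
-- either map shows that it comes from its image under `S`.
lemma full_locMap_of_contraction (hα : ∀ F, W (α.app (r.obj F)))
    (hi : ∀ F, r.map (i.hom.app F) ≫ α.app (r.obj F) = β.app (r.obj F)) :
    (locMap r hr).Full where
  map_surjective {F G} f := by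
    obtain ⟨⟨F⟩⟩ := F
    obtain ⟨⟨G⟩⟩ := G
    change W.Q.obj (r.obj F) ⟶ W.Q.obj (r.obj G) at f
    have hα' (F : 𝓓) := W.Q_inverts _ (hα F)
    have hi' (F : 𝓓) : W.Q.map (r.map (i.hom.app F)) ≫ W.Q.map (α.app (r.obj F)) =
        W.Q.map (β.app (r.obj F)) := by
      rw [← W.Q.map_comp, hi]
    have nα := locNatTrans_naturality (F := 𝟭 W.Localization) (G := locMap T hT)
      (fun X => W.Q.map (α.app X)) (fun {X Y} f => by
        rw [locMap_map]
        exact (W.Q.map_comp _ _).symm.trans ((congrArg W.Q.map (α.naturality f)).trans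
          (W.Q.map_comp _ _))) f
    have nβ := locNatTrans_naturality (F := locMap S hS ⋙ locMap r hr) (G := locMap T hT)
      (fun X => W.Q.map (β.app X)) (fun {X Y} f => by
        rw [locMap_map]
        refine (congrArg (· ≫ _) ((congrArg (locMap r hr).map (locMap_map S hS f)).trans
          (locMap_map r hr _))).trans ?_
        exact (W.Q.map_comp _ _).symm.trans ((congrArg W.Q.map (β.naturality f)).trans
          (W.Q.map_comp _ _))) f
    -- The preimage is `S f` conjugated by `i`. After composing with the invertible `α` at `r G`,
    -- naturality of `β` on one side and of `α` on the other reduces both to `α ≫ T f`.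
    refine ⟨W'.Q.map (i.inv.app F) ≫ (locMap S hS).map f ≫ W'.Q.map (i.hom.app G), ?_⟩
    refine (cancel_mono (W.Q.map (α.app (r.obj G)))).1 ?_
    have e : (locMap r hr).map
        (W'.Q.map (i.inv.app F) ≫ (locMap S hS).map f ≫ W'.Q.map (i.hom.app G)) =
        W.Q.map (r.map (i.inv.app F)) ≫ (locMap r hr).map ((locMap S hS).map f) ≫
          W.Q.map (r.map (i.hom.app G)) :=
      ((locMap r hr).map_comp _ _).trans (congrArg₂ (· ≫ ·) (locMap_map r hr _)
        (((locMap r hr).map_comp _ _).trans (congrArg (_ ≫ ·) (locMap_map r hr _))))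
    refine (congrArg (· ≫ _) e).trans ?_
    refine Eq.trans ?_ nα.symm
    refine (Category.assoc _ _ _).trans ?_
    refine (congrArg (_ ≫ ·) ((Category.assoc _ _ _).trans
      ((congrArg (_ ≫ ·) (hi' G)).trans nβ))).trans ?_
    refine (congrArg (fun t => _ ≫ t ≫ _) (hi' F).symm).trans ?_
    refine (congrArg (_ ≫ ·) (Category.assoc _ _ _)).trans ?_
    refine (Category.assoc _ _ _).symm.trans ?_
    refine (congrArg (· ≫ _) ((W.Q.map_comp _ _).symm.trans (congrArg W.Q.map
      ((r.map_comp _ _).symm.trans ((congrArg r.map (i.inv_hom_id_app F)).trans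
        (r.map_id _)))))).trans ?_
    exact (congrArg (· ≫ _) (W.Q.map_id _)).trans (Category.id_comp _)

end Contraction

end LaxDescent

end

noncomputable section

namespace LaxDescent

/-! ### Lax sections of sheaves of modules over a simplicial object, in terms of sections -/

section SectionFormulas

variable {C : Type u} [SmallCategory C] {J : GrothendieckTopology C} (R : Sheaf J RingCat.{u})

lemma Sec.map_overMapIdIso_hom {Y : C} {f : Y ⟶ Y} (h : f = 𝟙 Y)
    (M : SheafOfModules.{u} (R.over Y)) {W : C} (s : W ⟶ Y)
    (a : Sec R ((SheafOfModules.overMap.{u} R f).obj M) s) :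
    Sec.map R ((overMapIdIso R h).hom.app M) s a =
      Sec.res R M (𝟙 W) (by simp [h]) (Sec.ofOverMap R f M s a) :=
  idSec_eq R h M (Over.mk s) a

lemma Sec.map_overMapCompIso_hom {Y Y' Y'' : C} {f : Y ⟶ Y'} {g : Y' ⟶ Y''} {h : Y ⟶ Y''}
    (e : h = f ≫ g) (M : SheafOfModules.{u} (R.over Y'')) {W : C} (s : W ⟶ Y)
    (a : Sec R ((SheafOfModules.overMap.{u} R h).obj M) s) :
    Sec.map R ((overMapCompIso R e).hom.app M) s a =
      Sec.toOverMap R f _ s (Sec.toOverMap R g M (s ≫ f)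
        (Sec.res R M (𝟙 W) (by simp [e]) (Sec.ofOverMap R h M s a))) :=
  compSec_eq R e M (Over.mk s) a

lemma Sec.map_overMapCompIso_inv {Y Y' Y'' : C} {f : Y ⟶ Y'} {g : Y' ⟶ Y''} {h : Y ⟶ Y''}
    (e : h = f ≫ g) (M : SheafOfModules.{u} (R.over Y'')) {W : C} (s : W ⟶ Y)
    (a : Sec R ((SheafOfModules.overMap.{u} R f).obj ((SheafOfModules.overMap.{u} R g).obj M)) s) :
    Sec.map R ((overMapCompIso R e).inv.app M) s a =
      Sec.toOverMap R h M s (Sec.res R M (𝟙 W) (by simp [e])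
        (Sec.ofOverMap R g M (s ≫ f) (Sec.ofOverMap R f _ s a))) :=
  compInvSec_eq R e M (Over.mk s) a

end SectionFormulas

/-! ### Lax sections as families of transport maps on sections -/

section Transport

variable {C : Type u} [SmallCategory C] {J : GrothendieckTopology C} {R : Sheaf J RingCat.{u}}
  {X Y : SimplicialObject C} {k l m n : SimplexCategory} {W W' W'' : C}

namespace LaxLimit

variable (E E' E'' : LaxLimit (modDiagram R X))

/-- The components of a lax section. -/
def sheaf (n : SimplexCategory) : SheafOfModules.{u} (R.over (X.obj (op n))) := E.x n

/-- The structure maps of a lax section. -/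
def str (θ : n ⟶ m) :
    (SheafOfModules.overMap.{u} R (X.map θ.op)).obj (E.sheaf n) ⟶ E.sheaf m := E.u θ

variable {E E' E''} in
/-- The components of a morphism of lax sections. -/
def sheafHom (f : E ⟶ E') (n : SimplexCategory) : E.sheaf n ⟶ E'.sheaf n := f.app n

/-- The action of the structure maps of a lax section on sections. -/
def tr (θ : n ⟶ m) (t : W' ⟶ W) {s : W ⟶ X.obj (op n)} {s' : W' ⟶ X.obj (op m)}
    (e : t ≫ s = s' ≫ X.map θ.op) : Sec R (E.sheaf n) s →+ Sec R (E.sheaf m) s' :=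
  ((Sec.map R (E.str θ) s').toAddMonoidHom.comp (Sec.toOverMap R (X.map θ.op) _ s')).comp
    (Sec.res R (E.sheaf n) t e)

variable {E E'}

lemma tr_apply (θ : n ⟶ m) (t : W' ⟶ W) {s : W ⟶ X.obj (op n)} {s' : W' ⟶ X.obj (op m)}
    (e : t ≫ s = s' ≫ X.map θ.op) (a : Sec R (E.sheaf n) s) :
    E.tr θ t e a = Sec.map R (E.str θ) s'
      (Sec.toOverMap R (X.map θ.op) _ s' (Sec.res R (E.sheaf n) t e a)) := rfl

lemma tr_smul (θ : n ⟶ m) (t : W' ⟶ W) {s : W ⟶ X.obj (op n)} {s' : W' ⟶ X.obj (op m)}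
    (e : t ≫ s = s' ≫ X.map θ.op) (r : R.obj.obj (op W)) (a : Sec R (E.sheaf n) s) :
    E.tr θ t e (r • a) = (R.obj.map t.op r : R.obj.obj (op W')) • E.tr θ t e a := by
  rw [tr_apply, Sec.res_smul, Sec.toOverMap_smul, map_smul, ← tr_apply]

lemma tr_congr {θ θ' : n ⟶ m} (hθ : θ = θ') {t t' : W' ⟶ W} (ht : t = t')
    {s : W ⟶ X.obj (op n)} {s' : W' ⟶ X.obj (op m)}
    (e : t ≫ s = s' ≫ X.map θ.op) (a : Sec R (E.sheaf n) s) :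
    E.tr θ t e a = E.tr θ' t' (by rw [← hθ, ← ht, e]) a := by
  subst hθ ht
  rfl

lemma tr_res (θ : n ⟶ m) (t : W' ⟶ W) (t' : W'' ⟶ W') {s : W ⟶ X.obj (op n)}
    {s' : W' ⟶ X.obj (op n)} {s'' : W'' ⟶ X.obj (op m)} (e : t ≫ s = s')
    (e' : t' ≫ s' = s'' ≫ X.map θ.op) (a : Sec R (E.sheaf n) s) :
    E.tr θ t' e' (Sec.res R _ t e a) = E.tr θ (t' ≫ t) (by rw [Category.assoc, e, e']) a := by
  rw [tr_apply, Sec.res_res, ← tr_apply]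

lemma res_tr (θ : n ⟶ m) (t : W' ⟶ W) (t' : W'' ⟶ W') {s : W ⟶ X.obj (op n)}
    {s' : W' ⟶ X.obj (op m)} {s'' : W'' ⟶ X.obj (op m)} (e : t ≫ s = s' ≫ X.map θ.op)
    (e' : t' ≫ s' = s'') (a : Sec R (E.sheaf n) s) :
    Sec.res R _ t' e' (E.tr θ t e a) =
      E.tr θ (t' ≫ t) (by rw [Category.assoc, e, ← e', Category.assoc]) a := by
  rw [tr_apply, ← Sec.map_res, ← Sec.toOverMap_res, Sec.res_res, ← tr_apply]

lemma tr_id (t : W' ⟶ W) {s : W ⟶ X.obj (op n)} {s' : W' ⟶ X.obj (op n)}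
    {θ : n ⟶ n} (hθ : θ = 𝟙 n) (e : t ≫ s = s' ≫ X.map θ.op) (a : Sec R (E.sheaf n) s) :
    E.tr θ t e a = Sec.res R _ t (by rw [e, hθ]; simp) a := by
  subst hθ
  have h : E.str (𝟙 n) = (overMapIdIso R (by simp)).hom.app (E.sheaf n) := E.u_id n
  rw [tr_apply, h, Sec.map_overMapIdIso_hom, Sec.of_toOverMap, Sec.res_res]
  exact Sec.res_congr R (Category.id_comp _) _ _

/-- The cocycle condition for structure maps, with the coherence isomorphisms absorbed. On sections
these are restrictions along identities of `C`, so transport along arbitrary commuting squares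
becomes strictly functorial. -/
lemma tr_tr (θ : k ⟶ l) (δ : l ⟶ m) (t : W' ⟶ W) (t' : W'' ⟶ W') {s : W ⟶ X.obj (op k)}
    {s' : W' ⟶ X.obj (op l)} {s'' : W'' ⟶ X.obj (op m)} (e : t ≫ s = s' ≫ X.map θ.op)
    (e' : t' ≫ s' = s'' ≫ X.map δ.op) (a : Sec R (E.sheaf k) s) :
    E.tr δ t' e' (E.tr θ t e a) = E.tr (θ ≫ δ) (t' ≫ t)
      (by rw [Category.assoc, e, ← Category.assoc, e', Category.assoc, op_comp, X.map_comp]) a := by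
  have h : E.str (θ ≫ δ) = (overMapCompIso R (by simp)).hom.app (E.sheaf k) ≫
    (SheafOfModules.overMap.{u} R (X.map δ.op)).map (E.str θ) ≫ E.str δ := E.u_comp θ δ
  rw [tr_apply δ, res_tr, tr_apply θ, tr_apply (θ ≫ δ), h, Sec.map_comp, Sec.map_comp,
    Sec.map_overMapCompIso_hom]
  refine congrArg (fun b => Sec.map R (E.str δ) s'' (Sec.toOverMap R (X.map δ.op) _ s''
    (Sec.map R (E.str θ) (s'' ≫ X.map δ.op) (Sec.toOverMap R (X.map θ.op) _ _ b)))) ?_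
  rw [Sec.of_toOverMap, Sec.res_res]
  exact Sec.res_congr R (Category.id_comp _).symm _ _

lemma map_tr (f : E ⟶ E') (θ : n ⟶ m) (t : W' ⟶ W) {s : W ⟶ X.obj (op n)}
    {s' : W' ⟶ X.obj (op m)} (e : t ≫ s = s' ≫ X.map θ.op) (a : Sec R (E.sheaf n) s) :
    Sec.map R (sheafHom f m) s' (E.tr θ t e a) =
      E'.tr θ t e (Sec.map R (sheafHom f n) s a) := by
  have h : (SheafOfModules.overMap.{u} R (X.map θ.op)).map (sheafHom f n) ≫ E'.str θ =
    E.str θ ≫ sheafHom f m := f.comm θ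
  rw [tr_apply, ← Sec.map_comp, ← h, Sec.map_comp, tr_apply, ← Sec.map_res]
  rfl

/-- Morphisms of lax sections, constructed from morphisms compatible with sections. -/
def homMk (f : ∀ n, E.sheaf n ⟶ E'.sheaf n)
    (h : ∀ {n m : SimplexCategory} (θ : n ⟶ m) {W : C} (s : W ⟶ X.obj (op m))
      (a : Sec R (E.sheaf n) (s ≫ X.map θ.op)),
      Sec.map R (f m) s (E.tr θ (𝟙 W) (Category.id_comp _) a) =
        E'.tr θ (𝟙 W) (Category.id_comp _) (Sec.map R (f n) _ a)) : E ⟶ E' where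
  app := f
  comm {n m} θ := by
    have : (SheafOfModules.overMap.{u} R (X.map θ.op)).map (f n) ≫ E'.str θ =
        E.str θ ≫ f m := by
      refine Sec.hom_ext R fun {W} s a => ?_
      have h' := h θ s (Sec.ofOverMap R _ _ s a)
      rw [tr_apply, tr_apply, Sec.res_id R rfl, Sec.res_id R rfl] at h'
      exact h'.symm
    exact this

lemma sheafHom_ext {f g : E ⟶ E'} (h : ∀ n, sheafHom f n = sheafHom g n) : f = g :=
  hom_ext h

variable (R X) in
/-- The components of lax sections, as a functor. -/
@[simps]
def evSheaf (n : SimplexCategory) :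
    LaxLimit (modDiagram R X) ⥤ SheafOfModules.{u} (R.over (X.obj (op n))) where
  obj E := E.sheaf n
  map f := sheafHom f n
  map_id _ := rfl
  map_comp _ _ := rfl

instance (n : SimplexCategory) : (evSheaf R X n).Additive where
  map_add := rfl

lemma sheafHom_comp (f : E ⟶ E') (g : E' ⟶ E'') (n : SimplexCategory) :
    sheafHom (f ≫ g) n = sheafHom f n ≫ sheafHom g n := rfl

end LaxLimit

variable (R X) in
/-- The data defining a lax section of sheaves of modules, in terms of sections. -/
structure TrData where
  /-- the components -/
  x (n : SimplexCategory) : SheafOfModules.{u} (R.over (X.obj (op n)))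
  /-- the action of the structure maps on sections -/
  T {n m : SimplexCategory} (θ : n ⟶ m) {W W' : C} (t : W' ⟶ W) {s : W ⟶ X.obj (op n)}
    {s' : W' ⟶ X.obj (op m)} (e : t ≫ s = s' ≫ X.map θ.op) : Sec R (x n) s →+ Sec R (x m) s'
  T_smul {n m : SimplexCategory} (θ : n ⟶ m) {W W' : C} (t : W' ⟶ W) {s : W ⟶ X.obj (op n)}
    {s' : W' ⟶ X.obj (op m)} (e : t ≫ s = s' ≫ X.map θ.op) (r : R.obj.obj (op W))
    (a : Sec R (x n) s) : T θ t e (r • a) = (R.obj.map t.op r : R.obj.obj (op W')) • T θ t e a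
  T_id {n : SimplexCategory} {W W' : C} (t : W' ⟶ W) {s : W ⟶ X.obj (op n)}
    {s' : W' ⟶ X.obj (op n)} (e : t ≫ s = s' ≫ X.map (𝟙 n).op) (e' : t ≫ s = s')
    (a : Sec R (x n) s) : T (𝟙 n) t e a = Sec.res R _ t e' a
  T_T {k l m : SimplexCategory} (θ : k ⟶ l) (δ : l ⟶ m) {W W' W'' : C} (t : W' ⟶ W)
    (t' : W'' ⟶ W') {s : W ⟶ X.obj (op k)} {s' : W' ⟶ X.obj (op l)} {s'' : W'' ⟶ X.obj (op m)}
    (e : t ≫ s = s' ≫ X.map θ.op) (e' : t' ≫ s' = s'' ≫ X.map δ.op)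
    (e'' : (t' ≫ t) ≫ s = s'' ≫ X.map (θ ≫ δ).op) (a : Sec R (x k) s) :
    T δ t' e' (T θ t e a) = T (θ ≫ δ) (t' ≫ t) e'' a

namespace TrData

variable (D : TrData R X)

lemma T_congr {θ θ' : n ⟶ m} (hθ : θ = θ') {t t' : W' ⟶ W} (ht : t = t')
    {s : W ⟶ X.obj (op n)} {s' : W' ⟶ X.obj (op m)}
    (e : t ≫ s = s' ≫ X.map θ.op) (a : Sec R (D.x n) s) :
    D.T θ t e a = D.T θ' t' (by rw [← hθ, ← ht, e]) a := by
  subst hθ ht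
  rfl

/-- Restriction is transport along the identity of `n`, so this compatibility is a case of the
composition law and need not be an axiom. -/
lemma T_res (θ : n ⟶ m) (t : W' ⟶ W) (t' : W'' ⟶ W') {s : W ⟶ X.obj (op n)}
    {s' : W' ⟶ X.obj (op n)} {s'' : W'' ⟶ X.obj (op m)} (e : t ≫ s = s')
    (e' : t' ≫ s' = s'' ≫ X.map θ.op) (a : Sec R (D.x n) s) :
    D.T θ t' e' (Sec.res R _ t e a) = D.T θ (t' ≫ t) (by rw [Category.assoc, e, e']) a := by
  rw [← D.T_id t (by simpa using e) e, D.T_T _ _ _ _ _ _ (by simp [e, e'])]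
  exact D.T_congr (Category.id_comp _) rfl _ _

lemma res_T (θ : n ⟶ m) (t : W' ⟶ W) (t' : W'' ⟶ W') {s : W ⟶ X.obj (op n)}
    {s' : W' ⟶ X.obj (op m)} {s'' : W'' ⟶ X.obj (op m)} (e : t ≫ s = s' ≫ X.map θ.op)
    (e' : t' ≫ s' = s'') (a : Sec R (D.x n) s) :
    Sec.res R _ t' e' (D.T θ t e a) =
      D.T θ (t' ≫ t) (by rw [Category.assoc, e, ← e', Category.assoc]) a := by
  rw [← D.T_id t' (by simpa using e') e', D.T_T _ _ _ _ _ _ (by simp [e, ← e'])]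
  exact D.T_congr (Category.comp_id _) rfl _ _

/-- The structure maps. -/
def U (θ : n ⟶ m) : (SheafOfModules.overMap.{u} R (X.map θ.op)).obj (D.x n) ⟶ D.x m :=
  Sec.homMk R
    (fun {W} s => (D.T θ (𝟙 W) (Category.id_comp _)).comp (Sec.ofOverMap R _ _ s))
    (fun {W} s r a => by
      refine (D.T_smul θ (𝟙 W) _ r (Sec.ofOverMap R _ _ s a)).trans ?_
      rw [op_id, R.obj.map_id]
      rfl)
    (fun {W W'} t {s s'} e a => by
      refine (D.T_res θ t (𝟙 W') (s := s ≫ X.map θ.op) (s' := s' ≫ X.map θ.op) (by simp [← e])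
        (by simp) (Sec.ofOverMap R _ _ s a)).trans ?_
      refine Eq.trans ?_ (D.res_T θ (𝟙 W) t (s := s ≫ X.map θ.op) (by simp) e
        (Sec.ofOverMap R _ _ s a)).symm
      exact D.T_congr rfl (by simp) _ _)

lemma map_U (θ : n ⟶ m) (s : W ⟶ X.obj (op m)) (a) :
    Sec.map R (D.U θ) s a = D.T θ (𝟙 W) (Category.id_comp _) (Sec.ofOverMap R _ _ s a) := rfl

lemma U_id (n : SimplexCategory) : D.U (𝟙 n) = (overMapIdIso R (by simp)).hom.app (D.x n) := by
  refine Sec.hom_ext R fun {W} s a => ?_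
  rw [Sec.map_overMapIdIso_hom, map_U]
  exact D.T_id _ _ _ _

lemma U_comp (θ : k ⟶ l) (δ : l ⟶ m) :
    D.U (θ ≫ δ) = (overMapCompIso R (by simp)).hom.app (D.x k) ≫
      (SheafOfModules.overMap.{u} R (X.map δ.op)).map (D.U θ) ≫ D.U δ := by
  refine Sec.hom_ext R fun {W} s a => ?_
  rw [Sec.map_comp, Sec.map_comp, Sec.map_overMapCompIso_hom, map_U, map_U, Sec.ofOverMap_map,
    Sec.of_toOverMap, map_U, Sec.of_toOverMap, T_res, D.T_T _ _ _ _ _ _ (by simp)]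
  exact D.T_congr rfl (by simp) _ _

/-- The lax section defined by its action on sections. -/
def toLaxLimit : LaxLimit (modDiagram R X) where
  x := D.x
  u θ := D.U θ
  u_id := D.U_id
  u_comp := D.U_comp

lemma tr_toLaxLimit (θ : n ⟶ m) (t : W' ⟶ W) {s : W ⟶ X.obj (op n)} {s' : W' ⟶ X.obj (op m)}
    (e : t ≫ s = s' ≫ X.map θ.op) (a : Sec R (D.x n) s) :
    D.toLaxLimit.tr θ t e a = D.T θ t e a := by
  change D.T θ (𝟙 W') _ (Sec.res R (D.x n) t e a) = _
  rw [T_res]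
  exact D.T_congr rfl (Category.id_comp _) _ _

end TrData

end Transport

end LaxDescent

end

noncomputable section

namespace LaxDescent

/-! ### The shift of the simplex category -/

section Shift

/-- The order preserving map `Fin (k + 1) → Fin (l + 1)` extending `f` by `0 ↦ 0`. -/
def succExtend {k l : ℕ} (f : Fin k →o Fin l) : Fin (k + 1) →o Fin (l + 1) where
  toFun := Fin.cases 0 fun i => (f i).succ
  monotone' i j h := by
    induction i using Fin.cases with
    | zero => exact Fin.zero_le _
    | succ i =>
      induction j using Fin.cases with
      | zero => simp at h
      | succ j => exact Fin.succ_le_succ_iff.2 (f.monotone (Fin.succ_le_succ_iff.1 h))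

/-- The functor `[n] ↦ [n + 1]` adding an initial vertex. -/
def shift : SimplexCategory ⥤ SimplexCategory where
  obj n := SimplexCategory.mk (n.len + 1)
  map θ := SimplexCategory.Hom.mk (succExtend θ.toOrderHom)
  map_id n := by
    ext i
    induction i using Fin.cases <;> rfl
  map_comp θ δ := by
    ext i
    induction i using Fin.cases <;> rfl

/-- The inclusion of the last vertices. -/
def shiftδ (n : SimplexCategory) : n ⟶ shift.obj n := SimplexCategory.Hom.mk
  ⟨Fin.succ, fun _ _ h => Fin.succ_le_succ_iff.2 h⟩

/-- The inclusion of the initial vertex. -/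
def shiftv (n : SimplexCategory) : SimplexCategory.mk 0 ⟶ shift.obj n :=
  SimplexCategory.Hom.mk ⟨fun _ => 0, fun _ _ _ => le_rfl⟩

/-- The degeneracy identifying the first two vertices. -/
def shiftσ (n : SimplexCategory) : shift.obj (shift.obj n) ⟶ shift.obj n :=
  SimplexCategory.Hom.mk
    ⟨Fin.cases 0 id, fun i j h => by
      induction i using Fin.cases with
      | zero => exact Fin.zero_le _
      | succ i =>
        induction j using Fin.cases with
        | zero => simp at h
        | succ j => exact Fin.succ_le_succ_iff.1 h⟩

variable {n m : SimplexCategory} (θ : n ⟶ m)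

lemma shiftδ_naturality : θ ≫ shiftδ m = shiftδ n ≫ shift.map θ := by
  ext i
  rfl

lemma shiftv_naturality : shiftv n ≫ shift.map θ = shiftv m := by
  ext i
  rfl

lemma shiftσ_naturality :
    shift.map (shift.map θ) ≫ shiftσ m = shiftσ n ≫ shift.map θ := by
  ext i
  induction i using Fin.cases <;> rfl

/-- The first identity of the extra degeneracy: doubling the initial vertex and then forgetting one
copy changes nothing. -/
lemma shift_map_shiftδ_comp_shiftσ (n : SimplexCategory) :
    shift.map (shiftδ n) ≫ shiftσ n = 𝟙 _ := by
  ext i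
  induction i using Fin.cases <;> rfl

/-- The second identity: `shift.map (shiftv n)` picks out the two copies of the initial vertex,
which `shiftσ n` identifies, so the composite factors through the point. -/
lemma shift_map_shiftv_comp_shiftσ (n : SimplexCategory) :
    shift.map (shiftv n) ≫ shiftσ n =
      SimplexCategory.const (shift.obj (SimplexCategory.mk 0)) (SimplexCategory.mk 0) 0 ≫
        shiftv n := by
  ext i
  induction i using Fin.cases <;> rfl

lemma shiftv_comp_const :
    shiftv (SimplexCategory.mk 0) ≫
      SimplexCategory.const (shift.obj (SimplexCategory.mk 0)) (SimplexCategory.mk 0) 0 = 𝟙 _ := by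
  ext i
  fin_cases i
  rfl

end Shift

/-! ### Reindexing of lax sections -/

section Reindex

variable {C : Type u} [SmallCategory C] {J : GrothendieckTopology C} {R : Sheaf J RingCat.{u}}
  {X Y : SimplicialObject C} {k l m n : SimplexCategory} {W W' W'' : C}

namespace LaxLimit

/-- The morphism between restrictions of the components of a lax section induced by its
structure map. -/
def trHom (E : LaxLimit (modDiagram R X)) (θ : n ⟶ m) {Z : C} (f : Z ⟶ X.obj (op n))
    (g : Z ⟶ X.obj (op m)) (h : f = g ≫ X.map θ.op) :
    (SheafOfModules.overMap.{u} R f).obj (E.sheaf n) ⟶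
      (SheafOfModules.overMap.{u} R g).obj (E.sheaf m) :=
  (overMapCompIso R h).hom.app (E.sheaf n) ≫ (SheafOfModules.overMap.{u} R g).map (E.str θ)

lemma map_trHom (E : LaxLimit (modDiagram R X)) (θ : n ⟶ m) {Z : C} (f : Z ⟶ X.obj (op n))
    (g : Z ⟶ X.obj (op m)) (h : f = g ≫ X.map θ.op) (s : W ⟶ Z)
    (a : Sec R ((SheafOfModules.overMap.{u} R f).obj (E.sheaf n)) s) :
    Sec.map R (E.trHom θ f g h) s a = Sec.toOverMap R g _ s
      (E.tr θ (𝟙 W) (by simp [h]) (Sec.ofOverMap R f _ s a)) := by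
  rw [trHom, Sec.map_comp, Sec.map_overMapCompIso_hom]
  rfl

lemma sheafHom_comp_trHom {E E' : LaxLimit (modDiagram R X)} (φ : E ⟶ E') (θ : n ⟶ m) {Z : C}
    (f : Z ⟶ X.obj (op n)) (g : Z ⟶ X.obj (op m)) (h : f = g ≫ X.map θ.op) :
    (SheafOfModules.overMap.{u} R f).map (sheafHom φ n) ≫ E'.trHom θ f g h =
      E.trHom θ f g h ≫ (SheafOfModules.overMap.{u} R g).map (sheafHom φ m) := by
  refine Sec.hom_ext R fun {W} s a => ?_
  rw [Sec.map_comp, Sec.map_comp, map_trHom, map_trHom, Sec.ofOverMap_map]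
  exact congrArg (Sec.toOverMap R g _ s) (map_tr φ θ _ _ _).symm

end LaxLimit

variable (a : SimplexCategory ⥤ SimplexCategory)
  (g : ∀ n : SimplexCategory, Y.obj (op n) ⟶ X.obj (op (a.obj n)))
  (hg : ∀ {n m : SimplexCategory} (θ : n ⟶ m),
    Y.map θ.op ≫ g n = g m ≫ X.map (a.map θ).op)

variable {a g} in
include hg in
lemma reind_compat {θ : n ⟶ m} {t : W' ⟶ W} {s : W ⟶ Y.obj (op n)} {s' : W' ⟶ Y.obj (op m)}
    (e : t ≫ s = s' ≫ Y.map θ.op) : t ≫ s ≫ g n = (s' ≫ g m) ≫ X.map (a.map θ).op := by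
  rw [← Category.assoc, e, Category.assoc, hg, Category.assoc]

/-- The data defining the reindexing of a lax section. -/
@[simps]
def reindData (E : LaxLimit (modDiagram R X)) : TrData R Y where
  x n := (SheafOfModules.overMap.{u} R (g n)).obj (E.sheaf (a.obj n))
  T {n m} θ {_ _} t {s s'} e := ((Sec.toOverMap R (g m) _ s').comp
    (E.tr (a.map θ) t (reind_compat hg e))).comp (Sec.ofOverMap R (g n) _ s)
  T_smul {_ _} θ {_ _} t {s _} e r b :=
    LaxLimit.tr_smul (a.map θ) t (reind_compat hg e) r (Sec.ofOverMap R (g _) _ s b)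
  T_id {_ _ _} t {_ _} e _ _ := LaxLimit.tr_id t (a.map_id _) (reind_compat hg e) _
  T_T {_ _ _} θ δ {_ _ _} t t' {_ _ _} e e' _ _ :=
    (LaxLimit.tr_tr (a.map θ) (a.map δ) t t' (reind_compat hg e) (reind_compat hg e') _).trans
      (LaxLimit.tr_congr (a.map_comp θ δ).symm rfl _ _)

variable (R) in
/-- Reindexing of lax sections. -/
def reind : LaxLimit (modDiagram R X) ⥤ LaxLimit (modDiagram R Y) where
  obj E := (reindData a g hg E).toLaxLimit
  map {E E'} f := LaxLimit.homMk (E := (reindData a g hg E).toLaxLimit)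
    (E' := (reindData a g hg E').toLaxLimit)
    (fun n => (SheafOfModules.overMap.{u} R (g n)).map (LaxLimit.sheafHom f (a.obj n)))
    (fun {n m} θ {W} s b => by
      refine (congrArg _ (TrData.tr_toLaxLimit (reindData a g hg E) _ _ _ _)).trans ?_
      refine Eq.trans ?_ (TrData.tr_toLaxLimit (reindData a g hg E') _ _ _ _).symm
      exact congrArg (Sec.toOverMap R (g m) _ s) (LaxLimit.map_tr f (a.map θ) _ _ _))
  map_id E := LaxLimit.sheafHom_ext fun n =>
    (SheafOfModules.overMap.{u} R (g n)).map_id (E.sheaf (a.obj n))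
  map_comp {E E' E''} f f' := LaxLimit.sheafHom_ext fun n =>
    (SheafOfModules.overMap.{u} R (g n)).map_comp (LaxLimit.sheafHom f _) (LaxLimit.sheafHom f' _)

instance : (reind R a g hg).Additive where
  map_add := rfl

section

variable (E : LaxLimit (modDiagram R X))

/-- The sections of a reindexed lax section. -/
def ofReind {n : SimplexCategory} (s : W ⟶ Y.obj (op n)) :
    Sec R (((reind R a g hg).obj E).sheaf n) s →+ Sec R (E.sheaf (a.obj n)) (s ≫ g n) :=
  Sec.ofOverMap R (g n) (E.sheaf (a.obj n)) s

variable {a g hg E}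

lemma ofReind_injective (s : W ⟶ Y.obj (op n))
    {x x' : Sec R (((reind R a g hg).obj E).sheaf n) s}
    (h : ofReind a g hg E s x = ofReind a g hg E s x') : x = x' := h

lemma ofReind_tr (θ : n ⟶ m) (t : W' ⟶ W)
    {s : W ⟶ Y.obj (op n)} {s' : W' ⟶ Y.obj (op m)} (e : t ≫ s = s' ≫ Y.map θ.op)
    (x : Sec R (((reind R a g hg).obj E).sheaf n) s) :
    ofReind a g hg E s' (((reind R a g hg).obj E).tr θ t e x) =
      E.tr (a.map θ) t (reind_compat hg e) (ofReind a g hg E s x) :=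
  TrData.tr_toLaxLimit (reindData a g hg E) θ t e x

end

section

variable {a} {b : SimplexCategory ⥤ SimplexCategory} (τ : a ⟶ b) {g}
  {h : ∀ n : SimplexCategory, Y.obj (op n) ⟶ X.obj (op (b.obj n))}
  (hg : ∀ {n m : SimplexCategory} (θ : n ⟶ m),
    Y.map θ.op ≫ g n = g m ≫ X.map (a.map θ).op)
  (hh : ∀ {n m : SimplexCategory} (θ : n ⟶ m),
    Y.map θ.op ≫ h n = h m ≫ X.map (b.map θ).op)
  (hτ : ∀ n, g n = h n ≫ X.map (τ.app n).op)

/-- The components of the comparison between reindexings. -/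
def reindTransApp (E : LaxLimit (modDiagram R X)) (n : SimplexCategory) :
    ((reind R a g hg).obj E).sheaf n ⟶ ((reind R b h hh).obj E).sheaf n :=
  E.trHom (τ.app n) (g n) (h n) (hτ n)

variable {τ hg hh} in
lemma ofReind_reindTransApp (E : LaxLimit (modDiagram R X)) {n : SimplexCategory}
    (s : W ⟶ Y.obj (op n)) (x : Sec R (((reind R a g hg).obj E).sheaf n) s) :
    ofReind b h hh E s (Sec.map R (reindTransApp τ hg hh hτ E n) s x) =
      E.tr (τ.app n) (𝟙 W) (by simp [hτ]) (ofReind a g hg E s x) :=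
  LaxLimit.map_trHom E (τ.app n) (g n) (h n) (hτ n) s x

variable (R) in
/-- The comparison between reindexings induced by a natural transformation. -/
def reindTrans : reind R a g hg ⟶ reind R b h hh where
  app E := LaxLimit.homMk (fun n => reindTransApp τ hg hh hτ E n)
    (fun {n m} θ {W} s x => by
      apply ofReind_injective
      rw [ofReind_reindTransApp, ofReind_tr, ofReind_tr, ofReind_reindTransApp, LaxLimit.tr_tr,
        LaxLimit.tr_tr]
      exact LaxLimit.tr_congr (τ.naturality θ) rfl _ _)
  naturality E E' f := LaxLimit.sheafHom_ext fun n => LaxLimit.sheafHom_comp_trHom f _ _ _ _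

end

lemma map_comp_aug {U : C} (p : X ⟶ (SimplicialObject.const C).obj U) (θ : n ⟶ m) :
    X.map θ.op ≫ augFamily X p n = augFamily X p m :=
  (p.naturality θ.op).trans (Category.comp_id _)

section

variable {U : C} (p : X ⟶ (SimplicialObject.const C).obj U) (F : SheafOfModules.{u} (R.over U))

/-- The sections of a restriction to a simplicial object. -/
def ofRestr {n : SimplexCategory} (s : W ⟶ X.obj (op n)) :
    Sec R (((restr R X p).obj F).sheaf n) s →+ Sec R F (s ≫ augFamily X p n) :=
  Sec.ofOverMap R (augFamily X p n) F s

/-- The sections of a restriction to a simplicial object. -/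
def toRestr {n : SimplexCategory} (s : W ⟶ X.obj (op n)) :
    Sec R F (s ≫ augFamily X p n) →+ Sec R (((restr R X p).obj F).sheaf n) s :=
  Sec.toOverMap R (augFamily X p n) F s

variable {p F}

lemma ofRestr_injective (s : W ⟶ X.obj (op n)) {x x' : Sec R (((restr R X p).obj F).sheaf n) s}
    (h : ofRestr p F s x = ofRestr p F s x') : x = x' := h

/-- The structure maps of a restricted sheaf are coherence isomorphisms, so transport in it is plain
restriction of sections of `F`. -/
lemma ofRestr_tr (θ : n ⟶ m) (t : W' ⟶ W)
    {s : W ⟶ X.obj (op n)} {s' : W' ⟶ X.obj (op m)} (e : t ≫ s = s' ≫ X.map θ.op)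
    (x : Sec R (((restr R X p).obj F).sheaf n) s) :
    ofRestr p F s' (((restr R X p).obj F).tr θ t e x) =
      Sec.res R F t (by rw [← Category.assoc, e, Category.assoc, map_comp_aug])
        (ofRestr p F s x) := by
  rw [LaxLimit.tr_apply]
  refine (Sec.map_overMapCompIso_inv R (map_comp_aug p θ).symm F s' _).trans ?_
  have e' : t ≫ s ≫ augFamily X p n = (s' ≫ X.map θ.op) ≫ augFamily X p n := by
    rw [← e, Category.assoc]
  refine (Sec.res_res R t (𝟙 W') e' _ (ofRestr p F s x)).trans ?_
  exact Sec.res_congr R (Category.id_comp _) _ _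

lemma ofRestr_res (t : W' ⟶ W) {s : W ⟶ X.obj (op n)} {s' : W' ⟶ X.obj (op n)} (e : t ≫ s = s')
    (x : Sec R (((restr R X p).obj F).sheaf n) s) :
    ofRestr p F s' (Sec.res R _ t e x) =
      Sec.res R _ t (by rw [← Category.assoc, e]) (ofRestr p F s x) := rfl

lemma ofRestr_map {F' : SheafOfModules.{u} (R.over U)} (f : F ⟶ F') (s : W ⟶ X.obj (op n))
    (x : Sec R (((restr R X p).obj F).sheaf n) s) :
    ofRestr p F' s (Sec.map R (LaxLimit.sheafHom ((restr R X p).map f) n) s x) =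
      Sec.map R f (s ≫ augFamily X p n) (ofRestr p F s x) := rfl

end

section

variable {a} {g} {hg} {i : SimplexCategory} (v : ∀ n, i ⟶ a.obj n)
  (hv : ∀ {n m : SimplexCategory} (θ : n ⟶ m), v n ≫ a.map θ = v m)
  {Z : C} (p : Y ⟶ (SimplicialObject.const C).obj Z) (f : Z ⟶ X.obj (op i))
  (hp : ∀ n, augFamily Y p n ≫ f = g n ≫ X.map (v n).op)

/-- The components of the comparison from a restriction to a reindexing. -/
def restrToReindApp (E : LaxLimit (modDiagram R X)) (n : SimplexCategory) :
    ((restr R Y p).obj ((SheafOfModules.overMap.{u} R f).obj (E.sheaf i))).sheaf n ⟶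
      ((reind R a g hg).obj E).sheaf n :=
  (overMapCompIso R rfl).inv.app (E.sheaf i) ≫ E.trHom (v n) _ (g n) (hp n)

variable {v p f} in
lemma ofReind_restrToReindApp (E : LaxLimit (modDiagram R X)) {n : SimplexCategory}
    (s : W ⟶ Y.obj (op n))
    (x : Sec R (((restr R Y p).obj ((SheafOfModules.overMap.{u} R f).obj (E.sheaf i))).sheaf n) s) :
    ofReind a g hg E s (Sec.map R (restrToReindApp v p f hp E n) s x) =
      E.tr (v n) (𝟙 W) (by rw [Category.id_comp, Category.assoc, Category.assoc, hp])
        (Sec.ofOverMap R f _ _ (ofRestr p _ s x)) := by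
  refine (LaxLimit.map_trHom E (v n) _ (g n) (hp n) s _).trans ?_
  refine (congrArg (fun b => E.tr (v n) (𝟙 W) _ (Sec.ofOverMap R _ _ s b))
    (Sec.map_overMapCompIso_inv R rfl (E.sheaf i) s x)).trans ?_
  refine (LaxLimit.tr_res _ _ _ _ _ _).trans ?_
  exact LaxLimit.tr_congr rfl (Category.comp_id _) _ _

include hv in
variable (R hg) in
/-- The comparison from a restriction to a reindexing. -/
def restrToReind : LaxLimit.evSheaf R X i ⋙ SheafOfModules.overMap.{u} R f ⋙ restr R Y p ⟶
    reind R a g hg where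
  app E := LaxLimit.homMk
    (E := (restr R Y p).obj ((SheafOfModules.overMap.{u} R f).obj (E.sheaf i)))
    (fun n => restrToReindApp v p f hp E n)
    (fun {n m} θ {W} s x => by
      apply ofReind_injective
      rw [ofReind_restrToReindApp, ofReind_tr, ofReind_restrToReindApp, ofRestr_tr, LaxLimit.tr_tr,
        Sec.ofOverMap_res, LaxLimit.tr_res]
      exact LaxLimit.tr_congr (hv θ).symm rfl _ _)
  naturality E E' φ := LaxLimit.sheafHom_ext fun n => by
    refine Sec.hom_ext R fun {W} s x => ?_
    apply ofReind_injective
    refine (ofReind_restrToReindApp hp E' s _).trans ?_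
    refine Eq.trans ?_ (congrArg _ (ofReind_restrToReindApp (hg := hg) hp E s x)).symm
    exact (LaxLimit.map_tr φ _ _ _ _).symm

end

section

variable {a : SimplexCategory ⥤ SimplexCategory} (τ : ∀ n, n ⟶ a.obj n)
  {g : ∀ n : SimplexCategory, X.obj (op n) ⟶ X.obj (op (a.obj n))}
  (hg : ∀ {n m : SimplexCategory} (θ : n ⟶ m), X.map θ.op ≫ g n = g m ≫ X.map (a.map θ).op)
  (hτ : ∀ n, g n ≫ X.map (τ n).op = 𝟙 _)
  (hτ' : ∀ {n m : SimplexCategory} (θ : n ⟶ m), θ ≫ τ m = τ n ≫ a.map θ)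

/-- The components of the comparison from the identity to a reindexing. -/
def idToReindApp (E : LaxLimit (modDiagram R X)) (n : SimplexCategory) :
    E.sheaf n ⟶ ((reind R a g hg).obj E).sheaf n :=
  (overMapIdIso R rfl).inv.app (E.sheaf n) ≫ E.trHom (τ n) (𝟙 _) (g n) (hτ n).symm

variable {τ hg} in
lemma ofReind_idToReindApp (E : LaxLimit (modDiagram R X)) {n : SimplexCategory}
    (s : W ⟶ X.obj (op n)) (x : Sec R (E.sheaf n) s) :
    ofReind a g hg E s (Sec.map R (idToReindApp τ hg hτ E n) s x) =
      E.tr (τ n) (𝟙 W) (by simp [hτ]) x := by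
  refine (LaxLimit.map_trHom E (τ n) _ (g n) (hτ n).symm s _).trans ?_
  have h : x = Sec.res R (E.sheaf n) (𝟙 W) (by simp) (Sec.ofOverMap R (𝟙 _) _ s
      (Sec.map R ((overMapIdIso R rfl).inv.app (E.sheaf n)) s x)) := by
    rw [← Sec.map_overMapIdIso_hom R rfl, ← Sec.map_comp, Iso.inv_hom_id_app]
    rfl
  refine Eq.trans ?_ (congrArg (E.tr (τ n) (𝟙 W) _) h.symm)
  have h' := LaxLimit.tr_res (E := E) (τ n) (𝟙 W) (𝟙 W) (s := s ≫ 𝟙 _) (s' := s) (s'' := s ≫ g n)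
    (by simp) (by simp [hτ]) (Sec.ofOverMap R (𝟙 _) _ s
      (Sec.map R ((overMapIdIso R rfl).inv.app (E.sheaf n)) s x))
  refine Eq.trans ?_ h'.symm
  exact LaxLimit.tr_congr rfl (Category.comp_id _).symm _ _

include hτ' in
variable (R) in
/-- The comparison from the identity to a reindexing. -/
def idToReind : 𝟭 _ ⟶ reind R a g hg where
  app E := LaxLimit.homMk (E := E) (fun n => idToReindApp τ hg hτ E n)
    (fun {n m} θ {W} s x => by
      apply ofReind_injective
      rw [ofReind_idToReindApp, ofReind_tr, ofReind_idToReindApp, LaxLimit.tr_tr,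
        LaxLimit.tr_tr]
      exact LaxLimit.tr_congr (hτ' θ) rfl _ _)
  naturality E E' φ := LaxLimit.sheafHom_ext fun n => by
    refine Sec.hom_ext R fun {W} s x => ?_
    apply ofReind_injective
    refine (ofReind_idToReindApp hτ E' s _).trans ?_
    refine Eq.trans ?_ (congrArg _ (ofReind_idToReindApp (hg := hg) hτ E s x)).symm
    exact (LaxLimit.map_tr φ _ _ _ _).symm

end

end Reindex

end LaxDescent

end

noncomputable section

namespace LaxDescent

/-! ### The décalage of a simplicial object -/

section Dec

variable {C : Type u} [SmallCategory C] {J : GrothendieckTopology C} (R : Sheaf J RingCat.{u})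
  (X : SimplicialObject C)

/-- The décalage of a simplicial object, forgetting the first vertex. -/
def dec : SimplicialObject C where
  obj n := X.obj (op (shift.obj n.unop))
  map θ := X.map (shift.map θ.unop).op
  map_id n := by
    rw [unop_id, shift.map_id]
    exact X.map_id _
  map_comp θ δ := by
    rw [unop_comp, shift.map_comp]
    exact X.map_comp _ _

/-- The augmentation of the décalage given by the first vertex. -/
def decAug : dec X ⟶ (SimplicialObject.const C).obj (X.obj (op (SimplexCategory.mk 0))) where
  app n := X.map (shiftv n.unop).op
  naturality n m θ := by
    refine Eq.trans ?_ (Category.comp_id _).symm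
    exact (X.map_comp _ _).symm.trans (congrArg (fun t => X.map t.op)
      (shiftv_naturality θ.unop))

/-- The projection from the décalage forgetting the first vertex. -/
def decProj (n : SimplexCategory) : (dec X).obj (op n) ⟶ X.obj (op n) := X.map (shiftδ n).op

/-- The degeneracy from the décalage to the double décalage. -/
def decσ (n : SimplexCategory) : (dec X).obj (op n) ⟶ (dec X).obj (op (shift.obj n)) :=
  X.map (shiftσ n).op

/-- The degeneracy in the lowest degree. -/
def decσ₀ : X.obj (op (SimplexCategory.mk 0)) ⟶ (dec X).obj (op (SimplexCategory.mk 0)) :=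
  X.map (SimplexCategory.const (shift.obj (SimplexCategory.mk 0)) (SimplexCategory.mk 0) 0).op

variable {n m : SimplexCategory} (θ : n ⟶ m)

lemma decProj_naturality : (dec X).map θ.op ≫ decProj X n = decProj X m ≫ X.map θ.op := by
  refine (X.map_comp _ _).symm.trans (Eq.trans ?_ (X.map_comp _ _))
  exact congrArg (fun t => X.map t.op) (shiftδ_naturality θ).symm

lemma decσ_naturality :
    (dec X).map θ.op ≫ decσ X n = decσ X m ≫ (dec X).map (shift.map θ).op := by
  refine (X.map_comp _ _).symm.trans (Eq.trans ?_ (X.map_comp _ _))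
  exact congrArg (fun t => X.map t.op) (shiftσ_naturality θ).symm

lemma decσ_comp_map_shiftδ (n : SimplexCategory) :
    decσ X n ≫ (dec X).map (shiftδ n).op = 𝟙 _ := by
  refine (X.map_comp _ _).symm.trans (Eq.trans ?_ (X.map_id _))
  exact congrArg (fun t => X.map t.op) (shift_map_shiftδ_comp_shiftσ n)

lemma decσ_comp_map_shiftv (n : SimplexCategory) :
    decσ X n ≫ (dec X).map (shiftv n).op = augFamily (dec X) (decAug X) n ≫ decσ₀ X := by
  refine (X.map_comp _ _).symm.trans (Eq.trans ?_ (X.map_comp _ _))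
  exact congrArg (fun t => X.map t.op) (shift_map_shiftv_comp_shiftσ n)

lemma decσ₀_comp_aug :
    decσ₀ X ≫ augFamily (dec X) (decAug X) (SimplexCategory.mk 0) = 𝟙 _ := by
  refine (X.map_comp _ _).symm.trans (Eq.trans ?_ (X.map_id _))
  exact congrArg (fun t => X.map t.op) shiftv_comp_const

lemma dec_map_comp_id : (dec X).map θ.op ≫ 𝟙 ((dec X).obj (op n)) =
    𝟙 ((dec X).obj (op m)) ≫ X.map (shift.map θ).op :=
  (Category.comp_id _).trans (Category.id_comp _).symm

/-- Restriction of lax sections along the projection from the décalage. -/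
abbrev projPull : LaxLimit (modDiagram R X) ⥤ LaxLimit (modDiagram R (dec X)) :=
  reind R (𝟭 _) (decProj X) (decProj_naturality X)

/-- The décalage of lax sections. -/
abbrev decLax : LaxLimit (modDiagram R X) ⥤ LaxLimit (modDiagram R (dec X)) :=
  reind R shift (fun n => 𝟙 ((dec X).obj (op n))) (dec_map_comp_id X)

/-- The inclusion of the last vertices as a natural transformation. -/
@[simps]
def shiftδNatTrans : 𝟭 SimplexCategory ⟶ shift where
  app := shiftδ
  naturality _ _ θ := shiftδ_naturality θ

/-- The comparison from the restriction to the décalage, forgetting the first vertex. -/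
abbrev projPullToDec : projPull R X ⟶ decLax R X :=
  reindTrans R shiftδNatTrans (decProj_naturality X) (dec_map_comp_id X) fun _ => (Category.id_comp _).symm

/-- The component in the lowest degree, as a functor. -/
abbrev lowest : LaxLimit (modDiagram R X) ⥤
    SheafOfModules.{u} (R.over (X.obj (op (SimplexCategory.mk 0)))) :=
  LaxLimit.evSheaf R X (SimplexCategory.mk 0) ⋙ SheafOfModules.overMap.{u} R (𝟙 _)

/-- The comparison from the restriction to the décalage, along the first vertex. -/
abbrev vertexToDec : lowest R X ⋙ restr R (dec X) (decAug X) ⟶ decLax R X :=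
  restrToReind R (dec_map_comp_id X) shiftv shiftv_naturality (decAug X) (𝟙 _)
    fun _ => (Category.comp_id _).trans (Category.id_comp _).symm

/-- The restriction to the extra degeneracy in the lowest degree. -/
abbrev lowestσ : LaxLimit (modDiagram R (dec X)) ⥤
    SheafOfModules.{u} (R.over (X.obj (op (SimplexCategory.mk 0)))) :=
  LaxLimit.evSheaf R (dec X) (SimplexCategory.mk 0) ⋙
    SheafOfModules.overMap.{u} R (decσ₀ X)

/-- Reindexing along the extra degeneracy. -/
abbrev decT : LaxLimit (modDiagram R (dec X)) ⥤ LaxLimit (modDiagram R (dec X)) :=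
  reind R shift (decσ X) (decσ_naturality X)

/-- The comparison of the identity with the reindexing along the extra degeneracy. -/
abbrev idToDecT : 𝟭 _ ⟶ decT R X := idToReind R shiftδ (decσ_naturality X)
  (decσ_comp_map_shiftδ X) shiftδ_naturality

/-- The comparison of the lowest degree with the reindexing along the extra degeneracy. -/
abbrev lowestToDecT : lowestσ R X ⋙ restr R (dec X) (decAug X) ⟶ decT R X :=
  restrToReind R (decσ_naturality X) shiftv shiftv_naturality (decAug X) (decσ₀ X)
    fun n => (decσ_comp_map_shiftv X n).symm

/-- The retraction of the restriction functor. -/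
def restrLowestσIso : restr R (dec X) (decAug X) ⋙ lowestσ R X ≅ 𝟭 _ :=
  (overMapCompIso R (decσ₀_comp_aug X).symm).symm ≪≫ overMapIdIso R rfl

end Dec

/-! ### Compatibility of the contraction with the augmentation of the décalage -/

section

variable {C : Type u} [SmallCategory C] {J : GrothendieckTopology C} {R : Sheaf J RingCat.{u}}
  {X : SimplicialObject C}

lemma map_restrLowestσIso_hom
    (F : SheafOfModules.{u} (R.over (X.obj (op (SimplexCategory.mk 0))))) {W : C}
    (s : W ⟶ X.obj (op (SimplexCategory.mk 0)))
    (x : Sec R ((SheafOfModules.overMap.{u} R (decσ₀ X)).obj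
      (((restr R (dec X) (decAug X)).obj F).sheaf (SimplexCategory.mk 0))) s) :
    Sec.map R ((restrLowestσIso R X).hom.app F) s x = Sec.res R F (𝟙 W)
      (by rw [Category.assoc, decσ₀_comp_aug]; simp)
      (ofRestr (decAug X) F _ (Sec.ofOverMap R (decσ₀ X) _ s x)) := by
  refine (Sec.map_overMapIdIso_hom R rfl F s _).trans ?_
  refine (congrArg (fun b => Sec.res R F (𝟙 W) _ (Sec.ofOverMap R (𝟙 _) F s b))
    (Sec.map_overMapCompIso_inv R (decσ₀_comp_aug X).symm F s x)).trans ?_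
  refine (Sec.res_res R _ _ _ _ _).trans ?_
  exact Sec.res_congr R (Category.id_comp _) _ _

/-- This is the hypothesis `hi` of `full_locMap_of_contraction`. On sections of `F` every map
involved is a restriction, and the two sides restrict along the same morphism of `C`. -/
lemma restr_map_restrLowestσIso_hom_comp
    (F : SheafOfModules.{u} (R.over (X.obj (op (SimplexCategory.mk 0))))) :
    (restr R (dec X) (decAug X)).map ((restrLowestσIso R X).hom.app F) ≫
        (idToDecT R X).app ((restr R (dec X) (decAug X)).obj F) =
      (lowestToDecT R X).app ((restr R (dec X) (decAug X)).obj F) :=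
  LaxLimit.sheafHom_ext fun n => by
    refine Sec.hom_ext R fun {W} s x => ?_
    apply ofReind_injective
    have h₁ := ofReind_idToReindApp (hg := decσ_naturality X) (decσ_comp_map_shiftδ X)
      ((restr R (dec X) (decAug X)).obj F) s
      (Sec.map R (LaxLimit.sheafHom ((restr R (dec X) (decAug X)).map
        ((restrLowestσIso R X).hom.app F)) n) s x)
    have h₂ := ofReind_restrToReindApp (hg := decσ_naturality X) (p := decAug X)
      (fun n => (decσ_comp_map_shiftv X n).symm) ((restr R (dec X) (decAug X)).obj F) s x
    have h₃ := ofRestr_map ((restrLowestσIso R X).hom.app F) s x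
    have h₄ := map_restrLowestσIso_hom F _ (ofRestr (decAug X) _ s x)
    refine h₁.trans (Eq.trans ?_ h₂.symm)
    apply ofRestr_injective
    rw [ofRestr_tr, ofRestr_tr]
    refine (congrArg (Sec.res R F (𝟙 W) _) (h₃.trans h₄)).trans ?_
    rw [Sec.res_res]
    exact Sec.res_congr R (Category.id_comp _) _ _

end

end LaxDescent

end

noncomputable section

namespace LaxDescent

/-! ### Quasi-isomorphisms between reindexings of complexes of lax sections -/

section QuasiIso

variable {C : Type u} [SmallCategory C] [HasPullbacks C] {J : GrothendieckTopology C}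
  {R : Sheaf J RingCat.{u}} {X Y : SimplicialObject C}

/-- The functor induced on complexes by an additive functor. -/
abbrev onChain {A B : Type*} [Category* A] [Category* B] [Preadditive A] [Preadditive B]
    (F : A ⥤ B) [F.Additive] : ChainComplex A ℕ ⥤ ChainComplex B ℕ :=
  F.mapHomologicalComplex (ComplexShape.down ℕ)

/-- The natural transformation induced on complexes. -/
abbrev onChainTrans {A B : Type*} [Category* A] [Category* B] [Preadditive A] [Preadditive B]
    {F G : A ⥤ B} [F.Additive] [G.Additive] (τ : F ⟶ G) : onChain F ⟶ onChain G :=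
  NatTrans.mapHomologicalComplex τ (ComplexShape.down ℕ)

/-- The components of a complex of lax sections. -/
abbrev sheafChain (E : ChainComplex (LaxLimit (modDiagram R X)) ℕ) (n : SimplexCategory) :
    ChainComplex (SheafOfModules.{u} (R.over (X.obj (op n)))) ℕ :=
  (onChain (LaxLimit.evSheaf R X n)).obj E

/-- The structure maps of a complex of lax sections. -/
abbrev strChain (E : ChainComplex (LaxLimit (modDiagram R X)) ℕ) {n m : SimplexCategory}
    (θ : n ⟶ m) : (onChain (SheafOfModules.overMap.{u} R (X.map θ.op))).obj (sheafChain E n) ⟶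
      sheafChain E m :=
  (LaxLimit.toChainLaxObj E).u θ

lemma quasiIso_onChain_overMap {Y Z : C} (f : Y ⟶ Z)
    {K L : ChainComplex (SheafOfModules.{u} (R.over Z)) ℕ} (g : K ⟶ L) [QuasiIso g] :
    QuasiIso ((onChain (SheafOfModules.overMap.{u} R f)).map g) := by
  infer_instance

lemma quasiIso_onChain_restr {U : C} (p : X ⟶ (SimplicialObject.const C).obj U)
    {K L : ChainComplex (SheafOfModules.{u} (R.over U)) ℕ} (g : K ⟶ L) [QuasiIso g] :
    QuasiIso ((onChain (restr R X p)).map g) := by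
  rw [LaxLimit.quasiIso_iff_ev]
  intro n
  exact quasiIso_onChain_overMap (augFamily X p n) g

lemma quasiIso_onChain_ev {K L : ChainComplex (LaxLimit (modDiagram R X)) ℕ} (g : K ⟶ L)
    [QuasiIso g] (n : SimplexCategory) :
    QuasiIso ((onChain (LaxLimit.evSheaf R X n)).map g) :=
  (LaxLimit.quasiIso_iff_ev g).1 ‹_› n

lemma quasiIso_onChain_ev_overMap {K L : ChainComplex (LaxLimit (modDiagram R X)) ℕ} (g : K ⟶ L)
    [QuasiIso g] (n : SimplexCategory) {Z : C} (f : Z ⟶ X.obj (op n)) :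
    QuasiIso ((onChain (LaxLimit.evSheaf R X n ⋙ SheafOfModules.overMap.{u} R f)).map g) :=
  have := quasiIso_onChain_ev g n
  quasiIso_onChain_overMap f ((onChain (LaxLimit.evSheaf R X n)).map g)

variable {a b : SimplexCategory ⥤ SimplexCategory} {τ : a ⟶ b}
  {g : ∀ n : SimplexCategory, Y.obj (op n) ⟶ X.obj (op (a.obj n))}
  {h : ∀ n : SimplexCategory, Y.obj (op n) ⟶ X.obj (op (b.obj n))}
  {hg : ∀ {n m : SimplexCategory} (θ : n ⟶ m), Y.map θ.op ≫ g n = g m ≫ X.map (a.map θ).op}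
  {hh : ∀ {n m : SimplexCategory} (θ : n ⟶ m), Y.map θ.op ≫ h n = h m ≫ X.map (b.map θ).op}
  {hτ : ∀ n, g n = h n ≫ X.map (τ.app n).op}

lemma quasiIso_onChain_reind {K L : ChainComplex (LaxLimit (modDiagram R X)) ℕ} (f : K ⟶ L)
    [QuasiIso f] : QuasiIso ((onChain (reind R a g hg)).map f) := by
  rw [LaxLimit.quasiIso_iff_ev]
  intro n
  exact quasiIso_onChain_ev_overMap f (a.obj n) (g n)

/-- The complex version of `LaxLimit.trHom`. -/
def trHomChain (E : ChainComplex (LaxLimit (modDiagram R X)) ℕ) {n m : SimplexCategory}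
    (θ : n ⟶ m) {Z : C} (f : Z ⟶ X.obj (op n)) (g : Z ⟶ X.obj (op m)) (h : f = g ≫ X.map θ.op) :
    (onChain (SheafOfModules.overMap.{u} R f)).obj (sheafChain E n) ⟶
      (onChain (SheafOfModules.overMap.{u} R g)).obj (sheafChain E m) :=
  (onChainTrans (overMapCompIso R h).hom).app (sheafChain E n) ≫
    (onChain (SheafOfModules.overMap.{u} R g)).map (strChain E θ)

lemma isIso_onChainTrans_app {A B : Type*} [Category* A] [Category* B] [Preadditive A]
    [Preadditive B] {F G : A ⥤ B} [F.Additive] [G.Additive] (τ : F ⟶ G)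
    (K : ChainComplex A ℕ) (h : ∀ k, IsIso (τ.app (K.X k))) : IsIso ((onChainTrans τ).app K) :=
  have (k : ℕ) : IsIso (((onChainTrans τ).app K).f k) := h k
  HomologicalComplex.Hom.isIso_of_components _

/-- A coherence isomorphism followed by the exact restriction of a structure map. Consequently each
comparison between reindexings is a quasi-isomorphism as soon as the structure maps of `E` that it
uses are. -/
lemma quasiIso_trHomChain (E : ChainComplex (LaxLimit (modDiagram R X)) ℕ) {n m : SimplexCategory}
    (θ : n ⟶ m) {Z : C} (f : Z ⟶ X.obj (op n)) (g : Z ⟶ X.obj (op m)) (h : f = g ≫ X.map θ.op)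
    (hE : QuasiIso (strChain E θ)) : QuasiIso (trHomChain E θ f g h) := by
  have := isIso_onChainTrans_app (overMapCompIso R h).hom (sheafChain E n) fun _ => inferInstance
  exact (HomologicalComplex.quasiIso _ _).comp_mem _ _
    (inferInstance : QuasiIso ((onChainTrans (overMapCompIso R h).hom).app (sheafChain E n)))
    (quasiIso_onChain_overMap g (strChain E θ))

lemma quasiIso_reindTrans (E : ChainComplex (LaxLimit (modDiagram R X)) ℕ)
    (hE : ∀ n, QuasiIso (strChain E (τ.app n))) :
    QuasiIso ((onChainTrans (reindTrans R τ hg hh hτ)).app E) := by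
  rw [LaxLimit.quasiIso_iff_ev]
  intro n
  exact quasiIso_trHomChain E (τ.app n) (g n) (h n) (hτ n) (hE n)

lemma quasiIso_restrToReind {i : SimplexCategory} {v : ∀ n, i ⟶ a.obj n}
    {hv : ∀ {n m : SimplexCategory} (θ : n ⟶ m), v n ≫ a.map θ = v m}
    {Z : C} {p : Y ⟶ (SimplicialObject.const C).obj Z} {f : Z ⟶ X.obj (op i)}
    {hp : ∀ n, augFamily Y p n ≫ f = g n ≫ X.map (v n).op}
    (E : ChainComplex (LaxLimit (modDiagram R X)) ℕ) (hE : ∀ n, QuasiIso (strChain E (v n))) :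
    QuasiIso ((onChainTrans (restrToReind R hg v hv p f hp)).app E) := by
  rw [LaxLimit.quasiIso_iff_ev]
  intro n
  have := quasiIso_trHomChain E (v n) _ (g n) (hp n) (hE n)
  have := isIso_onChainTrans_app (overMapCompIso R (rfl : augFamily Y p n ≫ f = _)).inv
    (sheafChain E i) fun _ => inferInstance
  exact quasiIso_comp ((onChainTrans (overMapCompIso R (rfl : augFamily Y p n ≫ f = _)).inv).app
    (sheafChain E i)) (trHomChain E (v n) _ (g n) (hp n))

omit [HasPullbacks C] in
lemma isIso_str_restr {U : C} (p : X ⟶ (SimplicialObject.const C).obj U)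
    (F : SheafOfModules.{u} (R.over U)) {n m : SimplexCategory} (θ : n ⟶ m) :
    IsIso (((restr R X p).obj F).str θ) :=
  inferInstanceAs (IsIso ((overMapCompIso R (map_comp_aug p θ).symm).inv.app F))

omit [HasPullbacks C] in
lemma isIso_trHom (E : LaxLimit (modDiagram R X)) {n m : SimplexCategory}
    (θ : n ⟶ m) {Z : C} (f : Z ⟶ X.obj (op n)) (g : Z ⟶ X.obj (op m)) (h : f = g ≫ X.map θ.op)
    [IsIso (E.str θ)] : IsIso (E.trHom θ f g h) := by
  unfold LaxLimit.trHom
  infer_instance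

omit [HasPullbacks C] in
-- The comparison is made of structure maps, and those of a restricted sheaf are invertible.
lemma isIso_idToReind {τ : ∀ n, n ⟶ a.obj n}
    {g : ∀ n : SimplexCategory, X.obj (op n) ⟶ X.obj (op (a.obj n))}
    {hg : ∀ {n m : SimplexCategory} (θ : n ⟶ m), X.map θ.op ≫ g n = g m ≫ X.map (a.map θ).op}
    {hτ : ∀ n, g n ≫ X.map (τ n).op = 𝟙 _}
    {hτ' : ∀ {n m : SimplexCategory} (θ : n ⟶ m), θ ≫ τ m = τ n ≫ a.map θ}
    {U : C} (p : X ⟶ (SimplicialObject.const C).obj U) (F : SheafOfModules.{u} (R.over U)) :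
    IsIso ((idToReind R τ hg hτ hτ').app ((restr R X p).obj F)) := by
  apply LaxLimit.isIso_of_app
  intro n
  have := isIso_str_restr p F (τ n)
  have := isIso_trHom ((restr R X p).obj F) (τ n) (𝟙 _) (g n) (hτ n).symm
  exact IsIso.comp_isIso' (inferInstance : IsIso ((overMapIdIso R rfl).inv.app
    (((restr R X p).obj F).sheaf n))) this

/-- Restriction of complexes along an augmented simplicial object, on derived categories. -/
abbrev restrLoc {U : C} (p : X ⟶ (SimplicialObject.const C).obj U) :
    DPlus (SheafOfModules.{u} (R.over U)) ⥤ DPlus (LaxLimit (modDiagram R X)) :=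
  locMap (onChain (restr R X p)) fun _ _ f (_ : QuasiIso f) => quasiIso_onChain_restr p f

/-- The natural isomorphism induced on complexes. -/
abbrev onChainIso {A B : Type*} [Category* A] [Category* B] [Preadditive A] [Preadditive B]
    {F G : A ⥤ B} [F.Additive] [G.Additive] (τ : F ≅ G) : onChain F ≅ onChain G :=
  NatIso.mapHomologicalComplex τ (ComplexShape.down ℕ)

variable (R X)

/-- The degeneracy `decσ₀` is a section of the augmentation in lowest degree, so pulling back the
lowest component along it is a left inverse of restriction. -/
instance : (restrLoc (R := R) (decAug X)).Faithful :=
  faithful_locMap_of_retraction _ (S := onChain (lowestσ R X))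
    (fun _ _ f (_ : QuasiIso f) => quasiIso_onChain_ev_overMap f _ (decσ₀ X))
    (onChainIso (restrLowestσIso R X) ≪≫ Functor.mapHomologicalComplexIdIso _ _)

/-- The contraction is `decT`, reindexing along the extra degeneracy. It receives the identity
through the last vertices and the restricted lowest component through the first vertex. -/
instance : (restrLoc (R := R) (decAug X)).Full :=
  full_locMap_of_contraction _ (S := onChain (lowestσ R X))
    (fun _ _ f (_ : QuasiIso f) => quasiIso_onChain_ev_overMap f _ (decσ₀ X))
    (T := onChain (decT R X)) (fun _ _ f (_ : QuasiIso f) => quasiIso_onChain_reind f)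
    ((Functor.mapHomologicalComplexIdIso _ _).inv ≫ onChainTrans (idToDecT R X))
    (onChainTrans (lowestToDecT R X))
    (onChainIso (restrLowestσIso R X) ≪≫ Functor.mapHomologicalComplexIdIso _ _)
    (fun F => by
      -- On a restricted complex the map from the identity to `decT` is invertible, not merely a
      -- quasi-isomorphism, because the structure maps are.
      have : IsIso (((Functor.mapHomologicalComplexIdIso _ _).inv ≫
          onChainTrans (idToDecT R X)).app ((onChain (restr R (dec X) (decAug X))).obj F)) := by
        have := isIso_onChainTrans_app (idToDecT R X)
          ((onChain (restr R (dec X) (decAug X))).obj F)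
          fun k => isIso_idToReind (decAug X) (F.X k)
        rw [NatTrans.comp_app]
        infer_instance
      rw [HomologicalComplex.mem_quasiIso_iff]
      infer_instance)
    (fun F => by
      ext k : 1
      have := restr_map_restrLowestσIso_hom_comp (F.X k)
      refine Eq.trans (congrArg₂ (· ≫ ·) (congrArg (restr R (dec X) (decAug X)).map ?_) ?_) this
      · exact Category.comp_id _
      · exact Category.id_comp _)

end QuasiIso

end LaxDescent

end

noncomputable section

namespace LaxDescent

/-! ### Direct images of lax sections -/

section Push

variable {C : Type u} [SmallCategory C] [HasPullbacks C] {J : GrothendieckTopology C}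
  (R : Sheaf J RingCat.{u}) {Y Z : C} (f : Y ⟶ Z) {W W' : C}

/-- The sections of a direct image. -/
def ofPush (M : SheafOfModules.{u} (R.over Y)) (s : W ⟶ Z) :
    Sec R ((SheafOfModules.overPullback.{u} R f).obj M) s →+ Sec R M (pullback.snd s f) :=
  AddMonoidHom.id (Sec R M (pullback.snd s f))

/-- The sections of a direct image. -/
def toPush (M : SheafOfModules.{u} (R.over Y)) (s : W ⟶ Z) :
    Sec R M (pullback.snd s f) →+ Sec R ((SheafOfModules.overPullback.{u} R f).obj M) s :=
  AddMonoidHom.id (Sec R M (pullback.snd s f))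

variable {R f} {M N : SheafOfModules.{u} (R.over Y)}

lemma ofPush_injective (s : W ⟶ Z) {x x' : Sec R ((SheafOfModules.overPullback.{u} R f).obj M) s}
    (h : ofPush R f M s x = ofPush R f M s x') : x = x' := h

lemma ofPush_smul (s : W ⟶ Z) (a : R.obj.obj (op W))
    (x : Sec R ((SheafOfModules.overPullback.{u} R f).obj M) s) :
    ofPush R f M s (a • x) =
      (R.obj.map (pullback.fst s f).op a : R.obj.obj (op (pullback s f))) • ofPush R f M s x := by
  rfl

/-- The morphism between pullbacks induced by a morphism of the base. -/
abbrev pullbackLift (t : W' ⟶ W) {s : W ⟶ Z} {s' : W' ⟶ Z} (e : t ≫ s = s') :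
    pullback s' f ⟶ pullback s f :=
  pullback.lift (pullback.fst s' f ≫ t) (pullback.snd s' f)
    (by rw [Category.assoc, e, pullback.condition])

lemma ofPush_res (t : W' ⟶ W) {s : W ⟶ Z} {s' : W' ⟶ Z} (e : t ≫ s = s')
    (x : Sec R ((SheafOfModules.overPullback.{u} R f).obj M) s) :
    ofPush R f M s' (Sec.res R _ t e x) =
      Sec.res R M (pullbackLift t e) (pullback.lift_snd _ _ _) (ofPush R f M s x) := by
  rfl

variable (R f)

/-- The unit of the adjunction between restriction and direct image. -/
abbrev pushUnit (F : SheafOfModules.{u} (R.over Z)) :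
    F ⟶ (SheafOfModules.overPullback.{u} R f).obj ((SheafOfModules.overMap.{u} R f).obj F) :=
  (SheafOfModules.overMapPushforwardAdj R f).unit.app F

/-- The counit of the adjunction between restriction and direct image. -/
abbrev pushCounit (M : SheafOfModules.{u} (R.over Y)) :
    (SheafOfModules.overMap.{u} R f).obj ((SheafOfModules.overPullback.{u} R f).obj M) ⟶ M :=
  (SheafOfModules.overMapPushforwardAdj R f).counit.app M

variable {R f}

/-- The adjunction on sheaves comes from `Over.mapPullbackAdj`, whose counit is the projection
`pullback.fst`; the unit on sheaves is restriction along it. -/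
lemma map_pushUnit (F : SheafOfModules.{u} (R.over Z)) (s : W ⟶ Z) (x : Sec R F s) :
    Sec.ofOverMap R f F _ (ofPush R f _ s (Sec.map R (pushUnit R f F) s x)) =
      Sec.res R F (pullback.fst s f) pullback.condition x := by
  refine congrArg (fun t => F.val.presheaf.map t x)
    (congrArg Quiver.Hom.op ?_ : ((Over.mapPullbackAdj f).counit.app (Over.mk s)).op =
      (Over.homMk (pullback.fst s f) pullback.condition :
        Over.mk (pullback.snd s f ≫ f) ⟶ Over.mk s).op)
  ext
  simp

lemma map_pushCounit (M : SheafOfModules.{u} (R.over Y)) (s : W ⟶ Y)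
    (x : Sec R ((SheafOfModules.overMap.{u} R f).obj
      ((SheafOfModules.overPullback.{u} R f).obj M)) s) :
    Sec.map R (pushCounit R f M) s x =
      Sec.res R M (pullback.lift (𝟙 W) s (Category.id_comp _)) (pullback.lift_snd _ _ _)
        (ofPush R f M _ (Sec.ofOverMap R f _ s x)) := by
  refine congrArg (fun t : op (Over.mk (pullback.snd (s ≫ f) f)) ⟶ op (Over.mk s) =>
    (M.val.presheaf.map t).hom (ofPush R f M _ (Sec.ofOverMap R f _ s x)))
    (congrArg Quiver.Hom.op ?_ : ((Over.mapPullbackAdj f).unit.app (Over.mk s)).op =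
      (Over.homMk (pullback.lift (𝟙 W) s (Category.id_comp _)) (pullback.lift_snd _ _ _) :
        Over.mk s ⟶ Over.mk (pullback.snd (s ≫ f) f)).op)
  ext
  simp

end Push

/-! ### Levelwise direct image of lax sections, right adjoint to pullback -/

section Coinduction

variable {C : Type u} [SmallCategory C] [HasPullbacks C] {J : GrothendieckTopology C}
  {R : Sheaf J RingCat.{u}} {X Y : SimplicialObject C} {n m : SimplexCategory} {W W' : C}
  (q : ∀ n : SimplexCategory, Y.obj (op n) ⟶ X.obj (op n))
  (hq : ∀ {n m : SimplexCategory} (θ : n ⟶ m), Y.map θ.op ≫ q n = q m ≫ X.map θ.op)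

variable {q} in
/-- The morphism between pullbacks induced by a simplicial structure map. -/
def coindLift {θ : n ⟶ m} (t : W' ⟶ W) {s : W ⟶ X.obj (op n)} {s' : W' ⟶ X.obj (op m)}
    (e : t ≫ s = s' ≫ X.map θ.op) : pullback s' (q m) ⟶ pullback s (q n) :=
  pullback.lift (pullback.fst s' (q m) ≫ t) (pullback.snd s' (q m) ≫ Y.map θ.op)
    (by rw [Category.assoc, e, Category.assoc, hq, ← Category.assoc, pullback.condition,
      Category.assoc])

section

variable {q} {θ : n ⟶ m} (t : W' ⟶ W) {s : W ⟶ X.obj (op n)} {s' : W' ⟶ X.obj (op m)}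
    (e : t ≫ s = s' ≫ X.map θ.op)

@[simp]
lemma coindLift_fst :
    coindLift hq t e ≫ pullback.fst s (q n) = pullback.fst s' (q m) ≫ t :=
  pullback.lift_fst _ _ _

@[simp]
lemma coindLift_snd :
    coindLift hq t e ≫ pullback.snd s (q n) = pullback.snd s' (q m) ≫ Y.map θ.op :=
  pullback.lift_snd _ _ _

lemma coindLift_id {θ : n ⟶ n} (hθ : θ = 𝟙 n) (t : W' ⟶ W) {s : W ⟶ X.obj (op n)}
    {s' : W' ⟶ X.obj (op n)} (e : t ≫ s = s' ≫ X.map θ.op) (e' : t ≫ s = s') :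
    coindLift hq t e = pullbackLift t e' := by
  subst hθ
  ext
  · exact (coindLift_fst hq t e).trans (pullback.lift_fst _ _ _).symm
  · refine (coindLift_snd hq t e).trans (Eq.trans ?_ (pullback.lift_snd _ _ _).symm)
    rw [op_id, Y.map_id, Category.comp_id]

lemma coindLift_comp {l : SimplexCategory} {δ : m ⟶ l} {W'' : C} (t' : W'' ⟶ W')
    {s'' : W'' ⟶ X.obj (op l)} (e : t ≫ s = s' ≫ X.map θ.op) (e' : t' ≫ s' = s'' ≫ X.map δ.op)
    (e'' : (t' ≫ t) ≫ s = s'' ≫ X.map (θ ≫ δ).op) :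
    coindLift hq t' e' ≫ coindLift hq t e = coindLift hq (t' ≫ t) e'' := by
  ext
  · rw [Category.assoc, coindLift_fst, coindLift_fst, reassoc_of% @coindLift_fst]
  · rw [Category.assoc, coindLift_snd, coindLift_snd, reassoc_of% @coindLift_snd, op_comp, Y.map_comp]

end

omit [HasPullbacks C] in
lemma ringMap_comp {W W' W'' : C} {f : W'' ⟶ W'} {g : W' ⟶ W} {h : W'' ⟶ W} (e : f ≫ g = h)
    (r : R.obj.obj (op W)) :
    (R.obj.map f.op (R.obj.map g.op r : R.obj.obj (op W')) : R.obj.obj (op W'')) =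
      (R.obj.map h.op r : R.obj.obj (op W'')) := by
  subst e
  rw [op_comp, R.obj.map_comp]
  rfl

/-- The data defining the direct image of a lax section. -/
def coindData (E : LaxLimit (modDiagram R Y)) : TrData R X where
  x n := (SheafOfModules.overPullback.{u} R (q n)).obj (E.sheaf n)
  T {n m} θ {_ _} t {s s'} e := ((toPush R (q m) _ s').comp
    (E.tr θ (coindLift hq t e) (coindLift_snd hq t e))).comp (ofPush R (q n) _ s)
  T_smul {n m} θ {W W'} t {s s'} e r b := by
    apply ofPush_injective
    rw [ofPush_smul]
    refine (LaxLimit.tr_smul _ _ _ _ _).trans ?_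
    refine congrArg (fun r' : R.obj.obj (op (pullback s' (q m))) => r' • _) ?_
    exact (ringMap_comp (coindLift_fst hq t e) r).trans (ringMap_comp rfl r).symm
  T_id {n W W'} t {s s'} e e' b := by
    apply ofPush_injective
    rw [ofPush_res]
    exact (LaxLimit.tr_id _ rfl _ _).trans (Sec.res_congr R (coindLift_id hq rfl t e e') _ _)
  T_T {k l m} θ δ {W W' W''} t t' {s s' s''} e e' e'' b :=
    (LaxLimit.tr_tr _ _ _ _ _ _ _).trans
      (LaxLimit.tr_congr rfl (coindLift_comp hq t t' e e' e'') _ _)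

variable (R) in
/-- The direct image of lax sections. -/
def coind : LaxLimit (modDiagram R Y) ⥤ LaxLimit (modDiagram R X) where
  obj E := (coindData q hq E).toLaxLimit
  map {E E'} f := LaxLimit.homMk (E := (coindData q hq E).toLaxLimit)
    (E' := (coindData q hq E').toLaxLimit)
    (fun n => (SheafOfModules.overPullback.{u} R (q n)).map (LaxLimit.sheafHom f n))
    (fun {n m} θ {W} s b => by
      refine (congrArg _ (TrData.tr_toLaxLimit (coindData q hq E) _ _ _ _)).trans ?_
      refine Eq.trans ?_ (TrData.tr_toLaxLimit (coindData q hq E') _ _ _ _).symm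
      exact congrArg (toPush R (q m) _ s) (LaxLimit.map_tr f θ _ _ _))
  map_id E := LaxLimit.sheafHom_ext fun n =>
    (SheafOfModules.overPullback.{u} R (q n)).map_id (E.sheaf n)
  map_comp {E E' E''} f f' := LaxLimit.sheafHom_ext fun n =>
    (SheafOfModules.overPullback.{u} R (q n)).map_comp (LaxLimit.sheafHom f _)
      (LaxLimit.sheafHom f' _)

/-- The sections of the direct image of a lax section. -/
def ofCoind (E : LaxLimit (modDiagram R Y)) (s : W ⟶ X.obj (op n)) :
    Sec R (((coind R q hq).obj E).sheaf n) s →+ Sec R (E.sheaf n) (pullback.snd s (q n)) :=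
  ofPush R (q n) (E.sheaf n) s

/-- The sections of the direct image of a lax section. -/
def toCoind (E : LaxLimit (modDiagram R Y)) (s : W ⟶ X.obj (op n)) :
    Sec R (E.sheaf n) (pullback.snd s (q n)) →+ Sec R (((coind R q hq).obj E).sheaf n) s :=
  toPush R (q n) (E.sheaf n) s

variable {q hq} {E E' : LaxLimit (modDiagram R Y)}

lemma ofCoind_injective (s : W ⟶ X.obj (op n)) {x x' : Sec R (((coind R q hq).obj E).sheaf n) s}
    (h : ofCoind q hq E s x = ofCoind q hq E s x') : x = x' := h

lemma ofCoind_tr (θ : n ⟶ m) (t : W' ⟶ W)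
    {s : W ⟶ X.obj (op n)} {s' : W' ⟶ X.obj (op m)} (e : t ≫ s = s' ≫ X.map θ.op)
    (x : Sec R (((coind R q hq).obj E).sheaf n) s) :
    ofCoind q hq E s' (((coind R q hq).obj E).tr θ t e x) =
      E.tr θ (coindLift hq t e) (coindLift_snd hq t e) (ofCoind q hq E s x) :=
  TrData.tr_toLaxLimit (coindData q hq E) θ t e x

variable (q hq)

/-- The components of the unit. -/
def coindUnitApp (E : LaxLimit (modDiagram R X)) (n : SimplexCategory) :
    E.sheaf n ⟶ ((coind R q hq).obj ((reind R (𝟭 _) q hq).obj E)).sheaf n :=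
  pushUnit R (q n) (E.sheaf n)

variable {q hq} in
lemma map_coindUnitApp (E : LaxLimit (modDiagram R X)) (s : W ⟶ X.obj (op n))
    (x : Sec R (E.sheaf n) s) :
    ofReind (𝟭 _) q hq E _ (ofCoind q hq _ s (Sec.map R (coindUnitApp q hq E n) s x)) =
      Sec.res R (E.sheaf n) (pullback.fst s (q n)) pullback.condition x :=
  map_pushUnit (E.sheaf n) s x

/-- The components of the counit. -/
def coindCounitApp (E : LaxLimit (modDiagram R Y)) (n : SimplexCategory) :
    ((reind R (𝟭 _) q hq).obj ((coind R q hq).obj E)).sheaf n ⟶ E.sheaf n :=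
  pushCounit R (q n) (E.sheaf n)

variable {q hq} in
lemma map_coindCounitApp (E : LaxLimit (modDiagram R Y)) (s : W ⟶ Y.obj (op n))
    (x : Sec R (((reind R (𝟭 _) q hq).obj ((coind R q hq).obj E)).sheaf n) s) :
    Sec.map R (coindCounitApp q hq E n) s x =
      Sec.res R (E.sheaf n) (pullback.lift (𝟙 W) s (Category.id_comp _)) (pullback.lift_snd _ _ _)
        (ofCoind q hq E _ (ofReind (𝟭 _) q hq _ s x)) :=
  map_pushCounit (E.sheaf n) s x

variable {q hq} in
lemma sheafHom_comp_coindUnitApp {E E' : LaxLimit (modDiagram R X)} (f : E ⟶ E')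
    (n : SimplexCategory) : LaxLimit.sheafHom f n ≫ coindUnitApp q hq E' n =
      coindUnitApp q hq E n ≫
        LaxLimit.sheafHom ((coind R q hq).map ((reind R (𝟭 _) q hq).map f)) n :=
  (SheafOfModules.overMapPushforwardAdj R (q n)).unit.naturality (LaxLimit.sheafHom f n)

variable {q hq} in
lemma coindCounitApp_comp_sheafHom {E E' : LaxLimit (modDiagram R Y)} (f : E ⟶ E')
    (n : SimplexCategory) :
    LaxLimit.sheafHom ((reind R (𝟭 _) q hq).map ((coind R q hq).map f)) n ≫
        coindCounitApp q hq E' n = coindCounitApp q hq E n ≫ LaxLimit.sheafHom f n :=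
  (SheafOfModules.overMapPushforwardAdj R (q n)).counit.naturality (LaxLimit.sheafHom f n)

/-- The unit. -/
def coindUnit (E : LaxLimit (modDiagram R X)) :
    E ⟶ (coind R q hq).obj ((reind R (𝟭 _) q hq).obj E) :=
  LaxLimit.homMk (fun n => coindUnitApp q hq E n)
    (fun {n m} θ {W} s x => by
      apply ofCoind_injective
      apply ofReind_injective
      rw [map_coindUnitApp, ofCoind_tr, ofReind_tr, map_coindUnitApp, LaxLimit.res_tr]
      refine Eq.trans ?_ (LaxLimit.tr_res _ _ _ _ _ _).symm
      refine LaxLimit.tr_congr rfl ?_ _ _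
      rw [coindLift_fst])

/-- The counit. -/
def coindCounit (E : LaxLimit (modDiagram R Y)) :
    (reind R (𝟭 _) q hq).obj ((coind R q hq).obj E) ⟶ E :=
  LaxLimit.homMk (fun n => coindCounitApp q hq E n)
    (fun {n m} θ {W} s x => by
      rw [map_coindCounitApp, ofReind_tr, map_coindCounitApp]
      refine (congrArg (Sec.res R (E.sheaf m) _ _) (ofCoind_tr _ _ _ _)).trans ?_
      rw [LaxLimit.res_tr, LaxLimit.tr_res]
      refine LaxLimit.tr_congr rfl ?_ _ _
      refine Eq.trans ?_ (Category.id_comp _).symm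
      ext
      · rw [Category.assoc, coindLift_fst]
        refine (pullback.lift_fst_assoc _ _ _ _).trans ((Category.comp_id _).trans ?_)
        exact (pullback.lift_fst _ _ _).symm
      · rw [Category.assoc, coindLift_snd]
        refine (pullback.lift_snd_assoc _ _ _ _).trans ?_
        exact (pullback.lift_snd _ _ _).symm)

lemma coindUnit_naturality {E E' : LaxLimit (modDiagram R X)} (f : E ⟶ E') :
    f ≫ coindUnit q hq E' =
      coindUnit q hq E ≫ (coind R q hq).map ((reind R (𝟭 _) q hq).map f) :=
  LaxLimit.sheafHom_ext fun n => by
    rw [LaxLimit.sheafHom_comp, LaxLimit.sheafHom_comp]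
    exact sheafHom_comp_coindUnitApp f n

lemma coindCounit_naturality {E E' : LaxLimit (modDiagram R Y)} (f : E ⟶ E') :
    (reind R (𝟭 _) q hq).map ((coind R q hq).map f) ≫ coindCounit q hq E' =
      coindCounit q hq E ≫ f :=
  LaxLimit.sheafHom_ext fun n => by
    rw [LaxLimit.sheafHom_comp, LaxLimit.sheafHom_comp]
    exact coindCounitApp_comp_sheafHom f n

lemma coind_left_triangle (E : LaxLimit (modDiagram R X)) :
    (reind R (𝟭 _) q hq).map (coindUnit q hq E) ≫ coindCounit q hq _ = 𝟙 _ :=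
  LaxLimit.sheafHom_ext fun n =>
    (SheafOfModules.overMapPushforwardAdj R (q n)).left_triangle_components (E.sheaf n)

lemma coind_right_triangle (E : LaxLimit (modDiagram R Y)) :
    coindUnit q hq _ ≫ (coind R q hq).map (coindCounit q hq E) = 𝟙 _ :=
  LaxLimit.sheafHom_ext fun n =>
    (SheafOfModules.overMapPushforwardAdj R (q n)).right_triangle_components (E.sheaf n)

variable (R) in
/-- The adjunction between restriction and direct image of lax sections. -/
def coindAdj : reind R (𝟭 _) q hq ⊣ coind R q hq where
  unit :=
    { app := coindUnit q hq
      naturality _ _ f := coindUnit_naturality q hq f }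
  counit :=
    { app := coindCounit q hq
      naturality _ _ f := coindCounit_naturality q hq f }
  left_triangle_components E := coind_left_triangle q hq E
  right_triangle_components E := coind_right_triangle q hq E

end Coinduction

end LaxDescent

end

noncomputable section

namespace LaxDescent

/-! ### Base change -/

section Bijective

variable {C : Type u} [SmallCategory C] {J : GrothendieckTopology C} {R : Sheaf J RingCat.{u}}
  {Y : C} {M N : SheafOfModules.{u} (R.over Y)}

lemma Sec.isIso_of_bijective (f : M ⟶ N)
    (hf : ∀ {W : C} (s : W ⟶ Y), Function.Bijective (Sec.map R f s)) : IsIso f := by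
  let e {W : C} (s : W ⟶ Y) : Sec R M s ≃+ Sec R N s :=
    AddEquiv.ofBijective (Sec.map R f s).toAddMonoidHom (hf s)
  have he {W : C} (s : W ⟶ Y) (x : Sec R N s) : Sec.map R f s ((e s).symm x) = x :=
    (e s).apply_symm_apply x
  refine ⟨Sec.homMk R (fun s => (e s).symm.toAddMonoidHom) (fun s a x => ?_)
    (fun t s s' e x => ?_), Sec.hom_ext R fun s x => (e s).symm_apply_apply x,
    Sec.hom_ext R fun s x => he s x⟩
  · refine (hf s).1 ((he s _).trans ?_)
    rw [map_smul]
    exact congrArg (a • ·) (he s x).symm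
  · refine (hf s').1 ((he s' _).trans ?_)
    rw [Sec.map_res]
    exact congrArg (Sec.res R N t e) (he s x).symm

lemma Sec.bijective_res {W W' : C} (t : W' ⟶ W) [IsIso t] {s : W ⟶ Y} {s' : W' ⟶ Y}
    (e : t ≫ s = s') : Function.Bijective (Sec.res R M t e) := by
  have e' : inv t ≫ s' = s := by rw [← e, IsIso.inv_hom_id_assoc]
  refine Function.bijective_iff_has_inverse.2 ⟨Sec.res R M (inv t) e', fun x => ?_, fun x => ?_⟩
  · rw [Sec.res_res, Sec.res_id R (by simp)]
  · rw [Sec.res_res, Sec.res_id R (by simp)]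

end Bijective

/-! ### Comparison of restrictions and of direct images in a cartesian square of augmentations -/

section BaseChange

variable {C : Type u} [SmallCategory C] [HasPullbacks C] {J : GrothendieckTopology C}
  {R : Sheaf J RingCat.{u}} {X Y : SimplicialObject C} {U Z : C}
  (p : X ⟶ (SimplicialObject.const C).obj U) (p' : Y ⟶ (SimplicialObject.const C).obj Z)
  (φ : Z ⟶ U) (q : ∀ n : SimplexCategory, Y.obj (op n) ⟶ X.obj (op n))
  (hq : ∀ {n m : SimplexCategory} (θ : n ⟶ m), Y.map θ.op ≫ q n = q m ≫ X.map θ.op)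

section

variable {φ q} (hpq : ∀ n, q n ≫ augFamily X p n = augFamily Y p' n ≫ φ)

/-- The components of the comparison of the two restrictions. -/
def restrCompareApp (F : SheafOfModules.{u} (R.over U)) (n : SimplexCategory) :
    ((reind R (𝟭 _) q hq).obj ((restr R X p).obj F)).sheaf n ≅
      ((restr R Y p').obj ((SheafOfModules.overMap.{u} R φ).obj F)).sheaf n :=
  ((overMapCompIso R (rfl : q n ≫ augFamily X p n = _)).symm ≪≫ overMapCompIso R (hpq n)).app F

omit [HasPullbacks C] in
variable {p p' hq} in
lemma map_restrCompareApp (F : SheafOfModules.{u} (R.over U)) {n : SimplexCategory} {W : C}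
    (s : W ⟶ Y.obj (op n))
    (x : Sec R (((reind R (𝟭 _) q hq).obj ((restr R X p).obj F)).sheaf n) s) :
    Sec.ofOverMap R φ F _ (ofRestr p' _ s (Sec.map R (restrCompareApp p p' hq hpq F n).hom s x)) =
      Sec.res R F (𝟙 W) (by simp [hpq]) (ofRestr p F _ (ofReind (𝟭 _) q hq _ s x)) := by
  refine (congrArg (fun y => Sec.ofOverMap R φ F _ (ofRestr p' _ s y))
    (Sec.map_overMapCompIso_hom R (hpq n) F s _)).trans ?_
  refine (congrArg (fun y => Sec.res R F (𝟙 W) _ (Sec.ofOverMap R _ F s y))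
    (Sec.map_overMapCompIso_inv R (rfl : q n ≫ augFamily X p n = _) F s x)).trans ?_
  refine (Sec.res_res R _ _ _ _ (ofRestr p F _ (ofReind (𝟭 _) q hq _ s x))).trans ?_
  exact Sec.res_congr R (Category.comp_id _) _ _

omit [HasPullbacks C] in
lemma restrCompareApp_tr (F : SheafOfModules.{u} (R.over U)) {n m : SimplexCategory} (θ : n ⟶ m)
    {W : C} (s : W ⟶ Y.obj (op m))
    (x : Sec R (((reind R (𝟭 _) q hq).obj ((restr R X p).obj F)).sheaf n) (s ≫ Y.map θ.op)) :
    Sec.map R (restrCompareApp p p' hq hpq F m).hom s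
        (((reind R (𝟭 _) q hq).obj ((restr R X p).obj F)).tr θ (𝟙 W) (Category.id_comp _) x) =
      ((restr R Y p').obj ((SheafOfModules.overMap.{u} R φ).obj F)).tr θ (𝟙 W)
        (Category.id_comp _) (Sec.map R (restrCompareApp p p' hq hpq F n).hom _ x) := by
  apply ofRestr_injective
  refine (map_restrCompareApp hpq F s _).trans ?_
  rw [ofRestr_tr]
  refine Eq.trans ?_ (Sec.ofOverMap_res R φ _ _ _).symm
  rw [map_restrCompareApp, ofReind_tr]
  refine (congrArg (Sec.res R F (𝟙 W) _) (ofRestr_tr _ _ _ _)).trans ?_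
  rw [Sec.res_res, Sec.res_res]

/-- The comparison of the two restrictions. -/
def restrCompare : restr R X p ⋙ reind R (𝟭 _) q hq ≅
    SheafOfModules.overMap.{u} R φ ⋙ restr R Y p' :=
  NatIso.ofComponents (fun F =>
    have : IsIso (LaxLimit.homMk
        (E := (reind R (𝟭 _) q hq).obj ((restr R X p).obj F))
        (E' := (restr R Y p').obj ((SheafOfModules.overMap.{u} R φ).obj F))
        (fun n => (restrCompareApp p p' hq hpq F n).hom)
        (fun {_ _} θ {_} s x => restrCompareApp_tr p p' hq hpq F θ s x)) :=
      LaxLimit.isIso_of_app _ fun n =>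
        (inferInstance : IsIso (restrCompareApp p p' hq hpq F n).hom)
    asIso (LaxLimit.homMk
        (E := (reind R (𝟭 _) q hq).obj ((restr R X p).obj F))
        (E' := (restr R Y p').obj ((SheafOfModules.overMap.{u} R φ).obj F))
        (fun n => (restrCompareApp p p' hq hpq F n).hom)
        (fun {_ _} θ {_} s x => restrCompareApp_tr p p' hq hpq F θ s x)))
    (fun f => LaxLimit.sheafHom_ext fun n =>
      ((overMapCompIso R (rfl : q n ≫ augFamily X p n = _)).symm ≪≫
        overMapCompIso R (hpq n)).hom.naturality f)

end

variable {φ q} (hpb : ∀ n, IsPullback (q n) (augFamily Y p' n) (augFamily X p n) φ)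

variable {p p'} in
/-- The comparison of pullbacks. -/
def pushCompareLift {n : SimplexCategory} {W : C} (s : W ⟶ X.obj (op n)) :
    pullback s (q n) ⟶ pullback (s ≫ augFamily X p n) φ :=
  pullback.lift (pullback.fst s (q n)) (pullback.snd s (q n) ≫ augFamily Y p' n)
    (by rw [← Category.assoc, pullback.condition, Category.assoc, Category.assoc, (hpb n).w])

section

variable {p p'} {n : SimplexCategory} {W : C} (s : W ⟶ X.obj (op n))

lemma pushCompareLift_fst : pushCompareLift hpb s ≫ pullback.fst _ _ = pullback.fst _ _ :=
  pullback.lift_fst _ _ _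

lemma pushCompareLift_snd : pushCompareLift hpb s ≫ pullback.snd _ _ =
    pullback.snd s (q n) ≫ augFamily Y p' n :=
  pullback.lift_snd _ _ _

/-- Pasting of pullbacks: the square over `s` followed by the cartesian square of augmentations is
again cartesian. Hence direct image commutes with restriction to the simplicial object. -/
lemma isIso_pushCompareLift : IsIso (pushCompareLift hpb s) := by
  have h₁ := (IsPullback.of_hasPullback s (q n)).paste_vert (hpb n)
  have h₂ := IsPullback.of_hasPullback (s ≫ augFamily X p n) φ
  have : pushCompareLift hpb s = (h₁.isoIsPullback _ _ h₂).hom := by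
    ext
    · rw [pushCompareLift_fst]
      exact (h₁.isoIsPullback_hom_fst _ _ h₂).symm
    · rw [pushCompareLift_snd]
      exact (h₁.isoIsPullback_hom_snd _ _ h₂).symm
  rw [this]
  infer_instance

end

/-- The components of the comparison of direct images. -/
def pushCompareApp (G : SheafOfModules.{u} (R.over Z)) (n : SimplexCategory) :
    ((restr R X p).obj ((SheafOfModules.overPullback.{u} R φ).obj G)).sheaf n ⟶
      ((coind R q hq).obj ((restr R Y p').obj G)).sheaf n :=
  Sec.homMk R
    (fun {W} s => ((toCoind q hq _ s).comp (toRestr p' G _)).comp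
      ((Sec.res R G (pushCompareLift hpb s) (pushCompareLift_snd hpb s)).comp
        ((ofPush R φ G _).comp (ofRestr p _ s))))
    (fun {W} s a x => by
      apply ofCoind_injective
      apply ofRestr_injective
      refine (Sec.res_smul R (pushCompareLift hpb s) (pushCompareLift_snd hpb s)
        (R.obj.map (pullback.fst (s ≫ augFamily X p n) φ).op a)
        (ofPush R φ G _ (ofRestr p _ s x))).trans ?_
      exact congrArg (fun r : R.obj.obj (op (pullback s (q n))) => r • _)
        (ringMap_comp (pushCompareLift_fst hpb s) a))
    (fun {W W'} t {s s'} e x => by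
      apply ofCoind_injective
      apply ofRestr_injective
      have e' : t ≫ s ≫ augFamily X p n = s' ≫ augFamily X p n := by rw [← Category.assoc, e]
      refine (Sec.res_res R (pullbackLift t e') (pushCompareLift hpb s') (pullback.lift_snd _ _ _)
        (pushCompareLift_snd hpb s') (ofPush R φ G _ (ofRestr p _ s x))).trans ?_
      refine Eq.trans ?_ (Sec.res_res R (pushCompareLift hpb s) (pullbackLift t e)
        (pushCompareLift_snd hpb s) (pullback.lift_snd_assoc _ _ _ _)
        (ofPush R φ G _ (ofRestr p _ s x))).symm
      refine Sec.res_congr R ?_ _ _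
      ext
      · rw [Category.assoc, Category.assoc, pullback.lift_fst, pushCompareLift_fst,
          reassoc_of% @pushCompareLift_fst, pullback.lift_fst]
      · rw [Category.assoc, Category.assoc, pullback.lift_snd, pushCompareLift_snd,
          pushCompareLift_snd, pullback.lift_snd_assoc])

variable {p p' hq} in
lemma map_pushCompareApp (G : SheafOfModules.{u} (R.over Z)) {n : SimplexCategory} {W : C}
    (s : W ⟶ X.obj (op n))
    (x : Sec R (((restr R X p).obj ((SheafOfModules.overPullback.{u} R φ).obj G)).sheaf n) s) :
    ofRestr p' G _ (ofCoind q hq _ s (Sec.map R (pushCompareApp p p' hq hpb G n) s x)) =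
      Sec.res R G (pushCompareLift hpb s) (pushCompareLift_snd hpb s)
        (ofPush R φ G _ (ofRestr p _ s x)) := rfl

lemma pushCompareApp_tr (G : SheafOfModules.{u} (R.over Z)) {n m : SimplexCategory} (θ : n ⟶ m)
    {W : C} (s : W ⟶ X.obj (op m))
    (x : Sec R (((restr R X p).obj ((SheafOfModules.overPullback.{u} R φ).obj G)).sheaf n)
      (s ≫ X.map θ.op)) :
    Sec.map R (pushCompareApp p p' hq hpb G m) s
        (((restr R X p).obj ((SheafOfModules.overPullback.{u} R φ).obj G)).tr θ (𝟙 W)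
          (Category.id_comp _) x) =
      ((coind R q hq).obj ((restr R Y p').obj G)).tr θ (𝟙 W)
        (Category.id_comp _) (Sec.map R (pushCompareApp p p' hq hpb G n) _ x) := by
  apply ofCoind_injective
  apply ofRestr_injective
  rw [map_pushCompareApp, ofRestr_tr, ofPush_res, Sec.res_res, ofCoind_tr, ofRestr_tr,
    map_pushCompareApp, Sec.res_res]
  refine Sec.res_congr R ?_ _ _
  ext
  · refine (Category.assoc _ _ _).trans (Eq.trans ?_ (Category.assoc _ _ _).symm)
    rw [pullback.lift_fst, pushCompareLift_fst, reassoc_of% @pushCompareLift_fst, coindLift_fst]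
  · refine (Category.assoc _ _ _).trans (Eq.trans ?_ (Category.assoc _ _ _).symm)
    rw [pullback.lift_snd, pushCompareLift_snd, pushCompareLift_snd, reassoc_of% @coindLift_snd,
      map_comp_aug]

lemma isIso_pushCompareApp (G : SheafOfModules.{u} (R.over Z)) (n : SimplexCategory) :
    IsIso (pushCompareApp p p' hq hpb G n) :=
  Sec.isIso_of_bijective _ fun s =>
    have := isIso_pushCompareLift hpb s
    Sec.bijective_res (M := G) (pushCompareLift hpb s) (pushCompareLift_snd hpb s)

/-- The comparison of direct images. -/
def pushCompareHom (G : SheafOfModules.{u} (R.over Z)) :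
    (restr R X p).obj ((SheafOfModules.overPullback.{u} R φ).obj G) ⟶
      (coind R q hq).obj ((restr R Y p').obj G) :=
  LaxLimit.homMk (fun n => pushCompareApp p p' hq hpb G n)
    (fun {_ _} θ {_} s x => pushCompareApp_tr p p' hq hpb G θ s x)

lemma isIso_pushCompareHom (G : SheafOfModules.{u} (R.over Z)) :
    IsIso (pushCompareHom p p' hq hpb G) :=
  LaxLimit.isIso_of_app _ fun n => isIso_pushCompareApp p p' hq hpb G n

lemma pushCompareHom_naturality {G G' : SheafOfModules.{u} (R.over Z)} (f : G ⟶ G') :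
    (restr R X p).map ((SheafOfModules.overPullback.{u} R φ).map f) ≫
        pushCompareHom p p' hq hpb G' =
      pushCompareHom p p' hq hpb G ≫ (coind R q hq).map ((restr R Y p').map f) :=
  LaxLimit.sheafHom_ext fun n => by
    refine Sec.hom_ext R fun {W} s x => ?_
    exact (Sec.map_res R f (pushCompareLift hpb s) (pushCompareLift_snd hpb s)
      (ofPush R φ G _ (ofRestr p _ s x))).symm

/-- The comparison of direct images. -/
def pushCompare : SheafOfModules.overPullback.{u} R φ ⋙ restr R X p ≅
    restr R Y p' ⋙ coind R q hq :=
  NatIso.ofComponents (fun G =>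
    have := isIso_pushCompareHom p p' hq hpb G
    asIso (pushCompareHom p p' hq hpb G))
    (fun f => pushCompareHom_naturality p p' hq hpb f)

/-- On sections both sides are the restriction along the first projection of `pullback s (q n)`.
This links the comparison of direct images to the comparison of restrictions, so that base change
respects units. -/
lemma restr_map_pushUnit_comp_pushCompare (F : SheafOfModules.{u} (R.over U)) :
    (restr R X p).map (pushUnit R φ F) ≫ pushCompareHom p p' hq hpb _ =
      coindUnit q hq _ ≫
        (coind R q hq).map ((restrCompare p p' hq fun n => (hpb n).w).hom.app F) :=
  LaxLimit.sheafHom_ext fun n => by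
    refine Sec.hom_ext R fun {W} s x => ?_
    apply ofCoind_injective
    apply ofRestr_injective
    have h₁ := map_pushCompareApp hpb (hq := hq) ((SheafOfModules.overMap.{u} R φ).obj F) s
      (Sec.map R (LaxLimit.sheafHom ((restr R X p).map (pushUnit R φ F)) n) s x)
    have h₂ := ofRestr_map (p := p) (pushUnit R φ F) s x
    have h₃ := map_pushUnit (f := φ) F (s ≫ augFamily X p n) (ofRestr p F s x)
    have h₄ := map_coindUnitApp (hq := hq) ((restr R X p).obj F) s x
    have h₅ := map_restrCompareApp (fun n => (hpb n).w) F (pullback.snd s (q n))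
      (ofCoind q hq _ s (Sec.map R (coindUnitApp q hq ((restr R X p).obj F) n) s x))
    refine h₁.trans ((congrArg (fun y => Sec.res R _ _ _ (ofPush R φ _ _ y)) h₂).trans ?_)
    refine (congrArg (Sec.res R F (pushCompareLift hpb s)
      (by rw [← Category.assoc, pushCompareLift_snd]; exact rfl)) h₃).trans ?_
    refine Eq.trans ?_ h₅.symm
    refine Eq.trans ?_ (congrArg (fun y => Sec.res R F _ _ (ofRestr p F _ y)) h₄).symm
    refine Eq.trans ?_ (congrArg (Sec.res R F (𝟙 _) _) (ofRestr_res (p := p) (pullback.fst s (q n))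
      pullback.condition (toRestr p F s (ofRestr p F s x)))).symm
    refine (Sec.res_res R (pullback.fst (s ≫ augFamily X p n) φ) (pushCompareLift hpb s)
      _ _ (ofRestr p F s x)).trans (Eq.trans ?_ (Sec.res_res R (pullback.fst s (q n)) (𝟙 _)
      _ _ (ofRestr p F s x)).symm)
    refine Sec.res_congr R ?_ _ _
    rw [pushCompareLift_fst, Category.id_comp]

end BaseChange

end LaxDescent

end

noncomputable section

namespace LaxDescent

/-! ### Base change for the left adjoints, by conjugation -/

section BaseChangeLan

variable {C : Type u} [SmallCategory C] [HasPullbacks C] {J : GrothendieckTopology C}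
  {R : Sheaf J RingCat.{u}} {X Y : SimplicialObject C} {U Z : C}
  (p : X ⟶ (SimplicialObject.const C).obj U) (p' : Y ⟶ (SimplicialObject.const C).obj Z)
  {φ : Z ⟶ U} {q : ∀ n : SimplexCategory, Y.obj (op n) ⟶ X.obj (op n)}
  (hq : ∀ {n m : SimplexCategory} (θ : n ⟶ m), Y.map θ.op ≫ q n = q m ≫ X.map θ.op)
  (hpb : ∀ n, IsPullback (q n) (augFamily Y p' n) (augFamily X p n) φ)

/-- The base change isomorphism for the left adjoints of the restriction functors. -/
def lanBaseChange : reind R (𝟭 _) q hq ⋙ lan R Y p' ≅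
    lan R X p ⋙ SheafOfModules.overMap.{u} R φ :=
  (conjugateIsoEquiv ((lanAdj R X p).comp (SheafOfModules.overMapPushforwardAdj R φ))
    ((coindAdj R q hq).comp (lanAdj R Y p'))).symm (pushCompare p p' hq hpb)

/-- Up to the canonical isomorphisms, the unit over the pulled-back simplicial object is the
pullback of the unit. This is what allows the unit over the Čech nerve to be tested over the
décalage. -/
lemma unit_lanBaseChange (E : LaxLimit (modDiagram R X)) :
    (lanAdj R Y p').unit.app ((reind R (𝟭 _) q hq).obj E) ≫
        (restr R Y p').map ((lanBaseChange p p' hq hpb).hom.app E) =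
      (reind R (𝟭 _) q hq).map ((lanAdj R X p).unit.app E) ≫
        (restrCompare p p' hq fun n => (hpb n).w).hom.app ((lan R X p).obj E) := by
  -- The base change isomorphism is defined as the conjugate of the comparison of direct images, so
  -- the identity is checked after transposing along pullback and direct image.
  apply ((coindAdj R q hq).homEquiv _ _).injective
  rw [Adjunction.homEquiv_unit, Adjunction.homEquiv_unit]
  have h := unit_conjugateEquiv ((lanAdj R X p).comp (SheafOfModules.overMapPushforwardAdj R φ))
    ((coindAdj R q hq).comp (lanAdj R Y p')) (lanBaseChange p p' hq hpb).hom E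
  have h' : conjugateEquiv ((lanAdj R X p).comp (SheafOfModules.overMapPushforwardAdj R φ))
    ((coindAdj R q hq).comp (lanAdj R Y p')) (lanBaseChange p p' hq hpb).hom =
      (pushCompare p p' hq hpb).hom := (conjugateEquiv _ _).apply_symm_apply _
  rw [h'] at h
  rw [Adjunction.comp_unit_app, Adjunction.comp_unit_app] at h
  have h₁ := restr_map_pushUnit_comp_pushCompare p p' hq hpb ((lan R X p).obj E)
  have h₂ := coindUnit_naturality q hq ((lanAdj R X p).unit.app E)
  rw [Functor.map_comp, Functor.map_comp]
  refine ((Category.assoc _ _ _).symm.trans (h.symm.trans ?_))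
  refine ((Category.assoc _ _ _).trans (congrArg (_ ≫ ·) h₁)).trans ?_
  refine ((Category.assoc _ _ _).symm.trans (congrArg (· ≫ _) h₂)).trans ?_
  exact Category.assoc _ _ _

/-- Restriction of families of sheaves of modules along `q`. -/
def piPull (q : ∀ n : SimplexCategory, Y.obj (op n) ⟶ X.obj (op n)) :
    (∀ n, (modDiagram R X).obj n) ⥤ (∀ n, (modDiagram R Y).obj n) where
  obj x n := (SheafOfModules.overMap.{u} R (q n)).obj (x n)
  map f n := (SheafOfModules.overMap.{u} R (q n)).map (f n)
  map_id _ := funext fun n => (SheafOfModules.overMap.{u} R (q n)).map_id _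
  map_comp _ _ := funext fun n => (SheafOfModules.overMap.{u} R (q n)).map_comp _ _

/-- Direct image of families of sheaves of modules along `q`. -/
def piPush (q : ∀ n : SimplexCategory, Y.obj (op n) ⟶ X.obj (op n)) :
    (∀ n, (modDiagram R Y).obj n) ⥤ (∀ n, (modDiagram R X).obj n) where
  obj x n := (SheafOfModules.overPullback.{u} R (q n)).obj (x n)
  map f n := (SheafOfModules.overPullback.{u} R (q n)).map (f n)
  map_id _ := funext fun n => (SheafOfModules.overPullback.{u} R (q n)).map_id _
  map_comp _ _ := funext fun n => (SheafOfModules.overPullback.{u} R (q n)).map_comp _ _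

/-- The adjunction between restriction and direct image for families. -/
def piAdj (q : ∀ n : SimplexCategory, Y.obj (op n) ⟶ X.obj (op n)) :
    piPull (R := R) q ⊣ piPush q where
  unit :=
    { app x n := (SheafOfModules.overMapPushforwardAdj R (q n)).unit.app (x n)
      naturality _ _ f := funext fun n =>
        (SheafOfModules.overMapPushforwardAdj R (q n)).unit.naturality (f n) }
  counit :=
    { app x n := (SheafOfModules.overMapPushforwardAdj R (q n)).counit.app (x n)
      naturality _ _ f := funext fun n =>
        (SheafOfModules.overMapPushforwardAdj R (q n)).counit.naturality (f n) }
  left_triangle_components x := funext fun n =>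
    (SheafOfModules.overMapPushforwardAdj R (q n)).left_triangle_components (x n)
  right_triangle_components x := funext fun n =>
    (SheafOfModules.overMapPushforwardAdj R (q n)).right_triangle_components (x n)

/-- Free lax sections are compatible with restriction. -/
def freeReindIso : free (modDiagram R X) ⋙ reind R (𝟭 _) q hq ≅
    piPull q ⋙ free (modDiagram R Y) :=
  Adjunction.leftAdjointUniq ((freeAdj (modDiagram R X)).comp (coindAdj R q hq))
    (((piAdj q).comp (freeAdj (modDiagram R Y))).ofNatIsoRight (Iso.refl _))

/-- Forgetting structure maps commutes with direct images, hence, passing to left adjoints, free lax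
sections pull back to free ones. A relatively projective object is a retract of a free one, so the
property pulls back as well. -/
lemma relProj_reind {E : LaxLimit (modDiagram R X)} (hE : RelProj (freeε (modDiagram R X)) E) :
    RelProj (freeε (modDiagram R Y)) ((reind R (𝟭 _) q hq).obj E) := by
  obtain ⟨s, hs⟩ := hE
  let e := (freeReindIso (R := R) hq).app ((evPi (modDiagram R X)).obj E)
  refine RelProj.of_retract (relProj_free ((piPull q).obj ((evPi (modDiagram R X)).obj E)))
    ((reind R (𝟭 _) q hq).map s ≫ e.hom)
    (e.inv ≫ (reind R (𝟭 _) q hq).map ((freeε (modDiagram R X)).app E)) ?_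
  rw [Category.assoc]
  refine (congrArg (_ ≫ ·) (e.hom_inv_id_assoc _)).trans ?_
  refine ((reind R (𝟭 _) q hq).map_comp _ _).symm.trans ?_
  exact (congrArg _ hs).trans ((reind R (𝟭 _) q hq).map_id E)

end BaseChangeLan

end LaxDescent

end

noncomputable section

namespace LaxDescent

/-! ### The Čech nerve and its décalage -/

section CechNerve

variable {C : Type u} [SmallCategory C] [HasPullbacks C] {U V : C} (φ : V ⟶ U)

instance (n : ℕ) : HasWidePullback U (fun _ : Fin (n + 1) => V) fun _ => φ :=
  hasWidePullback_of_hasPullbacks (Arrow.mk φ) n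

/-- The projections from the terms of the Čech nerve. -/
def cechπ (n : SimplexCategory) (i : Fin (n.len + 1)) : (cech φ).obj (op n) ⟶ V :=
  WidePullback.π (fun _ : Fin (n.len + 1) => φ) i

lemma cechπ_comp (n : SimplexCategory) (i : Fin (n.len + 1)) :
    cechπ φ n i ≫ φ = augFamily (cech φ) (cechAug φ) n :=
  WidePullback.π_arrow (fun _ : Fin (n.len + 1) => φ) i

lemma cech_map_π {n m : SimplexCategory} (θ : n ⟶ m) (i : Fin (n.len + 1)) :
    (cech φ).map θ.op ≫ cechπ φ n i = cechπ φ m (θ.toOrderHom i) :=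
  WidePullback.lift_π (arrows := fun _ : Fin (n.len + 1) => φ) _ _ _ i

lemma cech_hom_ext {n : SimplexCategory} {W : C} {f g : W ⟶ (cech φ).obj (op n)}
    (h : ∀ i, f ≫ cechπ φ n i = g ≫ cechπ φ n i) : f = g := by
  refine WidePullback.hom_ext (fun _ : Fin (n.len + 1) => φ) f g h ?_
  have e (k : W ⟶ (cech φ).obj (op n)) : k ≫ augFamily (cech φ) (cechAug φ) n =
      (k ≫ cechπ φ n 0) ≫ φ := by
    rw [Category.assoc, cechπ_comp]
  exact (e f).trans ((congrArg (· ≫ φ) (h 0)).trans (e g).symm)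

/-- Construction of morphisms to the terms of the Čech nerve. -/
def cechLift {n : SimplexCategory} {W : C} (a : W ⟶ U) (f : Fin (n.len + 1) → (W ⟶ V))
    (h : ∀ i, f i ≫ φ = a) : W ⟶ (cech φ).obj (op n) :=
  WidePullback.lift (arrows := fun _ : Fin (n.len + 1) => φ) a f h

lemma cechLift_π {n : SimplexCategory} {W : C} (a : W ⟶ U) (f : Fin (n.len + 1) → (W ⟶ V))
    (h : ∀ i, f i ≫ φ = a) (i : Fin (n.len + 1)) : cechLift φ a f h ≫ cechπ φ n i = f i :=
  WidePullback.lift_π (arrows := fun _ : Fin (n.len + 1) => φ) a f h i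

/-- A tuple of `n + 2` points of `V` over one point of `U` is its first entry together with the
remaining `n + 1`. -/
lemma isPullback_decProj (n : SimplexCategory) :
    IsPullback (decProj (cech φ) n) (augFamily (dec (cech φ)) (decAug (cech φ)) n)
      (augFamily (cech φ) (cechAug φ) n)
      (augFamily (cech φ) (cechAug φ) (SimplexCategory.mk 0)) := by
  have w₁ (i : Fin (n.len + 1)) : decProj (cech φ) n ≫ cechπ φ n i =
      cechπ φ (shift.obj n) i.succ := cech_map_π φ (shiftδ n) i
  have w₂ (i : Fin ((SimplexCategory.mk 0).len + 1)) :
      augFamily (dec (cech φ)) (decAug (cech φ)) n ≫ cechπ φ (SimplexCategory.mk 0) i =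
        cechπ φ (shift.obj n) 0 := cech_map_π φ (shiftv n) i
  refine ⟨⟨?_⟩, ⟨PullbackCone.IsLimit.mk _ (fun s => cechLift φ (n := shift.obj n)
    (s.fst ≫ augFamily (cech φ) (cechAug φ) n)
    (Fin.cases (s.snd ≫ cechπ φ _ 0) fun i => s.fst ≫ cechπ φ n i) ?_)
    (fun s => ?_) (fun s => ?_) (fun s m h₁ h₂ => ?_)⟩⟩
  · rw [← cechπ_comp φ n 0, ← Category.assoc, w₁, ← cechπ_comp φ (SimplexCategory.mk 0) 0,
      ← Category.assoc, w₂]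
    exact (cechπ_comp φ (shift.obj n) _).trans (cechπ_comp φ (shift.obj n) _).symm
  · refine Fin.cases ?_ fun i => ?_
    · exact (Category.assoc _ _ _).trans ((congrArg (s.snd ≫ ·) (cechπ_comp φ _ 0)).trans
        s.condition.symm)
    · exact (Category.assoc _ _ _).trans (congrArg (s.fst ≫ ·) (cechπ_comp φ n i))
  · refine cech_hom_ext φ fun i => ?_
    refine (Category.assoc _ _ _).trans ((congrArg (_ ≫ ·) (w₁ i)).trans ?_)
    exact cechLift_π φ _ _ _ i.succ
  · refine cech_hom_ext φ fun i => ?_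
    obtain rfl : i = 0 := Subsingleton.elim (α := Fin 1) _ _
    refine (Category.assoc _ _ _).trans ((congrArg (_ ≫ ·) (w₂ 0)).trans ?_)
    exact cechLift_π φ _ _ _ 0
  · refine cech_hom_ext φ fun i => Eq.trans ?_ (cechLift_π φ _ _ _ i).symm
    induction i using Fin.cases with
    | zero =>
      refine (congrArg (m ≫ ·) (w₂ 0).symm).trans ((Category.assoc _ _ _).symm.trans ?_)
      exact congrArg (· ≫ _) h₂
    | succ i =>
      refine (congrArg (m ≫ ·) (w₁ i).symm).trans ((Category.assoc _ _ _).symm.trans ?_)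
      exact congrArg (· ≫ _) h₁

variable {J : GrothendieckTopology C}

/-- The lowest term of the Čech nerve is a one-fold fibre product, isomorphic but not equal to `V`.
It is enough that `φ` factors through its augmentation. -/
lemma generate_aug_mem (hφ : Sieve.generate (Presieve.singleton φ) ∈ J U) :
    Sieve.generate (Presieve.singleton
      (augFamily (cech φ) (cechAug φ) (SimplexCategory.mk 0))) ∈ J U := by
  refine J.superset_covering ?_ hφ
  rw [Sieve.generate_le_iff]
  rintro _ _ ⟨⟩
  refine ⟨_, cechLift φ φ (fun _ => 𝟙 V) fun _ => Category.id_comp _, _,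
    Presieve.singleton_self _, ?_⟩
  rw [← cechπ_comp φ _ 0, reassoc_of% @cechLift_π, Category.id_comp]

end CechNerve

/-! ### Detecting quasi-isomorphisms along a covering morphism -/

section Covering

variable {C : Type u} [SmallCategory C] {J : GrothendieckTopology C}
  {R : Sheaf J RingCat.{u}} {Y Z : C}

lemma generate_singleton_pullback_mem {Y' Z' : C} {f : Z ⟶ Y} {g : Z' ⟶ Y'} {a : Z' ⟶ Z}
    {b : Y' ⟶ Y} (h : IsPullback a g f b)
    (hf : Sieve.generate (Presieve.singleton f) ∈ J Y) :
    Sieve.generate (Presieve.singleton g) ∈ J Y' := by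
  refine J.superset_covering ?_ (J.pullback_stable b hf)
  rintro W t ⟨_, s, _, ⟨⟩, e⟩
  exact ⟨_, h.lift s t e, _, Presieve.singleton_self _, h.lift_snd s t e⟩

lemma Sec.ext_of_cover (M : SheafOfModules.{u} (R.over Y)) {W : C} (s : W ⟶ Y) (S : Sieve W)
    (hS : S ∈ J W) {x y : Sec R M s}
    (h : ∀ {W' : C} (t : W' ⟶ W), S t → Sec.res R M t rfl x = Sec.res R M t rfl y) : x = y := by
  refine Presheaf.IsSheaf.isSeparated M.isSheaf (Over.mk s) ((Sieve.overEquiv (Over.mk s)).symm S)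
    (J.overEquiv_symm_mem_over _ _ hS) x y ?_
  intro W' t ht
  have e := h t.left ((Sieve.overEquiv_symm_iff _ _).1 ht)
  have e' := congrArg (Sec.res R M (𝟙 W'.left) (s' := W'.hom)
    ((Category.id_comp _).trans (Over.w t))) e
  rw [Sec.res_res, Sec.res_res, Sec.res_congr R (Category.id_comp _),
    Sec.res_congr R (Category.id_comp _)] at e'
  exact e'

variable (R) in
-- Separatedness: on the pullback of the covering sieve along `s`, each restriction of a section
-- factors through `f`, where the two morphisms agree by hypothesis.
lemma faithful_overMap (f : Z ⟶ Y) (hf : Sieve.generate (Presieve.singleton f) ∈ J Y) :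
    (SheafOfModules.overMap.{u} R f).Faithful where
  map_injective {M N a b} h := by
    refine Sec.hom_ext R fun {W} s x => ?_
    refine Sec.ext_of_cover N s _ (J.pullback_stable s hf) fun {W'} t => ?_
    rintro ⟨_, g, _, ⟨⟩, e⟩
    have h' := congrArg (fun k => Sec.res R N (𝟙 W') ((Category.id_comp _).trans e)
      (Sec.ofOverMap R f N g (Sec.map R k g (Sec.toOverMap R f M g
        (Sec.res R M t e.symm x))))) h
    rw [Sec.ofOverMap_map, Sec.ofOverMap_map, Sec.of_toOverMap, Sec.map_res, Sec.map_res,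
      Sec.res_res, Sec.res_res, Sec.res_congr R (Category.id_comp _),
      Sec.res_congr R (Category.id_comp _)] at h'
    exact h'

variable (R) in
-- An exact faithful functor between abelian categories reflects isomorphisms on homology.
lemma quasiIso_of_onChain_overMap [HasPullbacks C] (f : Z ⟶ Y)
    (hf : Sieve.generate (Presieve.singleton f) ∈ J Y)
    {K L : ChainComplex (SheafOfModules.{u} (R.over Y)) ℕ} (g : K ⟶ L)
    (hg : QuasiIso ((onChain (SheafOfModules.overMap.{u} R f)).map g)) : QuasiIso g := by
  have := faithful_overMap R f hf
  exact (HomologicalComplex.quasiIso_map_iff_of_preservesHomology g (SheafOfModules.overMap.{u} R f)).1 hg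

/-- Each projection `decProj` is a base change of the covering augmentation in lowest degree, hence
itself generates a covering sieve. -/
lemma quasiIso_of_onChain_projPull [HasPullbacks C] {U V : C} {φ : V ⟶ U}
    (hφ : Sieve.generate (Presieve.singleton φ) ∈ J U)
    {K L : ChainComplex (LaxLimit (modDiagram R (cech φ))) ℕ} (g : K ⟶ L)
    (hg : QuasiIso ((onChain (projPull R (cech φ))).map g)) : QuasiIso g := by
  rw [LaxLimit.quasiIso_iff_ev]
  intro n
  refine quasiIso_of_onChain_overMap R (decProj (cech φ) n) (generate_singleton_pullback_mem
    (isPullback_decProj φ n).flip (generate_aug_mem φ hφ)) _ ?_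
  exact quasiIso_onChain_ev ((onChain (projPull R (cech φ))).map g) n

end Covering

end LaxDescent

end

noncomputable section

namespace LaxDescent

/-! ### The derived unit of the restriction to the Čech nerve -/

section Localization

variable {𝓒 𝓓 : Type*} [Category* 𝓒] [Category* 𝓓]
  {W : MorphismProperty 𝓒} {W' : MorphismProperty 𝓓}

variable {l : 𝓒 ⥤ 𝓓} {r : 𝓓 ⥤ 𝓒} (adj : l ⊣ r)
  (hr : ∀ ⦃X Y : 𝓓⦄ (f : X ⟶ Y), W' f → W (r.map f))
  {B : 𝓒 ⥤ 𝓒} (π : B ⟶ 𝟭 𝓒) (hπ : ∀ X, W (π.app X))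
  (hB : ∀ ⦃X Y : 𝓒⦄ (f : X ⟶ Y), W f → W' (l.map (B.map f)))
  (hl : ∀ X, W' (l.map (π.app (B.obj X))))

include hπ hB hl in
-- For a fully faithful right adjoint the unit is invertible on the essential image. The derived
-- unit is the honest unit at `B X` up to the invertible `π`.
lemma isIso_Q_map_unit_of_iso [(locMap r hr).Full] [(locMap r hr).Faithful] (X : 𝓒)
    (F : W'.Localization) (e : W.Q.obj X ≅ (locMap r hr).obj F) :
    IsIso (W.Q.map (adj.unit.app (B.obj X))) := by
  have h := Adjunction.isIso_unit_app_of_iso (derivedAdj adj hr π hπ hB hl) e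
  rw [derivedAdj_unit_app] at h
  rw [← Q_map_π_derivedUnitApp adj π hπ X]
  exact IsIso.comp_isIso' (W.Q_inverts _ (hπ X)) h

end Localization

/-! ### Adjunctions on complexes, and saturation of the class of quasi-isomorphisms -/

section Derived

variable {A B : Type*} [Category* A] [Category* B]

section

variable [Preadditive A] [Preadditive B] {F : A ⥤ B} {G : B ⥤ A} [F.Additive] [G.Additive]

/-- The adjunction on complexes induced by an adjunction. -/
def chainAdj (adj : F ⊣ G) : onChain F ⊣ onChain G where
  unit :=
    { app K :=
        { f n := adj.unit.app (K.X n)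
          comm' i j _ := (adj.unit.naturality (K.d i j)).symm }
      naturality _ _ f := HomologicalComplex.Hom.ext (funext fun n => adj.unit.naturality (f.f n)) }
  counit :=
    { app K :=
        { f n := adj.counit.app (K.X n)
          comm' i j _ := (adj.counit.naturality (K.d i j)).symm }
      naturality _ _ f :=
        HomologicalComplex.Hom.ext (funext fun n => adj.counit.naturality (f.f n)) }
  left_triangle_components K :=
    HomologicalComplex.Hom.ext (funext fun n => adj.left_triangle_components (K.X n))
  right_triangle_components K :=
    HomologicalComplex.Hom.ext (funext fun n => adj.right_triangle_components (K.X n))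

end

/-- Homology factors through the localization, so a morphism that becomes invertible there is
invertible on homology. -/
lemma quasiIso_of_isIso_Q_map [Abelian A] {K L : ChainComplex A ℕ} (f : K ⟶ L)
    (h : IsIso ((DPlus.Q A).map f)) : QuasiIso f := by
  rw [quasiIso_iff]
  intro n
  rw [quasiIsoAt_iff_isIso_homologyMap]
  let H := Localization.Construction.lift (W := HomologicalComplex.quasiIso A (ComplexShape.down ℕ))
    (HomologicalComplex.homologyFunctor A (ComplexShape.down ℕ) n)
    (HomologicalComplex.homologyFunctor_inverts_quasiIso A _ n)
  have e := lift_map_Q_map (W := HomologicalComplex.quasiIso A (ComplexShape.down ℕ))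
    (HomologicalComplex.homologyFunctor A (ComplexShape.down ℕ) n)
    (HomologicalComplex.homologyFunctor_inverts_quasiIso A _ n) f
  have h' : IsIso (H.map ((DPlus.Q A).map f)) := inferInstance
  rw [e] at h'
  exact h'

end Derived

/-! ### The derived unit through relatively projective resolutions -/

section DerivedUnit

variable {C : Type u} [SmallCategory C] [HasPullbacks C] {J : GrothendieckTopology C}
  (R : Sheaf J RingCat.{u}) (X : SimplicialObject C) {U : C}
  (p : X ⟶ (SimplicialObject.const C).obj U)

/-- The relatively projective resolution of complexes of lax sections. -/
abbrev laxResolution : ChainComplex (LaxLimit (modDiagram R X)) ℕ ⥤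
    ChainComplex (LaxLimit (modDiagram R X)) ℕ :=
  functorialResolution (freeG (modDiagram R X)) (freeε (modDiagram R X))

/-- The augmentation of the relatively projective resolution. -/
abbrev laxResolutionπ : laxResolution R X ⟶ 𝟭 _ :=
  functorialResolutionπ (freeG (modDiagram R X)) (freeε (modDiagram R X))

instance (E : ChainComplex (LaxLimit (modDiagram R X)) ℕ) :
    QuasiIso ((laxResolutionπ R X).app E) :=
  quasiIso_functorialResolutionπ _ _ (fun E => inferInstanceAs (Epi ((freeAdj _).counit.app E))) E

lemma relProj_laxResolution (E : ChainComplex (LaxLimit (modDiagram R X)) ℕ) (n : ℕ) :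
    RelProj (freeε (modDiagram R X)) (((laxResolution R X).obj E).X n) := by
  obtain ⟨Q, hQ⟩ := functorialResolution_obj_X (freeG (modDiagram R X)) (freeε (modDiagram R X)) E n
  rw [hQ]
  exact relProj_free _

variable {R X} in
lemma quasiIso_laxResolution_map {E E' : ChainComplex (LaxLimit (modDiagram R X)) ℕ} (f : E ⟶ E')
    [QuasiIso f] : QuasiIso ((laxResolution R X).map f) := by
  have : QuasiIso ((laxResolution R X).map f ≫ (laxResolutionπ R X).app E') := by
    rw [(laxResolutionπ R X).naturality f]
    exact inferInstanceAs (QuasiIso (_ ≫ f))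
  exact quasiIso_of_comp_right _ ((laxResolutionπ R X).app E')

/-- The unit of the adjunction between restriction and its left adjoint on complexes. -/
abbrev lanUnit (E : ChainComplex (LaxLimit (modDiagram R X)) ℕ) :
    E ⟶ (onChain (restr R X p)).obj ((onChain (lan R X p)).obj E) :=
  (chainAdj (lanAdj R X p)).unit.app E

variable {R X} in
lemma quasiIso_onChain_lan_map {E E' : ChainComplex (LaxLimit (modDiagram R X)) ℕ} (f : E ⟶ E')
    [QuasiIso f] (hE : ∀ n, RelProj (freeε (modDiagram R X)) (E.X n))
    (hE' : ∀ n, RelProj (freeε (modDiagram R X)) (E'.X n)) :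
    QuasiIso ((onChain (lan R X p)).map f) := quasiIso_lan_map R X p f hE hE'

variable {R X} in
-- For relatively projective terms no further resolution is needed: `lan` keeps the augmentation of
-- the resolution of `E` a quasi-isomorphism, so the unit at `E` and the unit at its resolution are
-- related by quasi-isomorphisms. Naturality and two-out-of-three conclude.
lemma quasiIso_lanUnit_of_iso [(restrLoc (R := R) p).Full] [(restrLoc (R := R) p).Faithful]
    (E : ChainComplex (LaxLimit (modDiagram R X)) ℕ)
    (hE : ∀ n, RelProj (freeε (modDiagram R X)) (E.X n))
    (F : DPlus (SheafOfModules.{u} (R.over U))) (e : (DPlus.Q _).obj E ≅ (restrLoc p).obj F) :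
    QuasiIso (lanUnit R X p E) := by
  have h := isIso_Q_map_unit_of_iso (W := HomologicalComplex.quasiIso _ _)
    (W' := HomologicalComplex.quasiIso _ _) (chainAdj (lanAdj R X p))
    (fun _ _ f (_ : QuasiIso f) => quasiIso_onChain_restr p f) (laxResolutionπ R X)
    (fun E => (inferInstance : QuasiIso ((laxResolutionπ R X).app E)))
    (fun _ _ f (_ : QuasiIso f) =>
      have := quasiIso_laxResolution_map f
      quasiIso_onChain_lan_map p ((laxResolution R X).map f) (relProj_laxResolution R X _)
        (relProj_laxResolution R X _))
    (fun E => quasiIso_onChain_lan_map p ((laxResolutionπ R X).app ((laxResolution R X).obj E))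
      (relProj_laxResolution R X _) (relProj_laxResolution R X _)) E F e
  have h₃ := quasiIso_of_isIso_Q_map _ h
  have h₄ := quasiIso_onChain_lan_map p ((laxResolutionπ R X).app E)
    (relProj_laxResolution R X _) hE
  have h₅ := quasiIso_onChain_restr p ((onChain (lan R X p)).map ((laxResolutionπ R X).app E))
  have h₆ : QuasiIso ((laxResolutionπ R X).app E ≫ lanUnit R X p E) := by
    have := (chainAdj (lanAdj R X p)).unit.naturality ((laxResolutionπ R X).app E)
    refine this ▸ ?_
    exact quasiIso_comp (lanUnit R X p ((laxResolution R X).obj E))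
      ((onChain (restr R X p)).map ((onChain (lan R X p)).map ((laxResolutionπ R X).app E)))
  exact quasiIso_of_comp_left ((laxResolutionπ R X).app E) _

end DerivedUnit

end LaxDescent

end

noncomputable section

namespace LaxDescent

/-! ### Complexes of lax sections over the Čech nerve -/

section CechUnit

variable {C : Type u} [SmallCategory C] [HasPullbacks C] {J : GrothendieckTopology C}
  {R : Sheaf J RingCat.{u}} {X : SimplicialObject C} {U V : C}

instance : (decLax R X).Additive where
  map_add {E E' f g} := by
    refine LaxLimit.hom_ext fun n => ?_
    exact Functor.map_add (F := SheafOfModules.overMap.{u} R (𝟙 ((dec X).obj (op n))))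
      (f := f.app (shift.obj n)) (g := g.app (shift.obj n))

lemma quasiIso_projPullToDec (E : ChainComplex (LaxLimit (modDiagram R X)) ℕ)
    (hE : ∀ {n m : SimplexCategory} (θ : n ⟶ m), QuasiIso (strChain E θ)) :
    QuasiIso ((onChainTrans (projPullToDec R X)).app E) :=
  quasiIso_reindTrans (τ := shiftδNatTrans) (hg := decProj_naturality X) (hh := dec_map_comp_id X)
    E fun n => hE (shiftδ n)

lemma quasiIso_vertexToDec (E : ChainComplex (LaxLimit (modDiagram R X)) ℕ)
    (hE : ∀ {n m : SimplexCategory} (θ : n ⟶ m), QuasiIso (strChain E θ)) :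
    QuasiIso ((onChainTrans (vertexToDec R X)).app E) :=
  quasiIso_restrToReind (hg := dec_map_comp_id X) (v := shiftv) (hv := shiftv_naturality)
    E fun n => hE (shiftv n)

/-- For a complex of lax sections whose structure maps are quasi-isomorphisms, the restriction
to the décalage comes from the derived category of the vertices. -/
def projPullIso (E : ChainComplex (LaxLimit (modDiagram R X)) ℕ)
    (hE : ∀ {n m : SimplexCategory} (θ : n ⟶ m), QuasiIso (strChain E θ)) :
    (DPlus.Q _).obj ((onChain (projPull R X)).obj E) ≅
      (restrLoc (decAug X)).obj ((DPlus.Q _).obj ((onChain (lowest R X)).obj E)) :=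
  Localization.Construction.wIso (W := HomologicalComplex.quasiIso _ _)
      ((onChainTrans (projPullToDec R X)).app E) (quasiIso_projPullToDec E hE) ≪≫
    (Localization.Construction.wIso (W := HomologicalComplex.quasiIso _ _)
      ((onChainTrans (vertexToDec R X)).app E) (quasiIso_vertexToDec E hE)).symm

/-- The pulled-back resolution keeps relatively projective terms, and in the derived category it is
the pullback of `E`, which `projPullIso` places in the essential image of the fully faithful
restriction from the vertices. -/
lemma quasiIso_lanUnit_dec (E : ChainComplex (LaxLimit (modDiagram R X)) ℕ)
    (hE : ∀ {n m : SimplexCategory} (θ : n ⟶ m), QuasiIso (strChain E θ)) :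
    QuasiIso (lanUnit R (dec X) (decAug X) ((onChain (projPull R X)).obj
      ((laxResolution R X).obj E))) := by
  have h := quasiIso_onChain_reind (a := 𝟭 _) (g := decProj X) (hg := decProj_naturality X)
    ((laxResolutionπ R X).app E)
  refine quasiIso_lanUnit_of_iso (decAug X) _
    (fun n => relProj_reind (decProj_naturality X) (relProj_laxResolution R X E n)) _
    (Localization.Construction.wIso (W := HomologicalComplex.quasiIso _ _) _ h ≪≫
      projPullIso E hE)

lemma unit_lanBaseChange_chain {Y : SimplicialObject C} {Z : C}
    (p : X ⟶ (SimplicialObject.const C).obj U) (p' : Y ⟶ (SimplicialObject.const C).obj Z)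
    {φ : Z ⟶ U} {q : ∀ n : SimplexCategory, Y.obj (op n) ⟶ X.obj (op n)}
    (hq : ∀ {n m : SimplexCategory} (θ : n ⟶ m), Y.map θ.op ≫ q n = q m ≫ X.map θ.op)
    (hpb : ∀ n, IsPullback (q n) (augFamily Y p' n) (augFamily X p n) φ)
    (E : ChainComplex (LaxLimit (modDiagram R X)) ℕ) :
    lanUnit R Y p' ((onChain (reind R (𝟭 _) q hq)).obj E) ≫ (onChain (restr R Y p')).map
        ((onChainTrans (lanBaseChange p p' hq hpb).hom).app E) =
      (onChain (reind R (𝟭 _) q hq)).map (lanUnit R X p E) ≫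
        (onChainTrans (restrCompare p p' hq fun n => (hpb n).w).hom).app
          ((onChain (lan R X p)).obj E) :=
  HomologicalComplex.Hom.ext (funext fun k => unit_lanBaseChange p p' hq hpb (E.X k))

/-- Pull back to the décalage, where quasi-isomorphisms are detected. By base change the pulled-back
unit is, up to isomorphisms, the unit treated in `quasiIso_lanUnit_dec`. -/
lemma quasiIso_lanUnit_cech {φ : V ⟶ U} (hφ : Sieve.generate (Presieve.singleton φ) ∈ J U)
    (E : ChainComplex (LaxLimit (Ω R φ)) ℕ)
    (hE : ∀ {n m : SimplexCategory} (θ : n ⟶ m), QuasiIso (strChain E θ)) :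
    QuasiIso (lanUnit R (cech φ) (cechAug φ) ((laxResolution R (cech φ)).obj E)) := by
  refine quasiIso_of_onChain_projPull hφ _ ?_
  have h := unit_lanBaseChange_chain (R := R) (cechAug φ) (decAug (cech φ))
    (decProj_naturality (cech φ)) (isPullback_decProj φ) ((laxResolution R (cech φ)).obj E)
  have h₁ := quasiIso_lanUnit_dec E hE
  have h₂ := isIso_onChainTrans_app (lanBaseChange (R := R) (cechAug φ) (decAug (cech φ))
    (decProj_naturality (cech φ)) (isPullback_decProj φ)).hom ((laxResolution R (cech φ)).obj E)
    fun _ => inferInstance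
  have h₃ := isIso_onChainTrans_app (restrCompare (R := R) (cechAug φ) (decAug (cech φ))
    (decProj_naturality (cech φ)) fun n => (isPullback_decProj φ n).w).hom
    ((onChain (lan R (cech φ) (cechAug φ))).obj ((laxResolution R (cech φ)).obj E))
    fun _ => inferInstance
  have h₄ := quasiIso_comp (lanUnit R (dec (cech φ)) (decAug (cech φ))
    ((onChain (projPull R (cech φ))).obj ((laxResolution R (cech φ)).obj E)))
    (hφ' := quasiIso_of_isIso ((onChain (restr R (dec (cech φ)) (decAug (cech φ)))).map
      ((onChainTrans (lanBaseChange (cechAug φ) (decAug (cech φ))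
        (decProj_naturality (cech φ)) (isPullback_decProj φ)).hom).app
          ((laxResolution R (cech φ)).obj E))))
  have h₅ := Eq.subst (motive := fun f => QuasiIso f) h h₄
  have h₆ := @quasiIso_of_isIso _ _ _ _ _ _ _ _ h₃ _ _
  exact quasiIso_of_comp_right (hφ := h₆) (hφφ' := h₅) ((onChain (projPull R (cech φ))).map
      (lanUnit R (cech φ) (cechAug φ) ((laxResolution R (cech φ)).obj E)))
    ((onChainTrans (restrCompare (cechAug φ) (decAug (cech φ))
      (decProj_naturality (cech φ)) fun n => (isPullback_decProj φ n).w).hom).app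
        ((onChain (lan R (cech φ) (cechAug φ))).obj ((laxResolution R (cech φ)).obj E)))

end CechUnit

/-! ### Invariance of the condition on structure maps under derived isomorphism -/

section Invariance

variable {C : Type u} [SmallCategory C] [HasPullbacks C] {J : GrothendieckTopology C}
  {R : Sheaf J RingCat.{u}} {X : SimplicialObject C}

/-- The structure maps of lax sections as a natural transformation. -/
def strTrans {n m : SimplexCategory} (θ : n ⟶ m) :
    LaxLimit.evSheaf R X n ⋙ SheafOfModules.overMap.{u} R (X.map θ.op) ⟶
      LaxLimit.evSheaf R X m where
  app E := E.str θ
  naturality _ _ f := f.comm θ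

/-- For fixed `θ` the structure map is a natural transformation between exact functors, so it
descends to derived categories. There its invertibility at an object depends only on the isomorphism
class of that object. -/
lemma quasiIso_strChain_of_iso {E E' : ChainComplex (LaxLimit (modDiagram R X)) ℕ}
    (e : (DPlus.Q _).obj E ≅ (DPlus.Q _).obj E') {n m : SimplexCategory} (θ : n ⟶ m)
    (h : QuasiIso (strChain E θ)) : QuasiIso (strChain E' θ) := by
  let τ := locMapNatTrans (W := HomologicalComplex.quasiIso _ _)
    (W' := HomologicalComplex.quasiIso _ _)
    (G := onChain (LaxLimit.evSheaf R X n ⋙ SheafOfModules.overMap.{u} R (X.map θ.op)))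
    (fun _ _ f (_ : QuasiIso f) => quasiIso_onChain_ev_overMap f n (X.map θ.op))
    (fun _ _ f (_ : QuasiIso f) => quasiIso_onChain_ev f m) (onChainTrans (strTrans (R := R) θ))
  have hτ (K) : τ.app ((DPlus.Q _).obj K) = (DPlus.Q _).map (strChain K θ) :=
    locMapNatTrans_app _ _ _ K
  apply quasiIso_of_isIso_Q_map
  have h' : IsIso ((DPlus.Q _).map (strChain E θ)) :=
    (HomologicalComplex.quasiIso _ _).Q_inverts _ h
  rw [← hτ] at h' ⊢
  exact (NatTrans.isIso_app_iff_of_iso τ e).1 h'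

omit [HasPullbacks C] in
lemma quasiIso_strChain_restr {U : C} (p : X ⟶ (SimplicialObject.const C).obj U)
    (F : ChainComplex (SheafOfModules.{u} (R.over U)) ℕ) {n m : SimplexCategory} (θ : n ⟶ m) :
    QuasiIso (strChain ((onChain (restr R X p)).obj F) θ) := by
  have (k : ℕ) : IsIso ((strChain ((onChain (restr R X p)).obj F) θ).f k) :=
    isIso_str_restr p (F.X k) θ
  have : IsIso (strChain ((onChain (restr R X p)).obj F) θ) :=
    HomologicalComplex.Hom.isIso_of_components _
  infer_instance

end Invariance

end LaxDescent

end

noncomputable section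

namespace LaxDescent

/-! ### Full faithfulness of functors between localizations -/

section Zigzag

variable {𝓒 𝓓 : Type*} [Category* 𝓒] [Category* 𝓓]
  {W : MorphismProperty 𝓒} {W' : MorphismProperty 𝓓}

section

variable {T : 𝓒 ⥤ 𝓓} (hT : ∀ ⦃X Y : 𝓒⦄ (f : X ⟶ Y), W f → W' (T.map f))
  {S : 𝓓 ⥤ 𝓒} (hS : ∀ ⦃X Y : 𝓓⦄ (f : X ⟶ Y), W' f → W (S.map f))
  {B : 𝓒 ⥤ 𝓒} (π : B ⟶ 𝟭 𝓒) (hπ : ∀ X, W (π.app X)) (η : B ⟶ T ⋙ S)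

/-- The components of `locZigzag`. -/
def locZigzagApp (X : 𝓒) : W.Q.obj X ⟶ W.Q.obj (S.obj (T.obj X)) :=
  Localization.Construction.wInv (π.app X) (hπ X) ≫ W.Q.map (η.app X)

lemma Q_map_comp_locZigzagApp (X : 𝓒) :
    W.Q.map (π.app X) ≫ locZigzagApp π hπ η X = W.Q.map (η.app X) :=
  (Localization.Construction.wIso (π.app X) (hπ X)).hom_inv_id_assoc _

lemma locZigzagApp_naturality {X Y : 𝓒} (f : X ⟶ Y) :
    W.Q.map f ≫ locZigzagApp π hπ η Y =
      locZigzagApp π hπ η X ≫ (locMap T hT ⋙ locMap S hS).map (W.Q.map f) := by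
  have e : (locMap T hT ⋙ locMap S hS).map (W.Q.map f) = W.Q.map (S.map (T.map f)) :=
    (congrArg (locMap S hS).map (locMap_map T hT f)).trans (locMap_map S hS _)
  refine Eq.trans ?_ (congrArg (_ ≫ ·) e).symm
  have := W.Q_inverts _ (hπ X)
  refine (cancel_epi (W.Q.map (π.app X))).1 ?_
  have e₁ : W.Q.map (π.app X) ≫ W.Q.map f = W.Q.map (B.map f) ≫ W.Q.map (π.app Y) := by
    rw [← W.Q.map_comp, ← W.Q.map_comp, π.naturality]
    rfl
  refine (Category.assoc _ _ _).symm.trans ((congrArg (· ≫ _) e₁).trans ?_)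
  rw [Category.assoc, Q_map_comp_locZigzagApp]
  refine Eq.trans ?_ (Category.assoc _ _ _)
  refine Eq.trans ?_ (congrArg (· ≫ _) (Q_map_comp_locZigzagApp π hπ η X).symm)
  rw [← W.Q.map_comp]
  exact (congrArg W.Q.map (η.naturality f)).trans (W.Q.map_comp _ _)

/-- The natural transformation between functors on localizations induced by a zigzag. -/
def locZigzag : 𝟭 W.Localization ⟶ locMap T hT ⋙ locMap S hS :=
  locNatTrans (G := locMap T hT ⋙ locMap S hS) (locZigzagApp π hπ η)
    (locZigzagApp_naturality hT hS π hπ η)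

lemma locZigzag_app (X : 𝓒) :
    (locZigzag hT hS π hπ η).app (W.Q.obj X) = locZigzagApp π hπ η X :=
  locNatTrans_app (F := 𝟭 W.Localization) (G := locMap T hT ⋙ locMap S hS) (locZigzagApp π hπ η)
    (locZigzagApp_naturality hT hS π hπ η) X

end

/-- Naturality of `h` at `f : ι X ⟶ ι Y` reads `f ≫ ι(k) = ι(k) ≫ ι(Φ f)`, so `f` is the image of `k
≫ Φ f ≫ k⁻¹`; naturality of `k` gives faithfulness. Invertibility of `h` is not needed. -/
lemma full_and_faithful_of_unit {ι : 𝓒 ⥤ 𝓓} {Φ : 𝓓 ⥤ 𝓒} (k : 𝟭 𝓒 ⟶ ι ⋙ Φ)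
    (hk : ∀ X, IsIso (k.app X)) (h : 𝟭 𝓓 ⟶ Φ ⋙ ι) (hh : ∀ X, h.app (ι.obj X) = ι.map (k.app X)) :
    ι.Full ∧ ι.Faithful := by
  refine ⟨⟨fun {X Y} f => ⟨k.app X ≫ Φ.map f ≫ inv (k.app Y), ?_⟩⟩, ⟨fun {X Y f g} e => ?_⟩⟩
  · rw [← cancel_mono (ι.map (k.app Y)), ← ι.map_comp, Category.assoc, Category.assoc,
      IsIso.inv_hom_id]
    refine (ι.map_comp _ _).trans ?_
    rw [← hh, ← hh]
    exact (congrArg (_ ≫ ·) (congrArg ι.map (Category.comp_id _))).trans (h.naturality f).symm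
  · rw [← cancel_mono (k.app Y)]
    exact (k.naturality f).trans ((congrArg (fun a => k.app X ≫ Φ.map a) e).trans
      (k.naturality g).symm)

/-- The zigzags `X ← B X → Φ X`, formed in `𝓒` and in `𝓓`, supply the two transformations of
`full_and_faithful_of_unit`. Only the one in `𝓓` must consist of weak equivalences on both legs; `c`
compares the two resolutions. -/
lemma full_and_faithful_locMap {j : 𝓓 ⥤ 𝓒}
    (hj : ∀ ⦃X Y : 𝓓⦄ (f : X ⟶ Y), W' f → W (j.map f))
    {Φ : 𝓒 ⥤ 𝓓} (hΦ : ∀ ⦃X Y : 𝓒⦄ (f : X ⟶ Y), W f → W' (Φ.map f))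
    {B : 𝓒 ⥤ 𝓒} (π : B ⟶ 𝟭 𝓒) (hπ : ∀ X, W (π.app X)) (η : B ⟶ Φ ⋙ j)
    {B' : 𝓓 ⥤ 𝓓} (π' : B' ⟶ 𝟭 𝓓) (hπ' : ∀ X, W' (π'.app X)) (η' : B' ⟶ j ⋙ Φ)
    (hη' : ∀ X, W' (η'.app X)) (c : ∀ X, j.obj (B'.obj X) ⟶ B.obj (j.obj X))
    (hc : ∀ X, c X ≫ π.app (j.obj X) = j.map (π'.app X))
    (hc' : ∀ X, c X ≫ η.app (j.obj X) = j.map (η'.app X)) :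
    (locMap j hj).Full ∧ (locMap j hj).Faithful := by
  refine full_and_faithful_of_unit (locZigzag hj hΦ π' hπ' η') (loc_forall fun X => ?_)
    (locZigzag hΦ hj π hπ η) (loc_forall fun X => ?_)
  · rw [locZigzag_app]
    have h₁ := W'.Q_inverts _ (hπ' X)
    have h₂ := W'.Q_inverts _ (hη' X)
    rw [← Q_map_comp_locZigzagApp π' hπ' η' X] at h₂
    exact @IsIso.of_isIso_comp_left _ _ _ _ _ (W'.Q.map (π'.app X)) _ h₁ h₂
  · refine (locZigzag_app hΦ hj π hπ η (j.obj X)).trans ?_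
    rw [locZigzag_app]
    have h₁ := W.Q_inverts _ (hj _ (hπ' X))
    refine (cancel_epi (W.Q.map (j.map (π'.app X)))).1 ?_
    have e : W.Q.map (j.map (π'.app X)) = W.Q.map (c X) ≫ W.Q.map (π.app (j.obj X)) := by
      rw [← W.Q.map_comp, hc]
    have e₁ : W.Q.map (j.map (π'.app X)) ≫ locZigzagApp π hπ η (j.obj X) =
        W.Q.map (j.map (η'.app X)) := by
      rw [e, Category.assoc, Q_map_comp_locZigzagApp, ← W.Q.map_comp, hc']
    refine e₁.trans ?_
    rw [← locMap_map j hj, ← locMap_map j hj, ← Q_map_comp_locZigzagApp π' hπ' η' X]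
    exact (locMap j hj).map_comp _ _

end Zigzag

/-! ### The essential image and full faithfulness over the Čech nerve -/

section Cech

variable {C : Type u} [SmallCategory C] [HasPullbacks C] {J : GrothendieckTopology C}
  {R : Sheaf J RingCat.{u}} {U V : C} {φ : V ⟶ U}

lemma LAX_of_iso {E E' : ChainComplex (LaxLimit (Ω R φ)) ℕ}
    (e : (DPlus.Q _).obj E ≅ (DPlus.Q _).obj E')
    (h : LAX (Ω R φ) ((LaxLimit.chainLaxEquiv (Ω R φ)).functor.obj E)) :
    LAX (Ω R φ) ((LaxLimit.chainLaxEquiv (Ω R φ)).functor.obj E') :=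
  fun _ _ θ => quasiIso_strChain_of_iso e θ (h θ)

variable (R) in
lemma LAX_restrChain (F : ChainComplex (SheafOfModules.{u} (R.over U)) ℕ) :
    LAX (Ω R φ) ((LaxLimit.chainLaxEquiv (Ω R φ)).functor.obj ((restrChain R φ).obj F)) :=
  fun _ _ θ => quasiIso_strChain_restr (cechAug φ) F θ

lemma restrDerived_essImage_iff (hφ : Sieve.generate (Presieve.singleton φ) ∈ J U)
    (E : ChainComplex (LaxLimit (Ω R φ)) ℕ) :
    (restrDerived R φ).essImage ((DPlus.Q _).obj E) ↔
      LAX (Ω R φ) ((LaxLimit.chainLaxEquiv (Ω R φ)).functor.obj E) := by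
  constructor
  · rintro ⟨⟨⟨F⟩⟩, ⟨e⟩⟩
    exact LAX_of_iso (E := (restrChain R φ).obj F) e (LAX_restrChain R F)
  · intro h
    -- The preimage is the left derived functor of restriction at `E`, that is `lan` of the
    -- resolution; the isomorphism is the inverse of the unit at the resolution followed by the
    -- augmentation.
    exact ⟨(DPlus.Q _).obj ((onChain (lan R (cech φ) (cechAug φ))).obj
      ((laxResolution R (cech φ)).obj E)),
      ⟨(Localization.Construction.wIso (W := HomologicalComplex.quasiIso _ _) _
        (quasiIso_lanUnit_cech hφ E fun θ => h θ)).symm ≪≫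
        Localization.Construction.wIso (W := HomologicalComplex.quasiIso _ _)
          ((laxResolutionπ R (cech φ)).app E)
          (inferInstance : QuasiIso ((laxResolutionπ R (cech φ)).app E))⟩⟩

/-- An object of `LAX` is its own preimage; the converse is invariance under isomorphism. The
covering hypothesis enters only in the description of the other image. -/
lemma laxToDPlus_essImage_iff (E : ChainComplex (LaxLimit (Ω R φ)) ℕ) :
    (laxToDPlus (Ω R φ)).essImage ((DPlus.Q _).obj E) ↔
      LAX (Ω R φ) ((LaxLimit.chainLaxEquiv (Ω R φ)).functor.obj E) := by
  constructor
  · rintro ⟨⟨⟨X⟩⟩, ⟨e⟩⟩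
    exact LAX_of_iso (E := (LaxLimit.chainLaxEquiv (Ω R φ)).inverse.obj X.obj) e X.property
  · intro h
    exact ⟨((levelwiseQuasiIso (Ω R φ)).inverseImage (LAX (Ω R φ)).ι).Q.obj ⟨_, h⟩, ⟨Iso.refl _⟩⟩

variable (R φ)

/-- The underlying complex of lax sections. -/
abbrev laxToChain : (LAX (Ω R φ)).FullSubcategory ⥤ ChainComplex (LaxLimit (Ω R φ)) ℕ :=
  (LAX (Ω R φ)).ι ⋙ (LaxLimit.chainLaxEquiv (Ω R φ)).inverse

/-- The resolution of complexes of lax sections whose structure maps are quasi-isomorphisms. -/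
abbrev laxToLax : (LAX (Ω R φ)).FullSubcategory ⥤ (LAX (Ω R φ)).FullSubcategory :=
  (LAX (Ω R φ)).lift
    (laxToChain R φ ⋙ laxResolution R (cech φ) ⋙ (LaxLimit.chainLaxEquiv (Ω R φ)).functor)
    fun X => LAX_of_iso (Localization.Construction.wIso (W := HomologicalComplex.quasiIso _ _)
          ((laxResolutionπ R (cech φ)).app ((laxToChain R φ).obj X))
          (inferInstance : QuasiIso ((laxResolutionπ R (cech φ)).app _))).symm X.property

/-- The derived descent functor. -/
abbrev chainToLax : ChainComplex (LaxLimit (Ω R φ)) ℕ ⥤ (LAX (Ω R φ)).FullSubcategory :=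
  (LAX (Ω R φ)).lift
    (laxResolution R (cech φ) ⋙ onChain (lan R (cech φ) (cechAug φ)) ⋙ restrChain R φ ⋙
      (LaxLimit.chainLaxEquiv (Ω R φ)).functor)
    fun _ => LAX_restrChain R _

variable {φ}

/-- The functor back to `LAX` is `lan` of the resolution, restricted to the Čech nerve; it lands in
`LAX` for every complex. On `LAX` the unit leg of the zigzag is a levelwise quasi-isomorphism by
`quasiIso_lanUnit_cech`. -/
lemma full_and_faithful_laxToDPlus (hφ : Sieve.generate (Presieve.singleton φ) ∈ J U) :
    (laxToDPlus (Ω R φ)).Full ∧ (laxToDPlus (Ω R φ)).Faithful :=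
  full_and_faithful_locMap (W := HomologicalComplex.quasiIso _ _) (j := laxToChain R φ)
    (fun _ _ f hf => (quasiIso_iff_levelwiseQuasiIso _ ((laxToChain R φ).map f)).2 hf)
    (Φ := chainToLax R φ)
    (fun _ _ f (_ : QuasiIso f) => by
      have := quasiIso_laxResolution_map f
      have := quasiIso_onChain_lan_map (cechAug φ) ((laxResolution R (cech φ)).map f)
        (relProj_laxResolution R _ _) (relProj_laxResolution R _ _)
      exact (quasiIso_iff_levelwiseQuasiIso _ _).1 (quasiIso_onChain_restr (cechAug φ)
        ((onChain (lan R (cech φ) (cechAug φ))).map ((laxResolution R (cech φ)).map f))))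
    (laxResolutionπ R (cech φ))
    (fun E => (inferInstance : QuasiIso ((laxResolutionπ R (cech φ)).app E)))
    (Functor.whiskerLeft (laxResolution R (cech φ)) (chainAdj (lanAdj R (cech φ) (cechAug φ))).unit)
    (B' := laxToLax R φ)
    { app X := ObjectProperty.homMk ((LaxLimit.chainLaxEquiv (Ω R φ)).functor.map
        ((laxResolutionπ R (cech φ)).app ((laxToChain R φ).obj X)))
      naturality X Y f := ObjectProperty.hom_ext _
        (congrArg (LaxLimit.chainLaxEquiv (Ω R φ)).functor.map
          ((laxResolutionπ R (cech φ)).naturality ((laxToChain R φ).map f))) }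
    (fun X => (quasiIso_iff_levelwiseQuasiIso _ _).1
      (inferInstance : QuasiIso ((laxResolutionπ R (cech φ)).app ((laxToChain R φ).obj X))))
    { app X := ObjectProperty.homMk ((LaxLimit.chainLaxEquiv (Ω R φ)).functor.map
        (lanUnit R (cech φ) (cechAug φ) ((laxResolution R (cech φ)).obj ((laxToChain R φ).obj X))))
      naturality X Y f := ObjectProperty.hom_ext _
        (congrArg (LaxLimit.chainLaxEquiv (Ω R φ)).functor.map
          ((chainAdj (lanAdj R (cech φ) (cechAug φ))).unit.naturality
            ((laxResolution R (cech φ)).map ((laxToChain R φ).map f)))) }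
    (fun X => (quasiIso_iff_levelwiseQuasiIso _ _).1
      (quasiIso_lanUnit_cech hφ ((laxToChain R φ).obj X) fun θ => X.property θ))
    -- The resolution inside `LAX` is by definition that of the underlying complex, so the
    -- comparison of resolutions is the identity.
    (fun X => 𝟙 ((laxResolution R (cech φ)).obj ((laxToChain R φ).obj X)))
    (fun X => Category.id_comp _)
    (fun X => Category.id_comp _)

end Cech

end LaxDescent

end

/-! ### The descent theorem -/

theorem mainTheorem11 {C : Type u} [SmallCategory C] [HasPullbacks C] (J : GrothendieckTopology C)
    (R : Sheaf J RingCat.{u}) {U V : C} (φ : V ⟶ U)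
    (hφ : Sieve.generate (Presieve.singleton φ) ∈ J U) :
    (∀ E : ChainComplex (LaxLimit (Ω R φ)) ℕ,
      (restrDerived R φ).essImage ((DPlus.Q _).obj E) ↔
        LAX (Ω R φ) ((LaxLimit.chainLaxEquiv (Ω R φ)).functor.obj E)) ∧
    (laxToDPlus (Ω R φ)).Full ∧ (laxToDPlus (Ω R φ)).Faithful ∧
    (laxToDPlus (Ω R φ)).essImage = (restrDerived R φ).essImage := by
  refine ⟨restrDerived_essImage_iff hφ, (full_and_faithful_laxToDPlus R hφ).1,
    (full_and_faithful_laxToDPlus R hφ).2, ?_⟩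
  -- Every object of the derived category is a complex, and both essential images contain it exactly
  -- when it lies in `LAX`.
  ext Y
  obtain ⟨⟨E⟩⟩ := Y
  exact (laxToDPlus_essImage_iff E).trans (restrDerived_essImage_iff hφ E).symm
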